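/- \textsc{Weighted Feedback Arc Set}: given a simple directed graph $G=(V,A)$ on $n$ vertices (no loops or parallel arcs; antiparallel arcs are allowed) with arc weights $w\colon A\to\mathbb{N}=\{0,1,2,\dots\}$, find an ordering $\pi$ of $V$ that minimizes the total weight of the backward arcs, that is, of the arcs $(u,v)\in A$ with $\pi(u)>\pi(v)$. Write $w_{\max}$ for the largest arc weight ($w_{\max}=0$ if $A=\emptyset$). Running times are counted on a random access machine with logarithmic cost, so that an operation on numbers is charged according to their bit lengths. Theorem. For every $\varepsilon>0$ there is a $\delta$ with $0<\delta<1$ such that Weighted Feedback Arc Set can be $(1+\varepsilon)$-approximated in $O\big((2-\delta)^n\cdot\max\{1,\log_2 w_{\max}\}\big)$ time: there are a deterministic algorithm and a constant $C$, both depending only on $\varepsilon$ and $\delta$, such that on every input the algorithm halts within time $C\,(2-\delta)^n\max\{1,\log_2 w_{\max}\}$ (the maximum being read as $1$ if $w_{\max}=0$) and outputs an ordering of $V$ whose backward arcs have total weight at most $(1+\varepsilon)$ times the minimum. In particular, the running time is $O\big((2-\delta)^n\log w_{\max}\big)$ on all inputs with $w_{\max}\ge 2$. -/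

import Mathlib

/-! ### Arc-weighted directed graphs and feedback arc sets -/

/-- A simple directed graph on the vertex set `Fin n` with natural-number arc weights
(antiparallel arcs are allowed). Only the values of `weight` on `arcs` matter. -/
structure WeightedDigraph (n : ℕ) where
  arcs : Finset (Fin n × Fin n)
  loopless : ∀ v, (v, v) ∉ arcs
  weight : Fin n × Fin n → ℕ

namespace WeightedDigraph

variable {n : ℕ}

/-- The largest weight of an arc (`0` if there are no arcs). -/
def maxWeight (G : WeightedDigraph n) : ℕ := G.arcs.sup G.weight

/-- The arcs that are backward with respect to an ordering; `π v` is the position of `v`. -/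
def backwardArcs (G : WeightedDigraph n) (π : Equiv.Perm (Fin n)) : Finset (Fin n × Fin n) :=
  G.arcs.filter fun a => ¬ π a.1 < π a.2

/-- The total weight of the backward arcs of an ordering. -/
def fasCost (G : WeightedDigraph n) (π : Equiv.Perm (Fin n)) : ℕ :=
  ∑ a ∈ G.backwardArcs π, G.weight a

/-- The minimum of `fasCost` over all orderings. -/
def fasOpt (G : WeightedDigraph n) : ℕ :=
  (Finset.univ : Finset (Equiv.Perm (Fin n))).inf' Finset.univ_nonempty G.fasCost

end WeightedDigraph

/-! ### A random access machine with logarithmic (bit-length) cost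

Programs are structured (`while`) programs over registers and memories, all holding natural
numbers of arbitrary size. A program names finitely many registers and memories; memories are
addressed indirectly. Every elementary operation is charged at least the bit lengths of the
addresses and numbers it handles. -/

namespace RAM

/-- The contents of the registers and of the memories. -/
structure State where
  reg : ℕ → ℕ
  mem : ℕ → ℕ → ℕ

inductive Op where
  | add | sub | mul | div | mod | land | lor | xor | lt | eq

namespace Op

/-- `sub` is truncated; `div` and `mod` by zero follow `Nat`; comparisons return `0` or `1`. -/
def eval : Op → ℕ → ℕ → ℕ
  | add, x, y => x + y
  | sub, x, y => x - y
  | mul, x, y => x * y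
  | div, x, y => x / y
  | mod, x, y => x % y
  | land, x, y => Nat.land x y
  | lor, x, y => Nat.lor x y
  | xor, x, y => Nat.xor x y
  | lt, x, y => if x < y then 1 else 0
  | eq, x, y => if x = y then 1 else 0

/-- Multiplication and division are charged the product of the bit lengths (schoolbook
arithmetic), the other operations their sum. -/
def cost : Op → ℕ → ℕ → ℕ
  | mul, x, y => (x.size + 1) * (y.size + 1)
  | div, x, y => (x.size + 1) * (y.size + 1)
  | mod, x, y => (x.size + 1) * (y.size + 1)
  | _, x, y => x.size + y.size + 1

end Op

/-- Expressions: constants, registers, the entry of memory `a` at a computed address, and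
elementary operations. -/
inductive Expr where
  | const (c : ℕ)
  | reg (r : ℕ)
  | load (a : ℕ) (addr : Expr)
  | op (o : Op) (e₁ e₂ : Expr)

namespace Expr

def eval (s : State) : Expr → ℕ
  | const c => c
  | reg r => s.reg r
  | load a e => s.mem a (e.eval s)
  | op o e₁ e₂ => o.eval (e₁.eval s) (e₂.eval s)

/-- The cost of evaluating an expression. -/
def cost (s : State) : Expr → ℕ
  | const c => c.size + 1
  | reg r => (s.reg r).size + 1
  | load a e => e.cost s + (e.eval s).size + (s.mem a (e.eval s)).size + 1
  | op o e₁ e₂ => e₁.cost s + e₂.cost s + o.cost (e₁.eval s) (e₂.eval s)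

end Expr

inductive Program where
  | skip
  | assign (r : ℕ) (e : Expr)
  | store (a : ℕ) (addr e : Expr)
  | seq (p q : Program)
  | ite (e : Expr) (p q : Program)
  | loop (e : Expr) (p : Program)

namespace State

def setReg (s : State) (r x : ℕ) : State :=
  { s with reg := Function.update s.reg r x }

def setMem (s : State) (a i x : ℕ) : State :=
  { s with mem := Function.update s.mem a (Function.update (s.mem a) i x) }

end State

/-- `Exec p s s' t`: started in state `s`, the program `p` halts in state `s'` after time `t`.
A test succeeds if its value is nonzero; `loop e p` repeats `p` while the test `e` succeeds. -/
inductive Exec : Program → State → State → ℕ → Prop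
  | skip (s : State) : Exec .skip s s 1
  | assign (s : State) (r : ℕ) (e : Expr) :
      Exec (.assign r e) s (s.setReg r (e.eval s)) (e.cost s + (e.eval s).size + 1)
  | store (s : State) (a : ℕ) (i e : Expr) :
      Exec (.store a i e) s (s.setMem a (i.eval s) (e.eval s))
        (i.cost s + e.cost s + (i.eval s).size + (e.eval s).size + 1)
  | seq {p q : Program} {s s' s'' : State} {t t' : ℕ} :
      Exec p s s' t → Exec q s' s'' t' → Exec (.seq p q) s s'' (t + t')
  | iteTrue {e : Expr} {p q : Program} {s s' : State} {t : ℕ} :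
      e.eval s ≠ 0 → Exec p s s' t → Exec (.ite e p q) s s' (e.cost s + t + 1)
  | iteFalse {e : Expr} {p q : Program} {s s' : State} {t : ℕ} :
      e.eval s = 0 → Exec q s s' t → Exec (.ite e p q) s s' (e.cost s + t + 1)
  | loopDone {e : Expr} {p : Program} {s : State} :
      e.eval s = 0 → Exec (.loop e p) s s (e.cost s + 1)
  | loopStep {e : Expr} {p : Program} {s s' s'' : State} {t t' : ℕ} :
      e.eval s ≠ 0 → Exec p s s' t → Exec (.loop e p) s' s'' t' →
      Exec (.loop e p) s s'' (e.cost s + t + t' + 1)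

/-- Programs are deterministic: the final state and the running time are unique. -/
theorem Exec.unique {p : Program} {s s₁ s₂ : State} {t₁ t₂ : ℕ}
    (h₁ : Exec p s s₁ t₁) (h₂ : Exec p s s₂ t₂) : s₁ = s₂ ∧ t₁ = t₂ := by
  induction h₁ generalizing s₂ t₂ with
  | skip s => cases h₂; exact ⟨rfl, rfl⟩
  | assign s r e => cases h₂; exact ⟨rfl, rfl⟩
  | store s a i e => cases h₂; exact ⟨rfl, rfl⟩
  | seq _ _ ih ih' =>
    cases h₂ with
    | seq a b =>
      obtain ⟨rfl, rfl⟩ := ih a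
      obtain ⟨rfl, rfl⟩ := ih' b
      exact ⟨rfl, rfl⟩
  | iteTrue h _ ih =>
    cases h₂ with
    | iteTrue _ b => obtain ⟨rfl, rfl⟩ := ih b; exact ⟨rfl, rfl⟩
    | iteFalse h' _ => exact absurd h' h
  | iteFalse h _ ih =>
    cases h₂ with
    | iteTrue h' _ => exact absurd h h'
    | iteFalse _ b => obtain ⟨rfl, rfl⟩ := ih b; exact ⟨rfl, rfl⟩
  | loopDone h =>
    cases h₂ with
    | loopDone _ => exact ⟨rfl, rfl⟩
    | loopStep h' _ _ => exact absurd h h'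
  | loopStep h _ _ ih ih' =>
    cases h₂ with
    | loopDone h' => exact absurd h' h
    | loopStep _ a b =>
      obtain ⟨rfl, rfl⟩ := ih a
      obtain ⟨rfl, rfl⟩ := ih' b
      exact ⟨rfl, rfl⟩

end RAM

/-! ### Solving weighted feedback arc set on the machine -/

namespace WeightedDigraph

variable {n : ℕ}

/-- The initial state on input `G`: register `0` holds `n`; memory `0` holds the adjacency
matrix and memory `1` the weight matrix of `G`, row by row (the entry of `(u, v)` is at address
`u * n + v`, and non-arcs have weight entry `0`); everything else is `0`. -/
def inputState (G : WeightedDigraph n) : RAM.State where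
  reg r := if r = 0 then n else 0
  mem a i :=
    if h : i < n * n then
      let e : Fin n × Fin n := finProdFinEquiv.symm ⟨i, h⟩
      if e ∈ G.arcs then
        if a = 0 then 1 else if a = 1 then G.weight e else 0
      else 0
    else 0

/-- The state `s` presents the ordering `π` as output: the position of vertex `v` is the entry of
memory `2` at address `v`. -/
def OutputIs (s : RAM.State) (π : Equiv.Perm (Fin n)) : Prop :=
  ∀ v : Fin n, s.mem 2 v = π v

end WeightedDigraph

/-- `p` is an `r`-approximation algorithm for weighted feedback arc set: on every arc-weighted
digraph it halts and outputs an ordering whose backward arcs weigh at most `r` times the optimum,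
and it does so within time `T n w`, where `n` is the number of vertices and `w` the largest arc
weight. -/
def ApproximatesWeightedFAS (p : RAM.Program) (r : ℝ) (T : ℕ → ℕ → ℝ) : Prop :=
  ∀ (n : ℕ) (G : WeightedDigraph n), ∃ (s : RAM.State) (t : ℕ) (π : Equiv.Perm (Fin n)),
    RAM.Exec p G.inputState s t ∧ WeightedDigraph.OutputIs s π ∧
      (G.fasCost π : ℝ) ≤ r * (G.fasOpt : ℝ) ∧ (t : ℝ) ≤ T n G.maxWeight

/-! Fix an optimal ordering of weight OPT and scales `a 0 ≤ … ≤ a k` up to `n`. The backward arcs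
whose head has its position in `[a j, a (j + 1))` are disjoint for different `j`, so for some `j`
they weigh at most OPT / `k`. Let `A` be the set of the first `a j` vertices, `R` the set of the
others, and `T ⊆ R` a set with `b = a (j + 1) - a j` elements that minimizes the weight of the arcs
from `R \ T` to `T`. The vertices of the optimal ordering at the positions `[a j, a (j + 1))`
compete with `T`, so this minimum is at most OPT / `k` (`cutWeight_add_headWeight_le`). Place `A`
first, then `T`, then the rest, each block ordered as in the optimum: only arcs from `R \ T` to `T`
can become backward, so the weight is at most (1 + 1/`k`) OPT (`blockWeight_le`; `mul_le_of_beats`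
sums over `j` instead of choosing the best one). The optimal ordering need not be known: all small
sets `A` are tried, `T` depends on `A` alone, and dynamic programming over subsets orders each block
at least as well as the optimum does (`runs_extend`, `Extended.le_inversionWeight`).

Time is saved because no block has more than `n - b` vertices. Let `a j = n / p` and `a (j + 1) = n
/ q` with `2 * q ≤ p`, so that `b ≥ n / (2q) - 1` as real numbers. If `p` is so large compared to
`q` that there are at most 2^(n/(4q)) sets `A`, the dynamic programs cost 2^((1 - 1/(4q)) n) up to
polynomial factors. The cuts are found by brute force, which with all choices of `A` costs 2^(n/2)
up to such factors (`stage_steps_le`). Hence the scales come from a rapidly growing sequence of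
denominators (`exists_denominators`), with `k > 1/ε`.

On the machine, `Runs Z K` counts steps of cost at most `K` on numbers of at most `Z` bits. Both `Z`
and `K` are linear in `n` plus the bit length of the largest weight, so the logarithm enters as a
single factor; polynomial factors in `n` are absorbed by a slightly larger base. -/

namespace RAM

/-! ### Executions with bounded numbers, counted in steps of bounded cost -/

namespace Expr

/-- The number of nodes of an expression. -/
def nodes : Expr → ℕ
  | const _ => 1
  | reg _ => 1
  | load _ e => e.nodes + 1
  | op _ e₁ e₂ => e₁.nodes + e₂.nodes + 1

/-- No multiplications and divisions, and no constants but `0` and `1`. -/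
def linear : Expr → Bool
  | const c => decide (c ≤ 1)
  | reg _ => true
  | load _ e => e.linear
  | op .mul _ _ => false
  | op .div _ _ => false
  | op .mod _ _ => false
  | op _ e₁ e₂ => e₁.linear && e₂.linear

/-- Expressions that can be evaluated in a single step. -/
def simple (e : Expr) : Bool := e.linear && decide (e.nodes ≤ 12)

end Expr

/-- All numbers in the state have at most `Z` bits. -/
def Bdd (Z : ℕ) (s : State) : Prop :=
  (∀ r, s.reg r < 2 ^ Z) ∧ ∀ a i, s.mem a i < 2 ^ Z

theorem Bdd.setReg {Z : ℕ} {s : State} (h : Bdd Z s) {r x : ℕ} (hx : x < 2 ^ Z) :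
    Bdd Z (s.setReg r x) := by
  refine ⟨fun r' => ?_, h.2⟩
  by_cases hr : r' = r
  · subst hr; simpa [State.setReg] using hx
  · simpa [State.setReg, hr] using h.1 r'

theorem Bdd.setMem {Z : ℕ} {s : State} (h : Bdd Z s) {a i x : ℕ} (hx : x < 2 ^ Z) :
    Bdd Z (s.setMem a i x) := by
  refine ⟨h.1, fun a' i' => ?_⟩
  by_cases ha : a' = a
  · subst ha
    by_cases hi : i' = i
    · subst hi; simpa [State.setMem] using hx
    · simpa [State.setMem, hi] using h.2 a' i'
  · simpa [State.setMem, ha] using h.2 a' i'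

/-- Each node adds at most one bit: among the admitted operations addition grows the most, and it at
most doubles the larger operand. -/
theorem Expr.eval_lt {Z : ℕ} {s : State} (h : Bdd Z s) :
    ∀ e : Expr, e.linear = true → e.eval s < 2 ^ (Z + e.nodes)
  | .const c, hl => by
    simp only [Expr.linear, decide_eq_true_eq] at hl
    have : 2 ^ 1 ≤ 2 ^ (Z + 1) := Nat.pow_le_pow_right (by norm_num) (by omega)
    simp only [Expr.eval, Expr.nodes]; omega
  | .reg r, _ => lt_of_lt_of_le (h.1 r) (Nat.pow_le_pow_right (by norm_num) (by simp))
  | .load a e, _ => lt_of_lt_of_le (h.2 a _) (Nat.pow_le_pow_right (by norm_num) (by simp))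
  | .op o e₁ e₂, hl => by
    have key : e₁.linear = true → e₂.linear = true →
        e₁.eval s < 2 ^ (Z + e₁.nodes + e₂.nodes) ∧ e₂.eval s < 2 ^ (Z + e₁.nodes + e₂.nodes) := by
      intro h1 h2
      exact ⟨lt_of_lt_of_le (Expr.eval_lt h e₁ h1) (Nat.pow_le_pow_right (by norm_num) (by omega)),
        lt_of_lt_of_le (Expr.eval_lt h e₂ h2) (Nat.pow_le_pow_right (by norm_num) (by omega))⟩
    have hp : 2 ^ (Z + (Expr.op o e₁ e₂).nodes) = 2 * 2 ^ (Z + e₁.nodes + e₂.nodes) := by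
      simp only [Expr.nodes]; rw [← pow_succ']; congr 1; omega
    have hpos : 1 ≤ 2 ^ (Z + e₁.nodes + e₂.nodes) := Nat.one_le_two_pow
    rw [hp]
    cases o <;> simp only [Expr.linear, Bool.and_eq_true, Bool.false_eq_true] at hl <;>
      obtain ⟨k1, k2⟩ := key hl.1 hl.2 <;> simp only [Expr.eval, Op.eval]
    · omega
    · omega
    · exact lt_of_lt_of_le (Nat.and_lt_two_pow _ k2) (by omega)
    · exact lt_of_lt_of_le (Nat.or_lt_two_pow k1 k2) (by omega)
    · exact lt_of_lt_of_le (Nat.xor_lt_two_pow k1 k2) (by omega)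
    · split_ifs <;> omega
    · split_ifs <;> omega

/-- A node is charged for at most two numbers, which by `Expr.eval_lt` have at most `Z + e.nodes`
bits, plus one unit. -/
theorem Expr.cost_le {Z : ℕ} {s : State} (h : Bdd Z s) :
    ∀ e : Expr, e.linear = true → e.cost s ≤ e.nodes * (2 * (Z + e.nodes) + 1)
  | .const c, hl => by
    simp only [Expr.linear, decide_eq_true_eq] at hl
    have : c.size ≤ 1 := Nat.size_le.2 (by omega)
    simp only [Expr.cost, Expr.nodes]; omega
  | .reg r, _ => by
    have : (s.reg r).size ≤ Z := Nat.size_le.2 (h.1 r)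
    simp only [Expr.cost, Expr.nodes]; omega
  | .load a e, hl => by
    have h1 := Expr.cost_le h e hl
    have h2 : (e.eval s).size ≤ Z + e.nodes := Nat.size_le.2 (Expr.eval_lt h e hl)
    have h3 : (s.mem a (e.eval s)).size ≤ Z := Nat.size_le.2 (h.2 a _)
    simp only [Expr.cost, Expr.nodes]
    nlinarith
  | .op o e₁ e₂, hl => by
    have key : e₁.linear = true → e₂.linear = true →
        e₁.cost s + e₂.cost s + ((e₁.eval s).size + (e₂.eval s).size + 1) ≤
          (e₁.nodes + e₂.nodes + 1) * (2 * (Z + (e₁.nodes + e₂.nodes + 1)) + 1) := by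
      intro l1 l2
      have h1 := Expr.cost_le h e₁ l1
      have h2 := Expr.cost_le h e₂ l2
      have h3 : (e₁.eval s).size ≤ Z + e₁.nodes := Nat.size_le.2 (Expr.eval_lt h e₁ l1)
      have h4 : (e₂.eval s).size ≤ Z + e₂.nodes := Nat.size_le.2 (Expr.eval_lt h e₂ l2)
      nlinarith
    simp only [Expr.cost, Expr.nodes]
    cases o <;> simp only [Expr.linear, Bool.and_eq_true, Bool.false_eq_true] at hl <;>
      exact key hl.1 hl.2

theorem Expr.cost_le_of_simple {Z : ℕ} {s : State} (h : Bdd Z s) {e : Expr}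
    (he : e.simple = true) : e.cost s ≤ 12 * (2 * Z + 25) := by
  simp only [Expr.simple, Bool.and_eq_true, decide_eq_true_eq] at he
  refine (Expr.cost_le h e he.1).trans ?_
  exact Nat.mul_le_mul he.2 (by have := he.2; omega)

/-- Started in `s`, the program halts within `T` steps, each of cost at most `K`, in a state all
of whose numbers have at most `Z` bits, and which satisfies `Q`. -/
def Runs (Z K : ℕ) (p : Program) (s : State) (T : ℕ) (Q : State → Prop) : Prop :=
  ∃ s' t, Exec p s s' t ∧ t ≤ T * K ∧ Bdd Z s' ∧ Q s'

namespace Runs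

variable {Z K : ℕ} {p q : Program} {s : State} {T T' : ℕ} {Q R : State → Prop}

theorem mono (h : Runs Z K p s T Q) (hT : T ≤ T') (hQ : ∀ s', Bdd Z s' → Q s' → R s') :
    Runs Z K p s T' R := by
  obtain ⟨s', t, h1, h2, h3, h4⟩ := h
  exact ⟨s', t, h1, h2.trans (Nat.mul_le_mul_right K hT), h3, hQ s' h3 h4⟩

theorem mono_time (h : Runs Z K p s T Q) (hT : T ≤ T') : Runs Z K p s T' Q :=
  h.mono hT fun _ _ h => h

theorem seq (hp : Runs Z K p s T R) (hq : ∀ s', Bdd Z s' → R s' → Runs Z K q s' T' Q) :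
    Runs Z K (.seq p q) s (T + T') Q := by
  obtain ⟨s', t, h1, h2, h3, h4⟩ := hp
  obtain ⟨s'', t', g1, g2, g3, g4⟩ := hq s' h3 h4
  exact ⟨s'', t + t', .seq h1 g1, by rw [add_mul]; omega, g3, g4⟩

theorem skip (hK : 100 * (Z + 20) ≤ K) (h : Bdd Z s) (hQ : Q s) : Runs Z K .skip s 1 Q :=
  ⟨s, 1, .skip s, by omega, h, hQ⟩

theorem assign (hK : 100 * (Z + 20) ≤ K) (h : Bdd Z s) {r : ℕ} {e : Expr} {x : ℕ}
    (he : e.simple = true) (hx : e.eval s = x) (hlt : x < 2 ^ Z) (hQ : Q (s.setReg r x)) :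
    Runs Z K (.assign r e) s 1 Q := by
  subst hx
  refine ⟨_, _, .assign s r e, ?_, h.setReg hlt, hQ⟩
  have h1 := Expr.cost_le_of_simple h he
  have h2 : (e.eval s).size ≤ Z := Nat.size_le.2 hlt
  omega

/-- The most expensive single step: two simple expressions of cost at most `12 * (2 * Z + 25)` each
and two numbers of `Z` bits. The bound `100 * (Z + 20)` leaves ample room for it. -/
theorem store (hK : 100 * (Z + 20) ≤ K) (h : Bdd Z s) {a : ℕ} {i e : Expr} {j x : ℕ}
    (hi : i.simple = true) (he : e.simple = true) (hj : i.eval s = j) (hx : e.eval s = x)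
    (hjlt : j < 2 ^ Z) (hlt : x < 2 ^ Z) (hQ : Q (s.setMem a j x)) :
    Runs Z K (.store a i e) s 1 Q := by
  subst hx hj
  refine ⟨_, _, .store s a i e, ?_, h.setMem hlt, hQ⟩
  have h1 := Expr.cost_le_of_simple h he
  have h2 : (e.eval s).size ≤ Z := Nat.size_le.2 hlt
  have h3 := Expr.cost_le_of_simple h hi
  have h4 : (i.eval s).size ≤ Z := Nat.size_le.2 hjlt
  omega

theorem ite (hK : 100 * (Z + 20) ≤ K) (h : Bdd Z s) {e : Expr} (he : e.simple = true)
    (hp : e.eval s ≠ 0 → Runs Z K p s T Q) (hq : e.eval s = 0 → Runs Z K q s T Q) :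
    Runs Z K (.ite e p q) s (T + 1) Q := by
  have h1 := Expr.cost_le_of_simple h he
  by_cases h0 : e.eval s = 0
  · obtain ⟨s', t, g1, g2, g3, g4⟩ := hq h0
    exact ⟨s', _, .iteFalse h0 g1, by rw [add_mul]; omega, g3, g4⟩
  · obtain ⟨s', t, g1, g2, g3, g4⟩ := hp h0
    exact ⟨s', _, .iteTrue h0 g1, by rw [add_mul]; omega, g3, g4⟩

/-- A conditional without alternative. -/
theorem when (hK : 100 * (Z + 20) ≤ K) (h : Bdd Z s) {e : Expr} (he : e.simple = true)
    (hp : e.eval s ≠ 0 → Runs Z K p s T Q) (hq : e.eval s = 0 → Q s) :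
    Runs Z K (.ite e p .skip) s (T + 2) Q :=
  (ite hK h he (fun h0 => (hp h0).mono_time (Nat.le_succ T))
    (fun h0 => (skip hK h (hq h0)).mono_time (by omega)))

end Runs

/-- Repeat `body` with register `i` running from `0` to the content of register `N`. -/
def forLoop (i N : ℕ) (body : Program) : Program :=
  .seq (.assign i (.const 0))
    (.loop (.op .lt (.reg i) (.reg N)) (.seq body (.assign i (.op .add (.reg i) (.const 1)))))

/-- A round costs `T` steps for the body, one for the test and one for the increment; the
initialization and the last test give the extra 2. The invariant for `k + 1` is required of the
state in which the counter has already been increased, so the body itself must leave the counter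
alone. -/
theorem Runs.forLoop {Z K T N i b : ℕ} {body : Program} {s : State} {Q : State → Prop}
    (Inv : ℕ → State → Prop) (hK : 100 * (Z + 20) ≤ K) (h : Bdd Z s) (hN : N < 2 ^ Z)
    (h0 : Inv 0 (s.setReg i 0))
    (hreg : ∀ k s, Inv k s → s.reg i = k ∧ s.reg b = N)
    (hstep : ∀ k s, k < N → Bdd Z s → Inv k s →
      Runs Z K body s T fun s' => s'.reg i = k ∧ Inv (k + 1) (s'.setReg i (k + 1)))
    (hQ : ∀ s, Bdd Z s → Inv N s → Q s) :
    Runs Z K (forLoop i b body) s (N * (T + 2) + 2) Q := by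
  -- Induction on the number `m` of rounds that remain.
  have main : ∀ m k s, m + k = N → Bdd Z s → Inv k s →
      Runs Z K (.loop (.op .lt (.reg i) (.reg b))
        (.seq body (.assign i (.op .add (.reg i) (.const 1))))) s (m * (T + 2) + 1) Q := by
    intro m
    induction m with
    | zero =>
      intro k s hk hb hinv
      obtain ⟨e1, e2⟩ := hreg k s hinv
      have hz : (Expr.op Op.lt (Expr.reg i) (Expr.reg b)).eval s = 0 := by
        simp [Expr.eval, Op.eval, e1, e2, ← hk]
      refine ⟨s, _, .loopDone hz, ?_, hb, hQ s hb (by simpa [← hk] using hinv)⟩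
      have := Expr.cost_le_of_simple hb (e := Expr.op Op.lt (Expr.reg i) (Expr.reg b)) rfl
      omega
    | succ m ih =>
      intro k s hk hb hinv
      obtain ⟨e1, e2⟩ := hreg k s hinv
      have hz : (Expr.op Op.lt (Expr.reg i) (Expr.reg b)).eval s ≠ 0 := by
        have : k < N := by omega
        simp [Expr.eval, Op.eval, e1, e2, this]
      have hb1 : Runs Z K (.seq body (.assign i (.op .add (.reg i) (.const 1)))) s (T + 1)
          (Inv (k + 1)) := by
        refine Runs.seq (hstep k s (by omega) hb hinv) fun s' hb' hs' => ?_
        refine Runs.assign hK hb' (x := k + 1) rfl ?_ (by omega) hs'.2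
        simp [Expr.eval, Op.eval, hs'.1]
      obtain ⟨s', t, g1, g2, g3, g4⟩ := hb1
      obtain ⟨s'', t', f1, f2, f3, f4⟩ := ih (k + 1) s' (by omega) g3 g4
      refine ⟨s'', _, .loopStep hz g1 f1, ?_, f3, f4⟩
      have := Expr.cost_le_of_simple hb (e := Expr.op Op.lt (Expr.reg i) (Expr.reg b)) rfl
      have e : ((m + 1) * (T + 2) + 1) * K = (T + 1) * K + (m * (T + 2) + 1) * K + K := by ring
      omega
  refine (Runs.seq (R := Inv 0) (T := 1) ?_ fun s' hb' hs' => main N 0 s' rfl hb' hs').mono_time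
    (by omega)
  exact Runs.assign hK h rfl rfl (by positivity) h0

end RAM

/-! ### Sets of natural numbers as bit masks -/

/-- The number whose binary digits are the indicator of `F`. -/
def mask (F : Finset ℕ) : ℕ := ∑ i ∈ F, 2 ^ i

theorem mask_empty : mask ∅ = 0 := rfl

theorem mask_insert {F : Finset ℕ} {v : ℕ} (h : v ∉ F) : mask (insert v F) = mask F + 2 ^ v := by
  rw [mask, Finset.sum_insert h, add_comm]; rfl

theorem mask_erase {F : Finset ℕ} {v : ℕ} (h : v ∈ F) : mask F - 2 ^ v = mask (F.erase v) := by
  have := Finset.sum_erase_add F (fun i => 2 ^ i) h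
  simp only [mask] at *
  omega

theorem mask_union {F G : Finset ℕ} (h : Disjoint F G) : mask (F ∪ G) = mask F + mask G :=
  Finset.sum_union h

theorem mask_sdiff {F G : Finset ℕ} (h : G ⊆ F) : mask F - mask G = mask (F \ G) := by
  have := Finset.sum_sdiff (f := fun i => 2 ^ i) h
  simp only [mask] at *
  omega

theorem mask_range (n : ℕ) : mask (Finset.range n) = 2 ^ n - 1 := by
  rw [mask, Nat.geomSum_eq le_rfl]; simp

theorem mask_le_mask {F G : Finset ℕ} (h : F ⊆ G) : mask F ≤ mask G :=
  Finset.sum_le_sum_of_subset h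

theorem mask_lt_two_pow {F : Finset ℕ} {n : ℕ} (h : F ⊆ Finset.range n) : mask F < 2 ^ n := by
  have := mask_le_mask h
  rw [mask_range] at this
  have := Nat.one_le_two_pow (n := n)
  omega

/-- Adding a new maximum `m` to `F` does not disturb the lower digits, because `mask F < 2 ^ m`. -/
theorem testBit_mask (F : Finset ℕ) (v : ℕ) : (mask F).testBit v = decide (v ∈ F) := by
  induction F using Finset.induction_on_max with
  | empty => simp [mask_empty]
  | insert m F hm ih =>
    have hlt : mask F < 2 ^ m := mask_lt_two_pow fun x hx => Finset.mem_range.2 (hm x hx)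
    have hmF : m ∉ F := fun h => lt_irrefl _ (hm m h)
    rw [mask_insert hmF, add_comm]
    rcases lt_trichotomy v m with hv | hv | hv
    · rw [Nat.testBit_two_pow_add_gt hv, ih]
      simp [hv.ne]
    · subst hv
      rw [Nat.testBit_two_pow_add_eq, Nat.testBit_lt_two_pow hlt]
      simp
    · have hvF : v ∉ F := fun h => by have := hm v h; omega
      rw [Nat.testBit_lt_two_pow]
      · simp [hvF, hv.ne']
      · have : 2 ^ (m + 1) ≤ 2 ^ v := Nat.pow_le_pow_right (by norm_num) hv
        rw [pow_succ] at this
        omega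

theorem mask_injective : Function.Injective mask := fun F G h => by
  ext v
  have := congrArg (fun m => m.testBit v) h
  simpa [testBit_mask] using this

theorem land_mask {F : Finset ℕ} {v : ℕ} : Nat.land (mask F) (2 ^ v) ≠ 0 ↔ v ∈ F := by
  have : Nat.land (mask F) (2 ^ v) = mask F &&& 2 ^ v := rfl
  rw [this, Nat.and_two_pow, testBit_mask]
  by_cases h : v ∈ F <;> simp [h]

theorem mask_eq_zero {F : Finset ℕ} : mask F = 0 ↔ F = ∅ :=
  ⟨fun h => mask_injective (h.trans mask_empty.symm), fun h => h ▸ mask_empty⟩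

/-- The numerical order of masks refines inclusion. Tables filled in order of increasing address
therefore have the entries of all proper subsets at hand. -/
theorem mask_lt_mask {F G : Finset ℕ} (h : F ⊂ G) : mask F < mask G :=
  lt_of_le_of_ne (mask_le_mask h.subset) fun e => h.ne (mask_injective e)

/-! ### Listing the subsets of bounded size -/

/-- The subsets of `U ∩ {0, …, n - 1}` with at most `a` elements, ordered by their masks. -/
def subsList (U : Finset ℕ) (a : ℕ) : ℕ → List (Finset ℕ)
  | 0 => [∅]
  | v + 1 => subsList U a v ++
      if v ∈ U then ((subsList U a v).filter fun F => F.card < a).map (insert v) else []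

section

variable {U F : Finset ℕ} {a n : ℕ}

/-- The sets that contain `v` arise from those below `v` with fewer than `a` elements, so no set of
more than `a` elements is ever created. -/
theorem mem_subsList : F ∈ subsList U a n ↔ F ⊆ U ∧ F ⊆ Finset.range n ∧ F.card ≤ a := by
  induction n generalizing F with
  | zero =>
    simp only [subsList, List.mem_singleton, Finset.range_zero, Finset.subset_empty]
    constructor
    · rintro rfl; simp
    · exact fun h => h.2.1
  | succ v ih =>
    rw [subsList, List.mem_append, ih]
    have key : (F ⊆ U ∧ F ⊆ Finset.range (v + 1) ∧ F.card ≤ a ∧ v ∈ F) ↔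
        F ∈ (if v ∈ U then ((subsList U a v).filter fun F => F.card < a).map (insert v)
          else []) := by
      split_ifs with hv
      · simp only [List.mem_map, List.mem_filter, ih, decide_eq_true_eq]
        constructor
        · rintro ⟨h1, h2, h3, h4⟩
          refine ⟨F.erase v, ⟨⟨(Finset.erase_subset _ _).trans h1, fun x hx => ?_, ?_⟩, ?_⟩,
            Finset.insert_erase h4⟩
          · have := Finset.mem_range.1 (h2 (Finset.mem_of_mem_erase hx))
            have := Finset.ne_of_mem_erase hx
            exact Finset.mem_range.2 (by omega)
          · exact (Finset.card_le_card (Finset.erase_subset _ _)).trans h3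
          · exact lt_of_lt_of_le (Finset.card_erase_lt_of_mem h4) h3
        · rintro ⟨G, ⟨⟨h1, h2, -⟩, h3⟩, rfl⟩
          refine ⟨Finset.insert_subset hv h1, Finset.insert_subset (by simp) (h2.trans ?_),
            (Finset.card_insert_le _ _).trans h3, Finset.mem_insert_self _ _⟩
          exact Finset.range_mono (Nat.le_succ v)
      · simp only [List.not_mem_nil, iff_false]
        exact fun h => hv (h.1 h.2.2.2)
    rw [← key]
    constructor
    · rintro (⟨h1, h2, h3⟩ | ⟨h1, h2, h3, -⟩)
      · exact ⟨h1, h2.trans (Finset.range_mono (Nat.le_succ v)), h3⟩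
      · exact ⟨h1, h2, h3⟩
    · rintro ⟨h1, h2, h3⟩
      by_cases hv : v ∈ F
      · exact .inr ⟨h1, h2, h3, hv⟩
      · refine .inl ⟨h1, fun x hx => ?_, h3⟩
        have := Finset.mem_range.1 (h2 hx)
        have : x ≠ v := fun h => hv (h ▸ hx)
        exact Finset.mem_range.2 (by omega)

/-- The sets appended for `v` have masks at least `2 ^ v`, the earlier ones have smaller masks, and
adding `2 ^ v` keeps the order. -/
theorem subsList_sorted : (subsList U a n).Pairwise fun F G => mask F < mask G := by
  induction n with
  | zero => simp [subsList]
  | succ v ih =>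
    rw [subsList, List.pairwise_append]
    refine ⟨ih, ?_, ?_⟩
    · split_ifs
      · rw [List.pairwise_map]
        refine (ih.filter _).imp_of_mem fun {F G} hF hG h => ?_
        have hF' := (mem_subsList.1 (List.mem_filter.1 hF).1).2.1
        have hG' := (mem_subsList.1 (List.mem_filter.1 hG).1).2.1
        rw [mask_insert fun h => by simpa using hF' h, mask_insert fun h => by simpa using hG' h]
        omega
      · exact List.Pairwise.nil
    · intro F hF G hG
      split_ifs at hG
      · obtain ⟨G', hG', rfl⟩ := List.mem_map.1 hG
        have hG'' := (mem_subsList.1 (List.mem_filter.1 hG').1).2.1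
        rw [mask_insert fun h => by simpa using hG'' h]
        have := mask_lt_two_pow (mem_subsList.1 hF).2.1
        omega
      · simp at hG

theorem subsList_nodup : (subsList U a n).Nodup :=
  subsList_sorted.imp fun h e => by simp [e] at h

theorem length_subsList_le_two_pow : (subsList U a n).length ≤ 2 ^ n := by
  rw [← List.toFinset_card_of_nodup subsList_nodup, ← Finset.card_range n, ← Finset.card_powerset,
    Finset.card_range]
  exact Finset.card_le_card fun F hF =>
    Finset.mem_powerset.2 (mem_subsList.1 (List.mem_toFinset.1 hF)).2.1

theorem length_subsList_le_two_pow_card : (subsList U a n).length ≤ 2 ^ U.card := by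
  rw [← List.toFinset_card_of_nodup subsList_nodup, ← Finset.card_powerset]
  exact Finset.card_le_card fun F hF =>
    Finset.mem_powerset.2 (mem_subsList.1 (List.mem_toFinset.1 hF)).1

theorem empty_mem_subsList : ∅ ∈ subsList U a n := mem_subsList.2 (by simp)

/-- Bounds every intermediate list by the final one, so that listing takes time proportional to `n`
times the length of the output rather than `2 ^ n`. -/
theorem subsList_length_mono {v : ℕ} (h : v ≤ n) :
    (subsList U a v).length ≤ (subsList U a n).length := by
  induction h with
  | refl => exact le_rfl
  | step _ ih => rw [subsList, List.length_append]; omega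

/-- The number of sets with at most `a` of `n` elements. -/
def smallSets (n a : ℕ) : ℕ := ((Finset.range n).powerset.filter fun F => F.card ≤ a).card

theorem length_subsList_le_smallSets : (subsList U a n).length ≤ smallSets n a := by
  rw [← List.toFinset_card_of_nodup subsList_nodup]
  refine Finset.card_le_card fun F hF => ?_
  have := mem_subsList.1 (List.mem_toFinset.1 hF)
  exact Finset.mem_filter.2 ⟨Finset.mem_powerset.2 this.2.1, this.2.2⟩

end

/-! ### Reading a state after an update -/

namespace RAM

theorem State.setReg_reg (s : State) (r x r' : ℕ) :
    (s.setReg r x).reg r' = if r' = r then x else s.reg r' := by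
  simp [State.setReg, Function.update_apply]

theorem State.setReg_mem (s : State) (r x : ℕ) : (s.setReg r x).mem = s.mem := rfl

theorem State.setMem_reg (s : State) (a i x : ℕ) : (s.setMem a i x).reg = s.reg := rfl

theorem State.setMem_mem (s : State) (a i x a' : ℕ) : (s.setMem a i x).mem a' =
    if a' = a then Function.update (s.mem a) i x else s.mem a' := by
  simp [State.setMem, Function.update_apply]

theorem State.setMem_mem_of_ne (s : State) {a a' : ℕ} (i x : ℕ) (h : a' ≠ a) :
    (s.setMem a i x).mem a' = s.mem a' := by
  rw [State.setMem_mem, if_neg h]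

theorem State.setMem_mem_self (s : State) (a i x : ℕ) :
    (s.setMem a i x).mem a = Function.update (s.mem a) i x := by
  rw [State.setMem_mem, if_pos rfl]

end RAM

/-! ### Bit lengths, stored tables and row sums -/

open RAM Finset

/-- The bit length `Z` suffices for all numbers that occur on graphs with `n` vertices and
weights up to `w`, and `K` bounds the cost of a step on such numbers. -/
structure Setup (n w Z K : ℕ) (W : ℕ → ℕ → ℕ) : Prop where
  weight_le : ∀ u v, W u v ≤ w
  -- The summands make room for weights of orderings, for masks, list lengths and powers of two, for
  -- row offsets, and for the shift by one of tracked minima.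
  lt_two_pow : n * n * w + 2 ^ (n + 1) + n * n + 2 < 2 ^ Z
  le_cost : 100 * (Z + 20) ≤ K

/-- The weight of the arcs from `v` to `F`. -/
def outWeight (W : ℕ → ℕ → ℕ) (v : ℕ) (F : Finset ℕ) : ℕ := ∑ u ∈ F, W v u

/-- The weights, the row offsets and the powers of two are stored in the machine. -/
structure Env (n : ℕ) (W : ℕ → ℕ → ℕ) (s : State) : Prop where
  size : s.reg 0 = n
  full : s.reg 1 = mask (range n)
  weight : ∀ u < n, ∀ v < n, s.mem 1 (u * n + v) = W u v
  row : ∀ u < n, s.mem 9 u = u * n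
  pow : ∀ u < n, s.mem 10 u = 2 ^ u

namespace Setup

variable {n w Z K : ℕ} {W : ℕ → ℕ → ℕ} (S : Setup n w Z K W)
include S

theorem n_lt : n < 2 ^ Z := by
  have := S.lt_two_pow
  have : n < 2 ^ n := Nat.lt_two_pow_self
  rw [pow_succ] at *
  omega

theorem lt_of_le_weight {x : ℕ} (h : x ≤ n * n * w + 2) : x < 2 ^ Z := by
  refine lt_of_le_of_lt (h.trans ?_) S.lt_two_pow
  rw [add_assoc (n * n * w), add_assoc (n * n * w)]
  exact Nat.add_le_add_left (Nat.le_add_left _ _) _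

theorem pow_lt : 2 ^ (n + 1) < 2 ^ Z := by
  have := S.lt_two_pow
  omega

theorem mask_lt {F : Finset ℕ} (h : F ⊆ range n) : mask F < 2 ^ Z := by
  have := mask_lt_two_pow h
  have := S.pow_lt
  rw [pow_succ] at this
  omega

theorem outWeight_le (v : ℕ) {F : Finset ℕ} (h : F ⊆ range n) : outWeight W v F ≤ n * w := by
  calc outWeight W v F ≤ ∑ _u ∈ F, w := sum_le_sum fun u _ => S.weight_le v u
    _ ≤ n * w := by
      rw [sum_const, smul_eq_mul]
      exact Nat.mul_le_mul_right _ (by simpa using card_le_card h)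

theorem sum_outWeight_le {F G : Finset ℕ} (hF : F ⊆ range n) (hG : G ⊆ range n) :
    ∑ v ∈ F, outWeight W v G ≤ n * n * w := by
  calc ∑ v ∈ F, outWeight W v G ≤ ∑ _v ∈ F, n * w := sum_le_sum fun v _ => S.outWeight_le v hG
    _ ≤ n * n * w := by
      rw [sum_const, smul_eq_mul, mul_assoc]
      exact Nat.mul_le_mul_right _ (by simpa using card_le_card hF)

end Setup

/-- Nonzero if and only if the bit of `m` at the position `v` is set. -/
def bitTest (m v : Expr) : Expr := .op .land m (.load 10 v)

theorem bitTest_ne_zero {n : ℕ} {W : ℕ → ℕ → ℕ} {s : State} (E : Env n W s) {m v : Expr}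
    {F : Finset ℕ} (hm : m.eval s = mask F) (hv : v.eval s < n) :
    (bitTest m v).eval s ≠ 0 ↔ v.eval s ∈ F := by
  rw [← land_mask, ← hm, ← E.pow _ hv]; rfl

theorem Env.congr {n : ℕ} {W : ℕ → ℕ → ℕ} {s s' : State} (E : Env n W s)
    (h0 : s'.reg 0 = s.reg 0) (h1 : s'.reg 1 = s.reg 1) (m1 : s'.mem 1 = s.mem 1)
    (m9 : s'.mem 9 = s.mem 9) (m10 : s'.mem 10 = s.mem 10) : Env n W s' where
  size := h0.trans E.size
  full := h1.trans E.full
  weight := by rw [m1]; exact E.weight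
  row := by rw [m9]; exact E.row
  pow := by rw [m10]; exact E.pow

theorem filter_lt_succ_of_mem {F : Finset ℕ} {k : ℕ} (h : k ∈ F) :
    F.filter (· < k + 1) = insert k (F.filter (· < k)) := by
  ext x; simp only [mem_filter, mem_insert, Nat.lt_succ_iff_lt_or_eq]
  constructor
  · rintro ⟨h1, h2 | h2⟩ <;> simp [*]
  · rintro (rfl | ⟨h1, h2⟩) <;> simp [*]

theorem filter_lt_succ_of_notMem {F : Finset ℕ} {k : ℕ} (h : k ∉ F) :
    F.filter (· < k + 1) = F.filter (· < k) := by
  ext x; simp only [mem_filter, Nat.lt_succ_iff_lt_or_eq]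
  constructor
  · rintro ⟨h1, h2 | rfl⟩
    · exact ⟨h1, h2⟩
    · exact absurd h1 h
  · rintro ⟨h1, h2⟩; exact ⟨h1, .inl h2⟩

theorem filter_lt_of_subset {F : Finset ℕ} {n : ℕ} (h : F ⊆ range n) : F.filter (· < n) = F :=
  filter_true_of_mem fun _ hx => mem_range.1 (h hx)

/-- Put into register `33` the weight of the arcs from the vertex in register `30` to the set in
register `31`. -/
def rowSum : Program :=
  .seq (.assign 33 (.const 0))
    (forLoop 32 0 (.ite (bitTest (.reg 31) (.reg 32))
      (.assign 33 (.op .add (.reg 33) (.load 1 (.op .add (.load 9 (.reg 30)) (.reg 32))))) .skip))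

section

variable {n w Z K : ℕ} {W : ℕ → ℕ → ℕ}

/-- Like the later specifications, this one combines the result with a frame condition: registers
below a threshold and the memories not in use keep their contents. Callers hold their data there. -/
theorem runs_rowSum (S : Setup n w Z K W) {s : State} (hb : Bdd Z s) (E : Env n W s) {v : ℕ}
    {F : Finset ℕ} (hv : v < n) (hF : F ⊆ range n) (h30 : s.reg 30 = v) (h31 : s.reg 31 = mask F) :
    Runs Z K rowSum s (5 * n + 3) fun s' =>
      s'.reg 33 = outWeight W v F ∧ (∀ r < 32, s'.reg r = s.reg r) ∧ s'.mem = s.mem := by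
  refine (Runs.seq (T := 1) (T' := n * (3 + 2) + 2)
    (R := fun s1 => s1.reg 33 = 0 ∧ (∀ r < 32, s1.reg r = s.reg r) ∧ s1.mem = s.mem)
    (Runs.assign S.le_cost hb rfl rfl (by positivity) ?_) ?_).mono_time (by omega)
  · refine ⟨by simp [State.setReg_reg, Expr.eval], fun r hr => ?_, rfl⟩
    rw [State.setReg_reg, if_neg (by omega)]
  rintro s1 hb1 ⟨e33, eR, eM⟩
  refine Runs.forLoop (N := n) (fun k t => t.reg 32 = k ∧
    t.reg 33 = outWeight W v (F.filter (· < k)) ∧ (∀ r < 32, t.reg r = s.reg r) ∧ t.mem = s.mem)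
    S.le_cost hb1 S.n_lt ?_ ?_ ?_ ?_
  · refine ⟨by simp [State.setReg_reg], by simp [State.setReg_reg, e33, outWeight], fun r hr => ?_,
      eM⟩
    rw [State.setReg_reg, if_neg (by omega), eR r hr]
  · rintro k t ⟨h1, -, h3, -⟩
    exact ⟨h1, (h3 0 (by norm_num)).trans E.size⟩
  · rintro k t hk hbt ⟨h1, h2, h3, h4⟩
    have Et : Env n W t := E.congr (h3 0 (by norm_num)) (h3 1 (by norm_num)) (by rw [h4])
      (by rw [h4]) (by rw [h4])
    have hbit := bitTest_ne_zero Et (m := .reg 31) (v := .reg 32) (F := F)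
      ((h3 31 (by norm_num)).trans h31) (by simpa [Expr.eval, h1] using hk)
    simp only [Expr.eval, h1] at hbit
    refine Runs.when S.le_cost hbt rfl (fun h0 => ?_) (fun h0 => ?_)
    · have hkF := hbit.1 h0
      have hval : outWeight W v (F.filter (· < k + 1)) =
          outWeight W v (F.filter (· < k)) + W v k := by
        rw [filter_lt_succ_of_mem hkF, outWeight, sum_insert (by simp), add_comm]; rfl
      have hle := S.outWeight_le v ((filter_subset (· < k + 1) F).trans hF)
      have hnw : n * w ≤ n * n * w :=
        Nat.mul_le_mul_right _ (Nat.le_mul_of_pos_left n (by omega))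
      refine Runs.assign S.le_cost hbt (x := outWeight W v (F.filter (· < k + 1))) rfl ?_
        (S.lt_of_le_weight (by omega)) ?_
      · rw [hval]
        simp only [Expr.eval, Op.eval, h1, h2, h3 30 (by norm_num), h30, Et.row v hv,
          Et.weight v hv k hk]
      · refine ⟨by simp [State.setReg_reg, h1], by simp [State.setReg_reg],
          by simp [State.setReg_reg], fun r hr => ?_, h4⟩
        rw [State.setReg_reg, if_neg (by omega), State.setReg_reg, if_neg (by omega), h3 r hr]
    · have hkF : k ∉ F := fun h => hbit.2 h h0
      refine ⟨h1, by simp [State.setReg_reg], ?_, fun r hr => ?_, h4⟩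
      · rw [State.setReg_reg, if_neg (by norm_num), filter_lt_succ_of_notMem hkF, h2]
      · rw [State.setReg_reg, if_neg (by omega), h3 r hr]
  · rintro t - ⟨h1, h2, h3, h4⟩
    exact ⟨by rw [h2, filter_lt_of_subset hF], h3, h4⟩

/-! ### The program that lists subsets -/

/-- The memory cells `0, 1, …` hold the masks of the sets in `l`. -/
def Listed (l : List (Finset ℕ)) (f : ℕ → ℕ) : Prop :=
  ∀ i (h : i < l.length), f i = mask l[i]

theorem Listed.append_singleton {l : List (Finset ℕ)} {f : ℕ → ℕ} (h : Listed l f)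
    (F : Finset ℕ) : Listed (l ++ [F]) (Function.update f l.length (mask F)) := by
  intro i hi
  rw [List.length_append, List.length_singleton] at hi
  rcases Nat.lt_succ_iff_lt_or_eq.1 hi with h' | rfl
  · rw [Function.update_of_ne h'.ne, h i h', List.getElem_append_left h']
  · simp

/-- Write into memory `m` the list of the subsets of the set in register `40` with at most as many
elements as register `41` says, and into register `45` the length of the list. Memory `8` receives
the number of elements of each of these sets, addressed by its mask. -/
def listSubsets (m : ℕ) : Program :=
  .seq (.store m (.const 0) (.const 0)) <|
  .seq (.store 8 (.const 0) (.const 0)) <|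
  .seq (.assign 45 (.const 1)) <|
  forLoop 42 0 <| .ite (bitTest (.reg 40) (.reg 42))
    (.seq (.assign 43 (.reg 45)) <|
      forLoop 44 43 <| .ite (.op .lt (.load 8 (.load m (.reg 44))) (.reg 41))
        (.seq (.store m (.reg 45) (.op .add (.load m (.reg 44)) (.load 10 (.reg 42)))) <|
          .seq (.store 8 (.load m (.reg 45)) (.op .add (.load 8 (.load m (.reg 44))) (.const 1))) <|
          .assign 45 (.op .add (.reg 45) (.const 1))) .skip)
    .skip

/-- The state of the machine while it lists subsets: the sets in `l` are listed. -/
structure Listing (m : ℕ) (s₀ : State) (l : List (Finset ℕ)) (s : State) : Prop where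
  length : s.reg 45 = l.length
  listed : Listed l (s.mem m)
  card : ∀ F ∈ l, s.mem 8 (mask F) = F.card
  regs : ∀ r < 42, s.reg r = s₀.reg r
  mems : ∀ a, a ≠ m → a ≠ 8 → s.mem a = s₀.mem a

theorem Listing.setReg {m : ℕ} {s₀ s : State} {l : List (Finset ℕ)} (h : Listing m s₀ l s)
    {r x : ℕ} (hr : 42 ≤ r) (hr' : r ≠ 45) : Listing m s₀ l (s.setReg r x) where
  length := by rw [State.setReg_reg, if_neg hr'.symm, h.length]
  listed := h.listed
  card := h.card
  regs := fun r' hr' => by rw [State.setReg_reg, if_neg (by omega), h.regs r' hr']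
  mems := h.mems

theorem Listing.env {m : ℕ} {s₀ s : State} {l : List (Finset ℕ)} (h : Listing m s₀ l s)
    (hm : m < 8) (hm1 : m ≠ 1) (E : Env n W s₀) : Env n W s :=
  E.congr (h.regs 0 (by norm_num)) (h.regs 1 (by norm_num)) (h.mems 1 hm1.symm (by norm_num))
    (h.mems 9 (by omega) (by norm_num)) (h.mems 10 (by omega) (by norm_num))

theorem runs_listSubsets_push (S : Setup n w Z K W) {m : ℕ} (hm : m < 8) (hm1 : m ≠ 1)
    {s₀ s : State} (hb : Bdd Z s) (E : Env n W s₀) {l : List (Finset ℕ)} {F : Finset ℕ} {v k : ℕ}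
    (hL : Listing m s₀ l s) (hv : v < n) (hF : F ⊆ range v) (hk : k < l.length) (hlk : l[k] = F)
    (h42 : s.reg 42 = v) (h44 : s.reg 44 = k) (hlen : l.length < 2 ^ n) :
    Runs Z K (.seq (.store m (.reg 45) (.op .add (.load m (.reg 44)) (.load 10 (.reg 42)))) <|
        .seq (.store 8 (.load m (.reg 45)) (.op .add (.load 8 (.load m (.reg 44))) (.const 1))) <|
        .assign 45 (.op .add (.reg 45) (.const 1))) s 3 fun s' =>
      Listing m s₀ (l ++ [insert v F]) s' ∧ s'.reg 42 = v ∧ s'.reg 43 = s.reg 43 ∧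
        s'.reg 44 = k := by
  have hvF : v ∉ F := fun h => by simpa using hF h
  have hFn : insert v F ⊆ range n :=
    insert_subset (mem_range.2 hv) (hF.trans (range_mono hv.le))
  have hmask := S.mask_lt hFn
  have hpow := S.pow_lt
  rw [pow_succ] at hpow
  have Es := hL.env hm hm1 E
  have hmk : s.mem m k = mask F := by rw [hL.listed k hk, hlk]
  refine (Runs.seq (T := 1) (T' := 2) (R := fun t => t =
    s.setMem m l.length (mask (insert v F))) ?_ ?_).mono_time le_rfl
  · refine Runs.store S.le_cost hb (j := l.length) (x := mask (insert v F)) rfl rfl hL.length ?_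
      (by omega) hmask rfl
    simp only [Expr.eval, Op.eval, h42, h44, hmk, Es.pow v hv, mask_insert hvF]
  rintro s1 hb1 rfl
  have e8 : (s.setMem m l.length (mask (insert v F))).mem 8 = s.mem 8 :=
    State.setMem_mem_of_ne _ _ _ (by omega)
  refine (Runs.seq (T := 1) (T' := 1) (R := fun t => t =
    (s.setMem m l.length (mask (insert v F))).setMem 8 (mask (insert v F)) (F.card + 1))
      ?_ ?_).mono_time le_rfl
  · refine Runs.store S.le_cost hb1 (j := mask (insert v F)) (x := F.card + 1) rfl rfl ?_ ?_
      hmask ?_ rfl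
    · simp [Expr.eval, State.setMem_reg, hL.length, State.setMem_mem_self]
    · simp only [Expr.eval, Op.eval, State.setMem_reg, e8, h44, State.setMem_mem_self]
      rw [Function.update_of_ne (by omega), hmk, hL.card F (hlk ▸ List.getElem_mem hk)]
    · have := card_le_card hF
      rw [card_range] at this
      have := S.n_lt
      omega
  rintro s2 hb2 rfl
  refine Runs.assign S.le_cost hb2 (x := l.length + 1) rfl
    (by simp [Expr.eval, Op.eval, State.setMem_reg, hL.length]) (by omega) ⟨?_, ?_, ?_, ?_⟩
  · refine ⟨by simp [State.setReg_reg], ?_, ?_, ?_, ?_⟩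
    · rw [State.setReg_mem, State.setMem_mem_of_ne _ _ _ (by omega), State.setMem_mem_self]
      exact hL.listed.append_singleton _
    · intro G hG
      rw [State.setReg_mem, State.setMem_mem_self, Function.update_apply, e8]
      rw [List.mem_append, List.mem_singleton] at hG
      split_ifs with h
      -- Masks are injective, so the new entry of memory 8 can only overwrite the cardinality of the
      -- same set.
      · rw [mask_injective h, card_insert_of_notMem hvF]
      · exact hL.card G (hG.resolve_right fun h' => h (h' ▸ rfl))
    · intro r hr
      rw [State.setReg_reg, if_neg (by omega), State.setMem_reg, State.setMem_reg, hL.regs r hr]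
    · intro a ha ha8
      rw [State.setReg_mem, State.setMem_mem_of_ne _ _ _ ha8, State.setMem_mem_of_ne _ _ _ ha,
        hL.mems a ha ha8]
  all_goals simp [State.setReg_reg, State.setMem_reg, h42, h44]

/-- The program follows the recursion of `subsList`. The round for `v` traverses only the list as it
stands, whence the bound linear in the length of the output. -/
theorem runs_listSubsets (S : Setup n w Z K W) {m : ℕ} (hm : m < 8) (hm1 : m ≠ 1) {s : State}
    (hb : Bdd Z s) (E : Env n W s) {U : Finset ℕ} {a : ℕ} (h40 : s.reg 40 = mask U)
    (h41 : s.reg 41 = a) :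
    Runs Z K (listSubsets m) s (n * (7 * (subsList U a n).length + 7) + 5)
      (Listing m s (subsList U a n)) := by
  have hpow := S.pow_lt
  rw [pow_succ] at hpow
  have h1pow : 1 ≤ 2 ^ n := Nat.one_le_two_pow
  refine Runs.mono_time (T := 1 + (1 + (1 + (n * ((1 + ((subsList U a n).length * (5 + 2) + 2)) + 2 +
    2) + 2)))) ?_ (le_of_eq (by ring))
  refine Runs.seq (T := 1) (R := fun t => t = s.setMem m 0 0) (Runs.store S.le_cost hb rfl rfl
    rfl rfl (by positivity) (by positivity) rfl) ?_
  rintro s1 hb1 rfl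
  refine Runs.seq (T := 1) (R := fun t => t = (s.setMem m 0 0).setMem 8 0 0) (Runs.store S.le_cost
    hb1 rfl rfl rfl rfl (by positivity) (by positivity) rfl) ?_
  rintro s2 hb2 rfl
  refine Runs.seq (T := 1) (R := fun t => Listing m s (subsList U a 0) t) (Runs.assign S.le_cost
    hb2 rfl rfl (by simp only [Expr.eval]; omega) ?_) ?_
  · refine ⟨by simp [State.setReg_reg, subsList, Expr.eval], ?_, ?_, ?_, ?_⟩
    · rw [State.setReg_mem, State.setMem_mem_of_ne _ _ _ (by omega), State.setMem_mem_self]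
      intro i hi
      have : i = 0 := by simpa [subsList] using hi
      subst this
      simp [subsList, mask_empty]
    · intro F hF
      rw [State.setReg_mem, State.setMem_mem_self]
      have : F = ∅ := by simpa [subsList] using hF
      subst this
      simp [mask_empty]
    · intro r hr
      rw [State.setReg_reg, if_neg (by omega)]; rfl
    · intro b hb hb8
      rw [State.setReg_mem, State.setMem_mem_of_ne _ _ _ hb8, State.setMem_mem_of_ne _ _ _ hb]
  intro s3 hb3 hL3
  refine Runs.forLoop (N := n) (fun v t => t.reg 42 = v ∧ Listing m s (subsList U a v) t)
    S.le_cost hb3 S.n_lt ?_ ?_ ?_ ?_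
  · exact ⟨by simp [State.setReg_reg], hL3.setReg (by norm_num) (by norm_num)⟩
  · rintro v t ⟨h1, h2⟩
    exact ⟨h1, (h2.regs 0 (by norm_num)).trans E.size⟩
  · rintro v t hv hbt ⟨h1, hL⟩
    have Et := hL.env hm hm1 E
    have hbit := bitTest_ne_zero Et (m := .reg 40) (v := .reg 42) (F := U)
      ((hL.regs 40 (by norm_num)).trans h40) (by simpa [Expr.eval, h1] using hv)
    simp only [Expr.eval, h1] at hbit
    -- A round at most doubles the list, and `2 * 2 ^ v ≤ 2 ^ n`; so at every push the current
    -- length is below `2 ^ n`.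
    have hlen : (subsList U a v).length ≤ 2 ^ v := length_subsList_le_two_pow
    have h2v : 2 ^ (v + 1) ≤ 2 ^ n := Nat.pow_le_pow_right (by norm_num) hv
    rw [pow_succ] at h2v
    refine Runs.when S.le_cost hbt rfl (fun h0 => ?_) (fun h0 => ?_)
    · have hvU := hbit.1 h0
      -- Register 43 freezes the current length: the list grows while it is being traversed.
      refine Runs.seq (T := 1) (R := fun t => t.reg 42 = v ∧
        t.reg 43 = (subsList U a v).length ∧ Listing m s (subsList U a v) t) (Runs.assign S.le_cost
        hbt rfl rfl (by simp only [Expr.eval, hL.length]; omega) ?_) ?_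
      · exact ⟨by simp [State.setReg_reg, h1], by simp [State.setReg_reg, Expr.eval, hL.length],
          hL.setReg (by norm_num) (by norm_num)⟩
      rintro t1 hbt1 ⟨g1, g2, g3⟩
      have hle : (subsList U a v).length ≤ (subsList U a n).length := subsList_length_mono hv.le
      refine Runs.mono_time (T := (subsList U a v).length * (5 + 2) + 2) ?_ (by omega)
      refine Runs.forLoop (N := (subsList U a v).length) (fun k t => t.reg 44 = k ∧
        t.reg 42 = v ∧ t.reg 43 = (subsList U a v).length ∧ Listing m s (subsList U a v ++
          (((subsList U a v).take k).filter fun F => F.card < a).map (insert v)) t)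
        S.le_cost hbt1 (by omega) ?_ ?_ ?_ ?_
      · refine ⟨by simp [State.setReg_reg], by simp [State.setReg_reg, g1],
          by simp [State.setReg_reg, g2], ?_⟩
        simpa using g3.setReg (r := 44) (x := 0) (by norm_num) (by norm_num)
      · rintro k t' ⟨k1, -, k3, -⟩; exact ⟨k1, k3⟩
      · rintro k t' hk hbt' ⟨k1, k2, k3, kL⟩
        set l' := subsList U a v ++
          (((subsList U a v).take k).filter fun F => F.card < a).map (insert v) with hl'
        have hkl' : k < l'.length := by rw [hl', List.length_append]; omega
        have hlk : l'[k] = (subsList U a v)[k] := List.getElem_append_left hk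
        have hmemk : (subsList U a v)[k] ∈ subsList U a v := List.getElem_mem hk
        have hcardk : t'.mem 8 (t'.mem m k) = (subsList U a v)[k].card := by
          rw [kL.listed k hkl', hlk, kL.card _ (List.mem_append_left _ hmemk)]
        have h41' := (kL.regs 41 (by norm_num)).trans h41
        have hlen' : l'.length ≤ (subsList U a v).length + k := by
          rw [hl', List.length_append, List.length_map]
          refine Nat.add_le_add_left ((List.length_filter_le _ _).trans ?_) _
          rw [List.length_take]; omega
        refine Runs.when S.le_cost hbt' rfl (fun h0 => ?_) (fun h0 => ?_)
        · have hlt : (subsList U a v)[k].card < a := by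
            by_contra hcon
            simp [Expr.eval, Op.eval, k1, hcardk, h41', hcon] at h0
          refine (runs_listSubsets_push S hm hm1 hbt' E kL hv (mem_subsList.1 hmemk).2.1 hkl' hlk
            k2 k1 (by omega)).mono le_rfl ?_
          rintro s' - ⟨j1, j2, j3, j4⟩
          refine ⟨j4, by simp [State.setReg_reg], by simp [State.setReg_reg, j2],
            by simp [State.setReg_reg, j3, k3], ?_⟩
          have : (((subsList U a v).take (k + 1)).filter fun F => F.card < a).map (insert v) =
              (((subsList U a v).take k).filter fun F => F.card < a).map (insert v) ++
                [insert v (subsList U a v)[k]] := by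
            rw [List.take_succ_eq_append_getElem hk, List.filter_append, List.map_append]
            simp [hlt]
          rw [this, ← List.append_assoc]
          exact j1.setReg (by norm_num) (by norm_num)
        · have hnlt : ¬ (subsList U a v)[k].card < a := by
            intro hcon
            simp [Expr.eval, Op.eval, k1, hcardk, h41', hcon] at h0
          refine ⟨k1, by simp [State.setReg_reg], by simp [State.setReg_reg, k2],
            by simp [State.setReg_reg, k3], ?_⟩
          have : (((subsList U a v).take (k + 1)).filter fun F => F.card < a).map (insert v) =
              (((subsList U a v).take k).filter fun F => F.card < a).map (insert v) := by
            rw [List.take_succ_eq_append_getElem hk, List.filter_append, List.map_append]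
            simp [hnlt]
          rw [this]
          exact kL.setReg (by norm_num) (by norm_num)
      · rintro t' - ⟨-, k2, -, kL⟩
        rw [List.take_length] at kL
        refine ⟨k2, by simp [State.setReg_reg], ?_⟩
        rw [subsList, if_pos hvU]
        exact kL.setReg (by norm_num) (by norm_num)
    · have hvU : v ∉ U := fun h => hbit.2 h h0
      refine ⟨h1, by simp [State.setReg_reg], ?_⟩
      rw [subsList, if_neg hvU, List.append_nil]
      exact hL.setReg (by norm_num) (by norm_num)
  · rintro t - ⟨-, h⟩; exact h

end

/-! ### Keeping track of a minimum -/

/-- Either `C` is empty and `cur = 0`, or `cur - 1` is the minimum of `f` on `C` and `ch` encodes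
an element where it is attained. -/
structure MinTrack {α : Type*} (enc f : α → ℕ) (C : Finset α) (cur ch : ℕ) : Prop where
  zero : C = ∅ → cur = 0
  le : ∀ x ∈ C, cur ≤ f x + 1
  mem : C.Nonempty → ∃ x ∈ C, ch = enc x ∧ cur = f x + 1

/-- Replace the minimum in register `cur` and the place of the minimum in register `ch` if the
number in register `val` is smaller. -/
def updateMin (cur ch val arg : ℕ) : Program :=
  .ite (.op .lor (.op .eq (.reg cur) (.const 0)) (.op .lt (.reg val) (.reg cur)))
    (.seq (.assign cur (.reg val)) (.assign ch (.reg arg))) .skip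

theorem improves_ne_zero {s : State} {e e' : Expr} :
    (Expr.op .lor (.op .eq e (.const 0)) (.op .lt e' e)).eval s ≠ 0 ↔
      e.eval s = 0 ∨ e'.eval s < e.eval s := by
  simp only [Expr.eval, Op.eval]
  by_cases h1 : e.eval s = 0
  · simp only [h1, if_true, true_or, iff_true]
    rw [if_neg (by omega)]; decide
  · by_cases h2 : e'.eval s < e.eval s
    · simp only [h1, h2, if_true, if_false, or_true, iff_true]; decide
    · simp only [h1, h2, if_false, or_false, iff_false]; decide

theorem runs_updateMin {Z K : ℕ} (hK : 100 * (Z + 20) ≤ K) {α : Type*} [DecidableEq α]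
    {enc f : α → ℕ} {C : Finset α} {x : α} {s : State} (hb : Bdd Z s) {cur ch val arg : ℕ}
    (h1 : cur ≠ ch) (h3 : arg ≠ cur) (hM : MinTrack enc f C (s.reg cur) (s.reg ch))
    (hval : s.reg val = f x + 1) (harg : s.reg arg = enc x) :
    Runs Z K (updateMin cur ch val arg) s 4 fun s' =>
      MinTrack enc f (insert x C) (s'.reg cur) (s'.reg ch) ∧
        (∀ r, r ≠ cur → r ≠ ch → s'.reg r = s.reg r) ∧ s'.mem = s.mem := by
  refine Runs.when hK hb rfl (fun h0 => ?_) (fun h0 => ?_)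
  · rw [improves_ne_zero] at h0
    simp only [Expr.eval] at h0
    refine Runs.seq (T := 1) (T' := 1) (R := fun t => t = s.setReg cur (f x + 1))
      (Runs.assign hK hb rfl hval (hval ▸ hb.1 val) rfl) ?_
    rintro s1 hb1 rfl
    refine Runs.assign hK hb1 (x := enc x) rfl ?_ (harg ▸ hb.1 arg) ?_
    · simp [Expr.eval, State.setReg_reg, h3, harg]
    · refine ⟨⟨fun h => absurd h (insert_ne_empty x C), ?_, ?_⟩, ?_, rfl⟩
      · intro y hy
        simp only [State.setReg_reg, if_neg h1, if_true]
        rcases mem_insert.1 hy with rfl | hy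
        · exact le_rfl
        · have hc := hM.le y hy
          obtain ⟨z, hz, -, hz2⟩ := hM.mem ⟨y, hy⟩
          omega
      · exact fun _ => ⟨x, mem_insert_self x C, by simp [State.setReg_reg],
          by simp [State.setReg_reg, h1]⟩
      · intro r hr hr'
        simp [State.setReg_reg, hr, hr']
  · have h0' := mt improves_ne_zero.2 (not_not.2 h0)
    simp only [Expr.eval, not_or, not_lt] at h0'
    have hne : C.Nonempty := nonempty_iff_ne_empty.2 fun h => h0'.1 (hM.zero h)
    refine ⟨⟨fun h => absurd h (insert_ne_empty x C), ?_, ?_⟩, fun r _ _ => rfl, rfl⟩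
    · intro y hy
      rcases mem_insert.1 hy with rfl | hy
      · omega
      · exact hM.le y hy
    · obtain ⟨z, hz, hz'⟩ := hM.mem hne
      exact fun _ => ⟨z, mem_insert_of_mem hz, hz'⟩

theorem MinTrack.empty {α : Type*} (enc f : α → ℕ) (ch : ℕ) :
    MinTrack enc f ∅ 0 ch :=
  ⟨fun _ => rfl, by simp, by simp⟩

/-! ### Extending an ordering by a block -/

/-- The entries of the tables `D` and `Ch` describe an ordering of `F`: the last vertex is given
by `Ch` and the weight of the backward arcs by `D`, at the address `mask F`. -/
inductive Traceable (W : ℕ → ℕ → ℕ) (D Ch : ℕ → ℕ) : Finset ℕ → Prop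
  | empty : D 0 = 0 → Traceable W D Ch ∅
  | step {F : Finset ℕ} {v : ℕ} : v ∈ F → Ch (mask F) = v →
      D (mask F) = D (mask (F.erase v)) + outWeight W v (F.erase v) →
      Traceable W D Ch (F.erase v) → Traceable W D Ch F

/-- Tracing back from `F` visits only subsets of `F`, hence addresses up to `mask F`. Writing at
larger addresses leaves the description intact. -/
theorem Traceable.congr {W : ℕ → ℕ → ℕ} {D Ch D' Ch' : ℕ → ℕ} {F : Finset ℕ}
    (h : Traceable W D Ch F) (hD : ∀ m ≤ mask F, D' m = D m) (hCh : ∀ m ≤ mask F, Ch' m = Ch m) :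
    Traceable W D' Ch' F := by
  induction h with
  | empty h0 => exact .empty ((hD 0 (Nat.zero_le _)).trans h0)
  | @step F v hv h1 h2 _ ih =>
    have hle : mask (F.erase v) ≤ mask F := mask_le_mask (erase_subset _ _)
    refine .step hv ((hCh _ le_rfl).trans h1) ?_
      (ih (fun m hm => hD m (hm.trans hle)) fun m hm => hCh m (hm.trans hle))
    rw [hD _ le_rfl, hD _ hle, h2]

section

variable {n w Z K : ℕ} {W : ℕ → ℕ → ℕ}

/-- A crude bound that keeps table entries within `Z` bits. -/
theorem Traceable.le (S : Setup n w Z K W) {D Ch : ℕ → ℕ} {F : Finset ℕ}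
    (h : Traceable W D Ch F) (hF : F ⊆ range n) : D (mask F) ≤ F.card * (n * w) := by
  induction h with
  | empty h0 => simp [mask_empty, h0]
  | @step F v hv h1 h2 _ ih =>
    have hE := (erase_subset v F).trans hF
    rw [h2, ← card_erase_add_one hv, add_mul, one_mul]
    exact Nat.add_le_add (ih hE) (S.outWeight_le v hE)

/-- Compute the table entries for the union of the base set in register `16` and the set number
`k` on the list in memory `5`, where `k` is the content of register `18`. -/
def extendStep : Program :=
  .seq (.assign 20 (.op .add (.reg 16) (.load 5 (.reg 18)))) <|
  .seq (.assign 21 (.const 0)) <|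
  .seq (forLoop 23 0 <| .ite (bitTest (.load 5 (.reg 18)) (.reg 23))
    (.seq (.assign 30 (.reg 23)) <|
      .seq (.assign 31 (.op .sub (.reg 20) (.load 10 (.reg 23)))) <|
      .seq rowSum <|
      .seq (.assign 24 (.op .add (.op .add (.load 6 (.reg 31)) (.reg 33)) (.const 1))) <|
      updateMin 21 22 24 23) .skip) <|
  .seq (.store 6 (.reg 20) (.op .sub (.reg 21) (.const 1))) <|
  .store 7 (.reg 20) (.reg 22)

/-- Extend the tables in the memories `6` and `7` from the base set in register `16` by the
block in register `17`. -/
def extend : Program :=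
  .seq (.assign 40 (.reg 17)) <|
  .seq (.assign 41 (.reg 0)) <|
  .seq (listSubsets 5) <|
  .seq (.assign 19 (.reg 45)) <|
  forLoop 18 19 <| .ite (.load 5 (.reg 18)) extendStep .skip

/-- The cost of the ordering of `G` that ends with `v`. -/
def lastCost (W : ℕ → ℕ → ℕ) (D : ℕ → ℕ) (G : Finset ℕ) (v : ℕ) : ℕ :=
  D (mask (G.erase v)) + outWeight W v (G.erase v)

/-- The recurrence of the dynamic program. Orderings of `B ∪ Y` have to begin with `B`, so the last
vertex is chosen from the nonempty set `Y`. -/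
theorem runs_extendStep (S : Setup n w Z K W) {s : State} (hb : Bdd Z s) (E : Env n W s)
    {B Y : Finset ℕ} {k : ℕ} (hBn : B ⊆ range n) (hYn : Y ⊆ range n) (hBY : Disjoint B Y)
    (hY : Y.Nonempty) (h16 : s.reg 16 = mask B) (h18 : s.reg 18 = k) (h5 : s.mem 5 k = mask Y)
    (hT : ∀ v ∈ Y, Traceable W (s.mem 6) (s.mem 7) ((B ∪ Y).erase v)) :
    Runs Z K extendStep s (n * (5 * n + 14) + 6) fun s' =>
      (∀ r < 20, s'.reg r = s.reg r) ∧ (∀ a, a ≠ 6 → a ≠ 7 → s'.mem a = s.mem a) ∧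
      ∃ v ∈ Y, s'.mem 6 = Function.update (s.mem 6) (mask (B ∪ Y)) (lastCost W (s.mem 6) (B ∪ Y) v)
        ∧ s'.mem 7 = Function.update (s.mem 7) (mask (B ∪ Y)) v ∧
        ∀ u ∈ Y, lastCost W (s.mem 6) (B ∪ Y) v ≤ lastCost W (s.mem 6) (B ∪ Y) u := by
  have hGn : B ∪ Y ⊆ range n := union_subset hBn hYn
  have hmask := S.mask_lt hGn
  -- Traceability of the predecessors is needed here, to see that the candidate values fit into `Z`
  -- bits.
  have hcost : ∀ v ∈ Y, lastCost W (s.mem 6) (B ∪ Y) v ≤ n * n * w := by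
    intro v hv
    have hE := (erase_subset v (B ∪ Y)).trans hGn
    have h1 := (hT v hv).le S hE
    have h2 := S.outWeight_le v hE
    have h3 : ((B ∪ Y).erase v).card + 1 ≤ n := by
      rw [card_erase_add_one (mem_union_right _ hv)]
      simpa using card_le_card hGn
    calc lastCost W (s.mem 6) (B ∪ Y) v ≤ (((B ∪ Y).erase v).card + 1) * (n * w) := by
          rw [add_mul, one_mul]; exact Nat.add_le_add h1 h2
      _ ≤ n * (n * w) := Nat.mul_le_mul_right _ h3
      _ = n * n * w := (mul_assoc _ _ _).symm
  refine Runs.mono_time (T := 1 + (1 + ((n * ((1 + (1 + ((5 * n + 3) + (1 + 4))) + 2) + 2) + 2) +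
    (1 + 1)))) ?_ (le_of_eq (by ring))
  refine Runs.seq (R := fun t => t.reg 20 = mask (B ∪ Y) ∧ (∀ r < 20, t.reg r = s.reg r) ∧
    t.mem = s.mem) (Runs.assign S.le_cost hb (x := mask (B ∪ Y)) rfl ?_ hmask
      ⟨by simp [State.setReg_reg], fun r hr => by rw [State.setReg_reg, if_neg (by omega)],
        rfl⟩) ?_
  · rw [mask_union hBY]; simp only [Expr.eval, Op.eval, h16, h18, h5]
  rintro s1 hb1 ⟨a20, aR, aM⟩
  refine Runs.seq (R := fun t => t.reg 20 = mask (B ∪ Y) ∧ (∀ r < 20, t.reg r = s.reg r) ∧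
    t.mem = s.mem ∧ t.reg 21 = 0) (Runs.assign S.le_cost hb1 (x := 0) rfl rfl (by positivity)
      ⟨by simp [State.setReg_reg, a20], fun r hr => by
        rw [State.setReg_reg, if_neg (by omega), aR r hr], aM, by simp [State.setReg_reg]⟩) ?_
  rintro s2 hb2 ⟨b20, bR, bM, b21⟩
  refine Runs.seq (R := fun t => t.reg 20 = mask (B ∪ Y) ∧ (∀ r < 20, t.reg r = s.reg r) ∧
    t.mem = s.mem ∧ MinTrack id (lastCost W (s.mem 6) (B ∪ Y)) Y (t.reg 21) (t.reg 22)) ?_ ?_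
  · refine Runs.forLoop (N := n) (fun k t => t.reg 23 = k ∧ t.reg 20 = mask (B ∪ Y) ∧
      (∀ r < 20, t.reg r = s.reg r) ∧ t.mem = s.mem ∧
      MinTrack id (lastCost W (s.mem 6) (B ∪ Y)) (Y.filter (· < k)) (t.reg 21) (t.reg 22))
      S.le_cost hb2 S.n_lt ?_ ?_ ?_ ?_
    · refine ⟨by simp [State.setReg_reg], by simp [State.setReg_reg, b20], fun r hr => by
        rw [State.setReg_reg, if_neg (by omega), bR r hr], bM, ?_⟩
      simpa [State.setReg_reg, b21] using MinTrack.empty _ _ _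
    · rintro v t ⟨h1, -, h3, -⟩
      exact ⟨h1, (h3 0 (by norm_num)).trans E.size⟩
    · rintro v t hv hbt ⟨c23, c20, cR, cM, cT⟩
      have Et : Env n W t := E.congr (cR 0 (by norm_num)) (cR 1 (by norm_num)) (by rw [cM])
        (by rw [cM]) (by rw [cM])
      have c18 := (cR 18 (by norm_num)).trans h18
      have hbit := bitTest_ne_zero Et (m := .load 5 (.reg 18)) (v := .reg 23) (F := Y)
        (by simp only [Expr.eval, c18, cM, h5]) (by simpa [Expr.eval, c23] using hv)
      simp only [Expr.eval, c23] at hbit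
      refine Runs.when S.le_cost hbt rfl (fun h0 => ?_) (fun h0 => ?_)
      · have hvY := hbit.1 h0
        have hvG : v ∈ B ∪ Y := mem_union_right _ hvY
        have hEn := (erase_subset v (B ∪ Y)).trans hGn
        refine Runs.seq (R := fun t' => t' = t.setReg 30 v) (Runs.assign S.le_cost hbt rfl c23
          (c23 ▸ hbt.1 23) rfl) ?_
        rintro t1 hbt1 rfl
        refine Runs.seq (R := fun t' => t' = (t.setReg 30 v).setReg 31 (mask ((B ∪ Y).erase v)))
          (Runs.assign S.le_cost hbt1 rfl ?_ (S.mask_lt hEn) rfl) ?_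
        · simp [Expr.eval, Op.eval, State.setReg_reg, State.setReg_mem, c20, c23, Et.pow v hv,
            mask_erase hvG]
        rintro t2 hbt2 rfl
        have Et2 : Env n W ((t.setReg 30 v).setReg 31 (mask ((B ∪ Y).erase v))) :=
          Et.congr (by simp [State.setReg_reg]) (by simp [State.setReg_reg]) rfl rfl rfl
        refine Runs.seq (runs_rowSum S hbt2 Et2 hv hEn (by simp [State.setReg_reg])
          (by simp [State.setReg_reg])) ?_
        rintro t3 hbt3 ⟨d33, dR, dM⟩
        simp only [State.setReg_mem, cM] at dM
        have dR' : ∀ r < 30, t3.reg r = t.reg r := fun r hr => by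
          rw [dR r (by omega), State.setReg_reg, if_neg (by omega), State.setReg_reg,
            if_neg (by omega)]
        have d31 : t3.reg 31 = mask ((B ∪ Y).erase v) := by
          rw [dR 31 (by norm_num), State.setReg_reg, if_pos rfl]
        refine Runs.seq (R := fun t' => t' = t3.setReg 24 (lastCost W (s.mem 6) (B ∪ Y) v + 1))
          (Runs.assign S.le_cost hbt3 rfl ?_ ?_ rfl) ?_
        · simp only [Expr.eval, Op.eval, d31, d33, dM, lastCost]
        · have := hcost v hvY
          exact S.lt_of_le_weight (by omega)
        rintro t4 hbt4 rfl
        refine (runs_updateMin S.le_cost hbt4 (cur := 21) (ch := 22) (val := 24) (arg := 23)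
          (x := v) (C := Y.filter (· < v)) (enc := id) (f := lastCost W (s.mem 6) (B ∪ Y))
          (by norm_num) (by norm_num) ?_ (by simp [State.setReg_reg]) ?_).mono le_rfl ?_
        · simp only [State.setReg_reg]
          norm_num
          rw [dR' 21 (by norm_num), dR' 22 (by norm_num)]
          exact cT
        · simp [State.setReg_reg, dR' 23 (by norm_num), c23]
        · rintro t5 hbt5 ⟨eT, eR, eM⟩
          have eR' : ∀ r < 30, r ≠ 21 → r ≠ 22 → r ≠ 24 → t5.reg r = t.reg r := fun r h h1 h2 h3 => by
            rw [eR r h1 h2, State.setReg_reg, if_neg h3, dR' r h]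
          refine ⟨?_, by simp [State.setReg_reg], ?_, fun r hr => ?_, ?_, ?_⟩
          · rw [eR' 23 (by norm_num) (by norm_num) (by norm_num) (by norm_num), c23]
          · rw [State.setReg_reg, if_neg (by norm_num),
              eR' 20 (by norm_num) (by norm_num) (by norm_num) (by norm_num), c20]
          · rw [State.setReg_reg, if_neg (by omega),
              eR' r (by omega) (by omega) (by omega) (by omega), cR r hr]
          · rw [State.setReg_mem, eM, State.setReg_mem, dM]
          · rw [State.setReg_reg, if_neg (by norm_num), State.setReg_reg, if_neg (by norm_num),
              filter_lt_succ_of_mem hvY]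
            exact eT
      · have hvY : v ∉ Y := fun h => hbit.2 h h0
        refine ⟨c23, by simp [State.setReg_reg], by simp [State.setReg_reg, c20], fun r hr => by
          rw [State.setReg_reg, if_neg (by omega), cR r hr], cM, ?_⟩
        rw [State.setReg_reg, if_neg (by norm_num), State.setReg_reg, if_neg (by norm_num),
          filter_lt_succ_of_notMem hvY]
        exact cT
    · rintro t - ⟨-, c20, cR, cM, cT⟩
      rw [filter_lt_of_subset hYn] at cT
      exact ⟨c20, cR, cM, cT⟩
  rintro s3 hb3 ⟨c20, cR, cM, cT⟩
  obtain ⟨v, hv, hv1, hv2⟩ := cT.mem hY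
  refine Runs.seq (R := fun t => t = s3.setMem 6 (mask (B ∪ Y)) (lastCost W (s.mem 6) (B ∪ Y) v))
    (Runs.store S.le_cost hb3 rfl rfl c20 (by simp [Expr.eval, Op.eval, hv2]) hmask
      (S.lt_of_le_weight (by have := hcost v hv; omega)) rfl) ?_
  rintro s4 hb4 rfl
  refine Runs.store S.le_cost hb4 (j := mask (B ∪ Y)) (x := v) rfl rfl c20
    hv1 hmask (lt_trans (mem_range.1 (hYn hv)) S.n_lt) ⟨cR, ?_, v, hv, ?_, ?_, ?_⟩
  · intro a h6 h7
    rw [State.setMem_mem_of_ne _ _ _ h7, State.setMem_mem_of_ne _ _ _ h6, cM]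
  · rw [State.setMem_mem_of_ne _ _ _ (by norm_num), State.setMem_mem_self, cM]
  · rw [State.setMem_mem_self, State.setMem_mem_of_ne _ _ _ (by norm_num), cM]
  · intro u hu
    have := cT.le u hu
    omega

/-- The tables are optimal on the extensions of `B` by subsets of the block `X`. -/
structure Extended (W : ℕ → ℕ → ℕ) (B X : Finset ℕ) (D Ch : ℕ → ℕ) : Prop where
  traceable : ∀ Y ⊆ X, Traceable W D Ch (B ∪ Y)
  le : ∀ Y ⊆ X, ∀ v ∈ Y, D (mask (B ∪ Y)) ≤ lastCost W D (B ∪ Y) v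

/-- The recurrence at `G` reads only strictly smaller addresses. -/
theorem lastCost_congr {D D' : ℕ → ℕ} {G : Finset ℕ} {v : ℕ} (hv : v ∈ G)
    (h : ∀ m < mask G, D' m = D m) : lastCost W D' G v = lastCost W D G v := by
  rw [lastCost, lastCost, h _ (mask_lt_mask (erase_ssubset hv))]

/-- The subsets `Y` of `X` are treated by increasing mask. As `mask (B ∪ Y) = mask B + mask Y`, the
addresses written increase as well, so finished entries are never overwritten, and leftovers of
earlier runs are replaced before they are read. -/
theorem runs_extend (S : Setup n w Z K W) {s : State} (hb : Bdd Z s) (E : Env n W s)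
    {B X : Finset ℕ} (hBn : B ⊆ range n) (hXn : X ⊆ range n) (hBX : Disjoint B X)
    (h16 : s.reg 16 = mask B) (h17 : s.reg 17 = mask X)
    (hT : Traceable W (s.mem 6) (s.mem 7) B) :
    Runs Z K extend s (2 ^ X.card * (5 * n * n + 21 * n + 10) + (7 * n + 10)) fun s' =>
      (∀ r < 16, s'.reg r = s.reg r) ∧
      (∀ a, a ≠ 5 → a ≠ 6 → a ≠ 7 → a ≠ 8 → s'.mem a = s.mem a) ∧
      s'.mem 6 (mask B) = s.mem 6 (mask B) ∧ Extended W B X (s'.mem 6) (s'.mem 7) := by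
  set l := subsList X n n with hl
  have hlen : l.length ≤ 2 ^ X.card := length_subsList_le_two_pow_card
  have hsorted : l.Pairwise fun F G => mask F < mask G := subsList_sorted
  have hlenn : l.length ≤ 2 ^ n := length_subsList_le_two_pow
  have hpow := S.pow_lt
  rw [pow_succ] at hpow
  refine Runs.mono_time (T := 1 + (1 + ((n * (7 * l.length + 7) + 5) + (1 + (l.length *
    (((n * (5 * n + 14) + 6) + 2) + 2) + 2))))) ?_ ?_
  swap
  · calc _ = l.length * (5 * n * n + 21 * n + 10) + (7 * n + 10) := by ring
      _ ≤ _ := Nat.add_le_add_right (Nat.mul_le_mul_right _ hlen) _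
  refine Runs.seq (R := fun t => t = s.setReg 40 (mask X)) (Runs.assign S.le_cost hb rfl h17
    (S.mask_lt hXn) rfl) ?_
  rintro s1 hb1 rfl
  refine Runs.seq (R := fun t => t = (s.setReg 40 (mask X)).setReg 41 n) (Runs.assign S.le_cost hb1
    rfl (by simp [Expr.eval, State.setReg_reg, E.size]) S.n_lt rfl) ?_
  rintro s2 hb2 rfl
  have E2 : Env n W ((s.setReg 40 (mask X)).setReg 41 n) :=
    E.congr (by simp [State.setReg_reg]) (by simp [State.setReg_reg]) rfl rfl rfl
  refine Runs.seq (runs_listSubsets S (m := 5) (by norm_num) (by norm_num) hb2 E2 (U := X) (a := n)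
    (by simp [State.setReg_reg]) (by simp [State.setReg_reg])) ?_
  rw [← hl]
  rintro s3 hb3 hL
  have lR : ∀ r < 40, s3.reg r = s.reg r := fun r hr => by
    rw [hL.regs r (by omega), State.setReg_reg, if_neg (by omega), State.setReg_reg,
      if_neg (by omega)]
  have lM : ∀ a, a ≠ 5 → a ≠ 8 → s3.mem a = s.mem a := fun a h h' => by
    rw [hL.mems a h h', State.setReg_mem, State.setReg_mem]
  refine Runs.seq (R := fun t => t = s3.setReg 19 l.length) (Runs.assign S.le_cost hb3 rfl
    (by simpa [Expr.eval] using hL.length) (by omega) rfl) ?_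
  rintro s4 hb4 rfl
  have hempty : ∀ i (h : i < l.length), l[i] ⊆ X ∧ l[i] ⊆ range n := fun i h => by
    have := mem_subsList.1 (List.getElem_mem h)
    exact ⟨this.1, this.2.1⟩
  -- All proper subsets precede a set on the sorted list, in particular those with one vertex
  -- removed.
  have hbefore : ∀ k (hk : k < l.length), ∀ Y ⊂ l[k], ∃ i, ∃ h : i < l.length, i < k ∧ l[i] = Y := by
    intro k hk Y hY
    have hYl : Y ∈ l := mem_subsList.2 ⟨hY.subset.trans (hempty k hk).1,
      hY.subset.trans (hempty k hk).2, by
        simpa using card_le_card (hY.subset.trans (hempty k hk).2)⟩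
    obtain ⟨i, hi, rfl⟩ := List.getElem_of_mem hYl
    refine ⟨i, hi, ?_, rfl⟩
    by_contra hcon
    have hlt := mask_lt_mask hY
    rcases Nat.lt_or_eq_of_le (not_lt.1 hcon) with h | h
    · have := List.pairwise_iff_getElem.1 hsorted k i hk hi h
      omega
    · subst h; exact lt_irrefl _ hlt
  have hdisj : ∀ i (h : i < l.length), Disjoint B l[i] := fun i h =>
    disjoint_of_subset_right (hempty i h).1 hBX
  refine Runs.forLoop (N := l.length) (fun k t => t.reg 18 = k ∧ t.reg 19 = l.length ∧
    (∀ r < 18, t.reg r = s.reg r) ∧ (∀ a, a ≠ 5 → a ≠ 6 → a ≠ 7 → a ≠ 8 → t.mem a = s.mem a) ∧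
    Listed l (t.mem 5) ∧ t.mem 6 (mask B) = s.mem 6 (mask B) ∧
    Traceable W (t.mem 6) (t.mem 7) B ∧
    ∀ i (h : i < l.length), i < k → Traceable W (t.mem 6) (t.mem 7) (B ∪ l[i]) ∧
      ∀ v ∈ l[i], t.mem 6 (mask (B ∪ l[i])) ≤ lastCost W (t.mem 6) (B ∪ l[i]) v)
    S.le_cost hb4 (by omega) ?_ ?_ ?_ ?_
  · refine ⟨by simp [State.setReg_reg], by simp [State.setReg_reg], fun r hr => ?_,
      fun a h5 _ _ h8 => lM a h5 h8, hL.listed, ?_, ?_, fun i _ h => absurd h (Nat.not_lt_zero i)⟩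
    · rw [State.setReg_reg, if_neg (by omega), State.setReg_reg, if_neg (by omega),
        lR r (by omega)]
    · rw [State.setReg_mem, State.setReg_mem, lM 6 (by norm_num) (by norm_num)]
    · rw [State.setReg_mem, State.setReg_mem, lM 6 (by norm_num) (by norm_num),
        lM 7 (by norm_num) (by norm_num)]
      exact hT
  · rintro k t ⟨h1, h2, -⟩; exact ⟨h1, h2⟩
  · rintro k t hk hbt ⟨c18, c19, cR, cM, c5, c6, cT, cI⟩
    have hval : (Expr.load 5 (.reg 18)).eval t = mask l[k] := by
      simp only [Expr.eval, c18, c5 k hk]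
    have Et : Env n W t := E.congr (cR 0 (by norm_num)) (cR 1 (by norm_num))
      (cM 1 (by norm_num) (by norm_num) (by norm_num) (by norm_num))
      (cM 9 (by norm_num) (by norm_num) (by norm_num) (by norm_num))
      (cM 10 (by norm_num) (by norm_num) (by norm_num) (by norm_num))
    refine Runs.when S.le_cost hbt rfl (fun h0 => ?_) (fun h0 => ?_)
    · rw [hval, Ne, mask_eq_zero, ← Ne, ← nonempty_iff_ne_empty] at h0
      have herase : ∀ v ∈ l[k], (B ∪ l[k]).erase v = B ∪ l[k].erase v := by
        intro v hv
        rw [erase_union_distrib, erase_eq_of_notMem fun h => disjoint_left.1 (hdisj k hk) h hv]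
      refine (runs_extendStep S hbt Et hBn (hempty k hk).2 (hdisj k hk) h0
        ((cR 16 (by norm_num)).trans h16) c18 (c5 k hk) ?_).mono le_rfl ?_
      · intro v hv
        obtain ⟨i, hi, hik, hli⟩ := hbefore k hk _ (erase_ssubset hv)
        rw [herase v hv, ← hli]
        exact (cI i hi hik).1
      · rintro t' - ⟨dR, dM, v, hv, d6, d7, dmin⟩
        -- Only the address `mask (B ∪ l[k])` has been written.
        have old : ∀ m < mask (B ∪ l[k]), t'.mem 6 m = t.mem 6 m ∧ t'.mem 7 m = t.mem 7 m :=
          fun m hm => by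
            rw [d6, d7, Function.update_of_ne hm.ne, Function.update_of_ne hm.ne]
            exact ⟨rfl, rfl⟩
        have keep : ∀ F : Finset ℕ, mask F < mask (B ∪ l[k]) →
            Traceable W (t.mem 6) (t.mem 7) F → Traceable W (t'.mem 6) (t'.mem 7) F :=
          fun F hF h => h.congr (fun m hm => (old m (lt_of_le_of_lt hm hF)).1)
            fun m hm => (old m (lt_of_le_of_lt hm hF)).2
        have hBlt : mask B < mask (B ∪ l[k]) := by
          rw [mask_union (hdisj k hk)]
          have := Nat.pos_of_ne_zero (mt mask_eq_zero.1 h0.ne_empty)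
          omega
        have hlt : ∀ i (h : i < l.length), i < k → mask (B ∪ l[i]) < mask (B ∪ l[k]) := by
          intro i h hik
          rw [mask_union (hdisj k hk), mask_union (hdisj i h)]
          have := List.pairwise_iff_getElem.1 hsorted i k h hk hik
          exact Nat.add_lt_add_left this _
        refine ⟨(dR 18 (by norm_num)).trans c18, by simp [State.setReg_reg], ?_, fun r hr => ?_,
          fun a h1 h2 h3 h4 => ?_, ?_, ?_, keep B hBlt cT, fun i h hik => ?_⟩
        · rw [State.setReg_reg, if_neg (by norm_num), dR 19 (by norm_num), c19]
        · rw [State.setReg_reg, if_neg (by omega), dR r (by omega), cR r hr]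
        · rw [State.setReg_mem, dM a h2 h3, cM a h1 h2 h3 h4]
        · rw [State.setReg_mem, dM 5 (by norm_num) (by norm_num)]; exact c5
        · rw [State.setReg_mem, (old _ hBlt).1, c6]
        · rw [State.setReg_mem]
          rcases Nat.lt_succ_iff_lt_or_eq.1 hik with h' | rfl
          · refine ⟨keep _ (hlt i h h') (cI i h h').1, fun u hu => ?_⟩
            rw [lastCost_congr (mem_union_right _ hu) fun m hm =>
              (old m (hm.trans (hlt i h h'))).1, (old _ (hlt i h h')).1]
            exact (cI i h h').2 u hu
          · have e6 : t'.mem 6 (mask (B ∪ l[i])) = lastCost W (t.mem 6) (B ∪ l[i]) v := by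
              rw [d6, Function.update_self]
            have ec : ∀ u ∈ l[i], lastCost W (t'.mem 6) (B ∪ l[i]) u =
                lastCost W (t.mem 6) (B ∪ l[i]) u := fun u hu =>
              lastCost_congr (mem_union_right _ hu) fun m hm => (old m hm).1
            constructor
            · refine .step (mem_union_right _ hv) (by rw [d7, Function.update_self])
                (by rw [e6, ← ec v hv]; rfl) ?_
              obtain ⟨j, hj, hjk, hlj⟩ := hbefore i hk _ (erase_ssubset hv)
              have := (cI j hj hjk).1
              rw [hlj, ← herase v hv] at this
              exact keep _ (mask_lt_mask (erase_ssubset (mem_union_right _ hv))) this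
            · intro u hu
              rw [e6, ec u hu]
              exact dmin u hu
    -- The empty subset is skipped: the entry of `B` is already in the table.
    · rw [hval, mask_eq_zero] at h0
      refine ⟨c18, by simp [State.setReg_reg], by simp [State.setReg_reg, c19], fun r hr => by
        rw [State.setReg_reg, if_neg (by omega), cR r hr], cM, c5, c6, cT, fun i h hik => ?_⟩
      rcases Nat.lt_succ_iff_lt_or_eq.1 hik with h' | rfl
      · exact cI i h h'
      · rw [h0, union_empty]
        exact ⟨cT, by simp⟩
  · rintro t - ⟨-, -, cR, cM, -, c6, -, cI⟩
    have hall : ∀ Y ⊆ X, ∃ i, ∃ h : i < l.length, l[i] = Y := fun Y hY => by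
      have hYl : Y ∈ l := mem_subsList.2 ⟨hY, hY.trans hXn, by
        simpa using card_le_card (hY.trans hXn)⟩
      obtain ⟨i, hi, h⟩ := List.getElem_of_mem hYl
      exact ⟨i, hi, h⟩
    refine ⟨fun r hr => cR r (by omega), cM, c6, fun Y hY => ?_, fun Y hY => ?_⟩
    · obtain ⟨i, hi, rfl⟩ := hall Y hY
      exact (cI i hi hi).1
    · obtain ⟨i, hi, rfl⟩ := hall Y hY
      exact (cI i hi hi).2

/-! ### Optimality of the block tables -/

/-- The weight of the pairs in `F` that a ranking orders against an arc. -/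
def inversionWeight (W : ℕ → ℕ → ℕ) (r : ℕ → ℕ) (F : Finset ℕ) : ℕ :=
  ∑ v ∈ F, outWeight W v (F.filter fun u => r u < r v)

theorem outWeight_union (v : ℕ) {F G : Finset ℕ} (h : Disjoint F G) :
    outWeight W v (F ∪ G) = outWeight W v F + outWeight W v G :=
  sum_union h

/-- The local inequalities suffice for global optimality: build `Y` up by increasing rank and apply
the inequality to the vertex of highest rank, whose new backward arcs go to `B` and to the rest of
`Y`. -/
theorem Extended.le_inversionWeight {B X : Finset ℕ} {D Ch : ℕ → ℕ} (h : Extended W B X D Ch)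
    (hBX : Disjoint B X) {r : ℕ → ℕ} (hr : Set.InjOn r X) :
    ∀ Y ⊆ X, D (mask (B ∪ Y)) ≤ D (mask B) + ∑ v ∈ Y, outWeight W v B + inversionWeight W r Y := by
  intro Y
  induction Y using Finset.induction_on_max_value r with
  | empty => simp [inversionWeight]
  | insert v Y hvY hmax ih =>
    intro hY
    have hvX : v ∈ X := hY (mem_insert_self v Y)
    have hYX : Y ⊆ X := (subset_insert v Y).trans hY
    have hvB : v ∉ B := fun hB => disjoint_left.1 hBX hB hvX
    have hlt : ∀ u ∈ Y, r u < r v := fun u hu => lt_of_le_of_ne (hmax u hu) fun e =>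
      hvY (hr (hYX hu) hvX e ▸ hu)
    have e1 : (B ∪ insert v Y).erase v = B ∪ Y := by
      rw [erase_union_distrib, erase_eq_of_notMem hvB, erase_insert hvY]
    have h1 := h.le _ hY v (mem_insert_self v Y)
    rw [lastCost, e1, outWeight_union v (disjoint_of_subset_right hYX hBX)] at h1
    have e2 : inversionWeight W r (insert v Y) = outWeight W v Y + inversionWeight W r Y := by
      rw [inversionWeight, sum_insert hvY, inversionWeight]
      congr 1
      · congr 1
        ext u
        simp only [mem_filter, mem_insert]
        constructor
        · rintro ⟨rfl | hu, hu'⟩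
          · exact absurd hu' (lt_irrefl _)
          · exact hu
        · exact fun hu => ⟨.inr hu, hlt u hu⟩
      · refine sum_congr rfl fun u hu => ?_
        congr 1
        rw [filter_insert, if_neg (by have := hlt u hu; omega)]
    have h2 := ih hYX
    rw [e2, sum_insert hvY]
    omega

end

/-! ### Finding a minimum cut with a given number of vertices -/

/-- The weight of the arcs from `R \ T` to `T`. -/
def cutWeight (W : ℕ → ℕ → ℕ) (R T : Finset ℕ) : ℕ := ∑ v ∈ R \ T, outWeight W v T

/-- Put into register `14` one plus the weight of the arcs to the set in register `13` from the
other elements of the set in register `8`. -/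
def computeCut : Program :=
  .seq (.assign 14 (.const 1)) <|
  forLoop 15 0 <| .ite (bitTest (.op .sub (.reg 8) (.reg 13)) (.reg 15))
    (.seq (.assign 30 (.reg 15)) <|
      .seq (.assign 31 (.reg 13)) <|
      .seq rowSum <|
      .assign 14 (.op .add (.reg 14) (.reg 33))) .skip

/-- Put into register `12` a subset of the set in register `8`, with as many elements as register
`3` says, that has the smallest weight of arcs to it. -/
def minCut : Program :=
  .seq (.assign 40 (.reg 8)) <|
  .seq (.assign 41 (.reg 3)) <|
  .seq (listSubsets 4) <|
  .seq (.assign 10 (.reg 45)) <|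
  .seq (.assign 11 (.const 0)) <|
  forLoop 9 10 <| .ite (.op .eq (.load 8 (.load 4 (.reg 9))) (.reg 3))
    (.seq (.assign 13 (.load 4 (.reg 9))) <|
      .seq computeCut <|
      updateMin 11 12 14 13) .skip

section

variable {n w Z K : ℕ} {W : ℕ → ℕ → ℕ}

theorem runs_computeCut (S : Setup n w Z K W) {s : State} (hb : Bdd Z s) (E : Env n W s)
    {R T : Finset ℕ} (hR : R ⊆ range n) (hT : T ⊆ R) (h8 : s.reg 8 = mask R)
    (h13 : s.reg 13 = mask T) :
    Runs Z K computeCut s (n * (5 * n + 10) + 3) fun s' =>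
      s'.reg 14 = cutWeight W R T + 1 ∧ (∀ r < 14, s'.reg r = s.reg r) ∧ s'.mem = s.mem := by
  have h2Z : 1 < 2 ^ Z := S.lt_of_le_weight (by omega)
  refine Runs.mono_time (T := 1 + (n * ((1 + (1 + ((5 * n + 3) + 1)) + 2) + 2) + 2)) ?_
    (le_of_eq (by ring))
  refine Runs.seq (R := fun t => t = s.setReg 14 1) (Runs.assign S.le_cost hb rfl rfl h2Z rfl) ?_
  rintro s1 hb1 rfl
  have hX : R \ T ⊆ range n := sdiff_subset.trans hR
  refine Runs.forLoop (N := n) (fun k t => t.reg 15 = k ∧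
    t.reg 14 = ∑ v ∈ (R \ T).filter (· < k), outWeight W v T + 1 ∧
    (∀ r < 14, t.reg r = s.reg r) ∧ t.mem = s.mem) S.le_cost hb1 S.n_lt ?_ ?_ ?_ ?_
  · refine ⟨by simp [State.setReg_reg], by simp [State.setReg_reg], fun r hr => ?_, rfl⟩
    rw [State.setReg_reg, if_neg (by omega), State.setReg_reg, if_neg (by omega)]
  · rintro k t ⟨h1, -, h3, -⟩
    exact ⟨h1, (h3 0 (by norm_num)).trans E.size⟩
  · rintro k t hk hbt ⟨h1, h2, h3, h4⟩
    have Et : Env n W t := E.congr (h3 0 (by norm_num)) (h3 1 (by norm_num)) (by rw [h4])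
      (by rw [h4]) (by rw [h4])
    have t13 := (h3 13 (by norm_num)).trans h13
    have hbit := bitTest_ne_zero Et (m := .op .sub (.reg 8) (.reg 13)) (v := .reg 15) (F := R \ T)
      (by simp only [Expr.eval, Op.eval, t13, h3 8 (by norm_num), h8, mask_sdiff hT])
      (by simpa [Expr.eval, h1] using hk)
    simp only [Expr.eval, h1] at hbit
    refine Runs.when S.le_cost hbt rfl (fun h0 => ?_) (fun h0 => ?_)
    · have hkF := hbit.1 h0
      refine Runs.seq (R := fun t' => t' = t.setReg 30 k) (Runs.assign S.le_cost hbt rfl h1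
        (h1 ▸ hbt.1 15) rfl) ?_
      rintro t1 hbt1 rfl
      refine Runs.seq (R := fun t' => t' = (t.setReg 30 k).setReg 31 (mask T)) (Runs.assign
        S.le_cost hbt1 rfl (by simp [Expr.eval, State.setReg_reg, t13]) (S.mask_lt (hT.trans hR))
        rfl) ?_
      rintro t2 hbt2 rfl
      have Et2 : Env n W ((t.setReg 30 k).setReg 31 (mask T)) :=
        Et.congr (by simp [State.setReg_reg]) (by simp [State.setReg_reg]) rfl rfl rfl
      refine Runs.seq (runs_rowSum S hbt2 Et2 hk (hT.trans hR) (by simp [State.setReg_reg])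
        (by simp [State.setReg_reg])) ?_
      rintro t3 hbt3 ⟨d33, dR, dM⟩
      have dR' : ∀ r < 30, t3.reg r = t.reg r := fun r hr => by
        rw [dR r (by omega), State.setReg_reg, if_neg (by omega), State.setReg_reg,
          if_neg (by omega)]
      have hval : ∑ v ∈ (R \ T).filter (· < k + 1), outWeight W v T =
          ∑ v ∈ (R \ T).filter (· < k), outWeight W v T + outWeight W k T := by
        rw [filter_lt_succ_of_mem hkF, sum_insert (by simp), add_comm]
      have hle := S.sum_outWeight_le ((filter_subset (· < k + 1) (R \ T)).trans hX) (hT.trans hR)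
      refine Runs.assign S.le_cost hbt3
        (x := ∑ v ∈ (R \ T).filter (· < k + 1), outWeight W v T + 1) rfl ?_
        (S.lt_of_le_weight (by omega)) ?_
      · rw [hval]
        simp only [Expr.eval, Op.eval, d33, dR' 14 (by norm_num), h2]
        ring
      · refine ⟨?_, by simp [State.setReg_reg], by simp [State.setReg_reg], fun r hr => ?_, ?_⟩
        · rw [State.setReg_reg, if_neg (by norm_num), dR' 15 (by norm_num), h1]
        · rw [State.setReg_reg, if_neg (by omega), State.setReg_reg, if_neg (by omega),
            dR' r (by omega), h3 r hr]
        · rw [State.setReg_mem, State.setReg_mem, dM]; exact h4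
    · have hkF : k ∉ R \ T := fun h => hbit.2 h h0
      refine ⟨h1, by simp [State.setReg_reg], ?_, fun r hr => ?_, h4⟩
      · rw [State.setReg_reg, if_neg (by norm_num), filter_lt_succ_of_notMem hkF, h2]
      · rw [State.setReg_reg, if_neg (by omega), h3 r hr]
  · rintro t - ⟨-, h2, h3, h4⟩
    rw [filter_lt_of_subset hX] at h2
    exact ⟨h2, h3, h4⟩

/-- `T` is a subset of `R` with `b` elements and the smallest weight of arcs to it. -/
structure IsMinCut (W : ℕ → ℕ → ℕ) (R : Finset ℕ) (b : ℕ) (T : Finset ℕ) : Prop where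
  subset : T ⊆ R
  card : T.card = b
  le : ∀ T' ⊆ R, T'.card = b → cutWeight W R T ≤ cutWeight W R T'

/-- Exhaustive search. Smaller sets are on the list too, since the recursion creates them, and the
test on the cardinality discards them; `b ≤ R.card` guarantees a candidate. -/
theorem runs_minCut (S : Setup n w Z K W) {s : State} (hb : Bdd Z s) (E : Env n W s)
    {R : Finset ℕ} {b : ℕ} (hR : R ⊆ range n) (hbR : b ≤ R.card) (h8 : s.reg 8 = mask R)
    (h3 : s.reg 3 = b) :
    Runs Z K minCut s (smallSets n b * (5 * n * n + 17 * n + 12) + (7 * n + 11)) fun s' =>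
      (∃ T, IsMinCut W R b T ∧ s'.reg 12 = mask T) ∧
      (∀ r < 9, s'.reg r = s.reg r) ∧ ∀ a, a ≠ 4 → a ≠ 8 → s'.mem a = s.mem a := by
  set l := subsList R b n with hl
  have hlen : l.length ≤ smallSets n b := length_subsList_le_smallSets
  have hlenn : l.length ≤ 2 ^ n := length_subsList_le_two_pow
  have hpow := S.pow_lt
  rw [pow_succ] at hpow
  refine Runs.mono_time (T := 1 + (1 + ((n * (7 * l.length + 7) + 5) + (1 + (1 + (l.length *
    (((1 + ((n * (5 * n + 10) + 3) + 4)) + 2) + 2) + 2)))))) ?_ ?_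
  swap
  · calc _ = l.length * (5 * n * n + 17 * n + 12) + (7 * n + 11) := by ring
      _ ≤ _ := Nat.add_le_add_right (Nat.mul_le_mul_right _ hlen) _
  refine Runs.seq (R := fun t => t = s.setReg 40 (mask R)) (Runs.assign S.le_cost hb rfl h8
    (S.mask_lt hR) rfl) ?_
  rintro s1 hb1 rfl
  refine Runs.seq (R := fun t => t = (s.setReg 40 (mask R)).setReg 41 b) (Runs.assign S.le_cost hb1
    rfl (by simp [Expr.eval, State.setReg_reg, h3]) (h3 ▸ hb.1 3) rfl) ?_
  rintro s2 hb2 rfl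
  have E2 : Env n W ((s.setReg 40 (mask R)).setReg 41 b) :=
    E.congr (by simp [State.setReg_reg]) (by simp [State.setReg_reg]) rfl rfl rfl
  refine Runs.seq (runs_listSubsets S (m := 4) (by norm_num) (by norm_num) hb2 E2 (U := R) (a := b)
    (by simp [State.setReg_reg]) (by simp [State.setReg_reg])) ?_
  rw [← hl]
  rintro s3 hb3 hL
  have lR : ∀ r < 40, s3.reg r = s.reg r := fun r hr => by
    rw [hL.regs r (by omega), State.setReg_reg, if_neg (by omega), State.setReg_reg,
      if_neg (by omega)]
  have lM : ∀ a, a ≠ 4 → a ≠ 8 → s3.mem a = s.mem a := fun a h h' => by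
    rw [hL.mems a h h', State.setReg_mem, State.setReg_mem]
  refine Runs.seq (R := fun t => t = s3.setReg 10 l.length) (Runs.assign S.le_cost hb3 rfl
    (by simpa [Expr.eval] using hL.length) (by omega) rfl) ?_
  rintro s4 hb4 rfl
  refine Runs.seq (R := fun t => t = (s3.setReg 10 l.length).setReg 11 0) (Runs.assign S.le_cost hb4
    rfl rfl (by positivity) rfl) ?_
  rintro s5 hb5 rfl
  refine Runs.forLoop (N := l.length) (fun k t => t.reg 9 = k ∧ t.reg 10 = l.length ∧
    (∀ r < 9, t.reg r = s.reg r) ∧ t.mem = s3.mem ∧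
    MinTrack mask (cutWeight W R) ((l.take k).filter fun T => T.card = b).toFinset
      (t.reg 11) (t.reg 12)) S.le_cost hb5 (by omega) ?_ ?_ ?_ ?_
  · refine ⟨by simp [State.setReg_reg], by simp [State.setReg_reg], fun r hr => ?_, rfl, ?_⟩
    · rw [State.setReg_reg, if_neg (by omega), State.setReg_reg, if_neg (by omega),
        State.setReg_reg, if_neg (by omega), lR r (by omega)]
    · simpa [State.setReg_reg] using MinTrack.empty _ _ _
  · rintro k t ⟨h1, h2, -⟩; exact ⟨h1, h2⟩
  · rintro k t hk hbt ⟨c9, c10, cR, cM, cT⟩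
    have hmem : l[k] ∈ l := List.getElem_mem hk
    have hsub := mem_subsList.1 hmem
    have hval : (Expr.load 4 (.reg 9)).eval t = mask l[k] := by
      simp only [Expr.eval, c9, cM, hL.listed k hk]
    have htest : (Expr.op .eq (.load 8 (.load 4 (.reg 9))) (.reg 3)).eval t ≠ 0 ↔
        l[k].card = b := by
      have h1 : (Expr.load 8 (.load 4 (.reg 9))).eval t = l[k].card := by
        rw [Expr.eval, hval, cM, hL.card _ hmem]
      rw [Expr.eval, h1]
      simp [Expr.eval, Op.eval, cR 3 (by norm_num), h3]
    refine Runs.when S.le_cost hbt rfl (fun h0 => ?_) (fun h0 => ?_)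
    · have hcard := htest.1 h0
      refine Runs.seq (R := fun t' => t' = t.setReg 13 (mask l[k])) (Runs.assign S.le_cost hbt rfl
        hval (S.mask_lt hsub.2.1) rfl) ?_
      rintro t1 hbt1 rfl
      have Et1 : Env n W (t.setReg 13 (mask l[k])) := by
        refine E.congr ?_ ?_ ?_ ?_ ?_ <;>
          simp [State.setReg_reg, State.setReg_mem, cR, cM, lM]
      refine Runs.seq (runs_computeCut S hbt1 Et1 hR hsub.1
        (by simp [State.setReg_reg, cR, h8]) (by simp [State.setReg_reg])) ?_
      rintro t2 hbt2 ⟨d14, dR, dM⟩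
      have dR' : ∀ r < 13, t2.reg r = t.reg r := fun r hr => by
        rw [dR r (by omega), State.setReg_reg, if_neg (by omega)]
      have d13 : t2.reg 13 = mask l[k] := by
        rw [dR 13 (by norm_num), State.setReg_reg, if_pos rfl]
      refine (runs_updateMin S.le_cost hbt2 (cur := 11) (ch := 12) (val := 14) (arg := 13)
        (x := l[k]) (C := ((l.take k).filter fun T => T.card = b).toFinset) (enc := mask)
        (f := cutWeight W R) (by norm_num) (by norm_num) ?_ d14 d13).mono le_rfl ?_
      · rw [dR' 11 (by norm_num), dR' 12 (by norm_num)]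
        exact cT
      · rintro t3 - ⟨eT, eR, eM⟩
        have eR' : ∀ r < 11, t3.reg r = t.reg r := fun r h => by
          rw [eR r (by omega) (by omega), dR' r (by omega)]
        refine ⟨(eR' 9 (by norm_num)).trans c9, by simp [State.setReg_reg], ?_, fun r hr => ?_,
          ?_, ?_⟩
        · rw [State.setReg_reg, if_neg (by norm_num), eR' 10 (by norm_num), c10]
        · rw [State.setReg_reg, if_neg (by omega), eR' r (by omega), cR r hr]
        · rw [State.setReg_mem, eM, dM]; exact cM
        · rw [State.setReg_reg, if_neg (by norm_num), State.setReg_reg, if_neg (by norm_num)]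
          convert eT using 1
          rw [List.take_succ_eq_append_getElem hk, List.filter_append, List.toFinset_append]
          ext x
          simp [hcard, or_comm]
    · have hcard : ¬ l[k].card = b := fun h => htest.2 h h0
      refine ⟨c9, by simp [State.setReg_reg], by simp [State.setReg_reg, c10], fun r hr => by
        rw [State.setReg_reg, if_neg (by omega), cR r hr], cM, ?_⟩
      rw [State.setReg_reg, if_neg (by norm_num), State.setReg_reg, if_neg (by norm_num)]
      convert cT using 1
      rw [List.take_succ_eq_append_getElem hk, List.filter_append, List.toFinset_append]
      simp [hcard]
  · rintro t - ⟨-, -, cR, cM, cT⟩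
    rw [List.take_length] at cT
    have hmem : ∀ T, T ∈ (l.filter fun T => T.card = b).toFinset ↔ T ⊆ R ∧ T.card = b := by
      intro T
      rw [List.mem_toFinset, List.mem_filter, mem_subsList, decide_eq_true_eq]
      exact ⟨fun h => ⟨h.1.1, h.2⟩, fun h => ⟨⟨h.1, h.1.trans hR, h.2.le⟩, h.2⟩⟩
    obtain ⟨T₀, hT₀, hT₀'⟩ := exists_subset_card_eq hbR
    obtain ⟨T, hT, hT1, hT2⟩ := cT.mem ⟨T₀, (hmem T₀).2 ⟨hT₀, hT₀'⟩⟩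
    refine ⟨⟨T, ⟨((hmem T).1 hT).1, ((hmem T).1 hT).2, fun T' h1 h2 => ?_⟩, hT1⟩, cR, fun a h4 h8 =>
      by rw [cM, lM a h4 h8]⟩
    have := cT.le T' ((hmem T').2 ⟨h1, h2⟩)
    omega

/-! ### Writing down the ordering -/

/-- Write into memory `2` the ordering of all vertices that the tables describe. -/
def reconstruct : Program :=
  .seq (.assign 51 (.reg 1)) <|
  forLoop 50 0 <|
    .seq (.store 2 (.load 7 (.reg 51)) (.op .sub (.op .sub (.reg 0) (.reg 50)) (.const 1))) <|
    .assign 51 (.op .sub (.reg 51) (.load 10 (.load 7 (.reg 51))))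

/-- The last `i` vertices of an ordering of weight `c` have been placed, those in `F` have not. -/
structure Placed (n : ℕ) (W : ℕ → ℕ → ℕ) (c i : ℕ) (D pos : ℕ → ℕ) (F : Finset ℕ) : Prop where
  subset : F ⊆ range n
  card : F.card + i = n
  mem : ∀ v ∈ range n \ F, F.card ≤ pos v ∧ pos v < n
  inj : Set.InjOn pos ((range n \ F : Finset ℕ) : Set ℕ)
  cost : c = D (mask F) + ∑ v ∈ range n \ F,
    (outWeight W v F + outWeight W v ((range n \ F).filter fun u => pos u < pos v))

/-- The new position `n - i - 1` is `F.card - 1`, just below all positions in use. The weight of the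
arcs from `v` to `F.erase v` leaves the table entry and enters the sum. -/
theorem Placed.step {c i : ℕ} {D pos : ℕ → ℕ} {F : Finset ℕ} (h : Placed n W c i D pos F) {v : ℕ}
    (hv : v ∈ F) (hD : D (mask F) = D (mask (F.erase v)) + outWeight W v (F.erase v)) :
    Placed n W c (i + 1) D (Function.update pos v (n - i - 1)) (F.erase v) := by
  have hvn : v ∈ range n := h.subset hv
  have hset : range n \ F.erase v = insert v (range n \ F) := by
    ext x
    by_cases hx : x = v
    · subst hx; simpa using hvn
    · simp [hx]
  have hvG : v ∉ range n \ F := by simp [hv]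
  have hcard := card_erase_add_one hv
  have hi := h.card
  have hold : ∀ u ∈ range n \ F, Function.update pos v (n - i - 1) u = pos u := fun u hu =>
    Function.update_of_ne (fun e : u = v => hvG (by rw [← e]; exact hu)) _ _
  refine ⟨(erase_subset _ _).trans h.subset, by omega, ?_, ?_, ?_⟩
  · rw [hset]
    intro u hu
    rcases mem_insert.1 hu with rfl | hu
    · rw [Function.update_self]; omega
    · rw [hold u hu]
      have := h.mem u hu
      omega
  · rw [hset, coe_insert, Set.injOn_insert (by simpa using hvG)]
    constructor
    · intro x hx y hy hxy
      rw [hold x hx, hold y hy] at hxy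
      exact h.inj hx hy hxy
    · rintro ⟨x, hx, hxy⟩
      rw [hold x hx, Function.update_self] at hxy
      have := h.mem x hx
      omega
  · have e1 : outWeight W v ((insert v (range n \ F)).filter fun u =>
        Function.update pos v (n - i - 1) u < Function.update pos v (n - i - 1) v) = 0 := by
      rw [filter_eq_empty_iff.2, outWeight, sum_empty]
      intro u hu
      rw [Function.update_self]
      rcases mem_insert.1 hu with rfl | hu
      · rw [Function.update_self]; omega
      · rw [hold u hu]
        have := h.mem u hu
        omega
    -- For a vertex `x` placed before this step, `v` only moves from the unplaced vertices to the
    -- placed ones ahead of `x`; the total for `x` is unchanged.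
    have e2 : ∀ x ∈ range n \ F, outWeight W x (F.erase v) + outWeight W x
        ((insert v (range n \ F)).filter fun u =>
          Function.update pos v (n - i - 1) u < Function.update pos v (n - i - 1) x) =
        outWeight W x F + outWeight W x ((range n \ F).filter fun u => pos u < pos x) := by
      intro x hx
      have hx' := h.mem x hx
      rw [filter_insert, if_pos (by rw [Function.update_self, hold x hx]; omega)]
      have : (range n \ F).filter (fun u => Function.update pos v (n - i - 1) u <
          Function.update pos v (n - i - 1) x) = (range n \ F).filter fun u => pos u < pos x :=
        filter_congr fun u hu => by rw [hold u hu, hold x hx]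
      rw [this]
      simp only [outWeight]
      rw [sum_insert (by simp [hv]), ← sum_erase_add F _ hv]
      ring
    rw [hset, sum_insert hvG, e1, sum_congr rfl e2, h.cost, hD]
    ring

/-- `pos` is an ordering of `n` vertices. -/
structure IsOrdering (n : ℕ) (pos : ℕ → ℕ) : Prop where
  lt : ∀ v < n, pos v < n
  inj : Set.InjOn pos (range n : Finset ℕ)

theorem Traceable.apply_zero {D Ch : ℕ → ℕ} (h : Traceable W D Ch ∅) : D 0 = 0 := by
  cases h with
  | empty h => exact h
  | step hv _ _ _ => simp at hv

/-- When no vertex is left, `D 0 = 0` and the cost equation of `Placed` says that the table entry is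
exactly the weight of the ordering written down. -/
theorem runs_reconstruct (S : Setup n w Z K W) {s : State} (hb : Bdd Z s) (E : Env n W s)
    (hT : Traceable W (s.mem 6) (s.mem 7) (range n)) :
    Runs Z K reconstruct s (4 * n + 3) fun s' =>
      (∀ r < 50, s'.reg r = s.reg r) ∧ (∀ a, a ≠ 2 → s'.mem a = s.mem a) ∧
      IsOrdering n (s'.mem 2) ∧
      s.mem 6 (mask (range n)) = inversionWeight W (s'.mem 2) (range n) := by
  refine Runs.mono_time (T := 1 + (n * ((1 + 1) + 2) + 2)) ?_ (le_of_eq (by ring))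
  refine Runs.seq (R := fun t => t = s.setReg 51 (mask (range n))) (Runs.assign S.le_cost hb rfl
    E.full (S.mask_lt subset_rfl) rfl) ?_
  rintro s1 hb1 rfl
  refine Runs.forLoop (N := n) (fun i t => t.reg 50 = i ∧ (∀ r < 50, t.reg r = s.reg r) ∧
    (∀ a, a ≠ 2 → t.mem a = s.mem a) ∧ ∃ F, t.reg 51 = mask F ∧
      Placed n W (s.mem 6 (mask (range n))) i (s.mem 6) (t.mem 2) F ∧
      Traceable W (s.mem 6) (s.mem 7) F) S.le_cost hb1 S.n_lt ?_ ?_ ?_ ?_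
  · refine ⟨by simp [State.setReg_reg], fun r hr => ?_, fun a _ => rfl, range n,
      by simp [State.setReg_reg], ⟨subset_rfl, by simp, by simp, by simp, by simp⟩, hT⟩
    rw [State.setReg_reg, if_neg (by omega), State.setReg_reg, if_neg (by omega)]
  · rintro k t ⟨h1, h2, -⟩
    exact ⟨h1, (h2 0 (by norm_num)).trans E.size⟩
  · rintro i t hi hbt ⟨c50, cR, cM, F, c51, cP, cT⟩
    cases cT with
    -- Excluded: `i < n` vertices have been placed, so some are left.
    | empty _ => have := cP.card; simp at this; omega
    | @step _ v hv hCh hD hT' =>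
    have hvn := mem_range.1 (cP.subset hv)
    have e7 : t.mem 7 (mask F) = v := by rw [cM 7 (by norm_num), hCh]
    refine Runs.seq (R := fun t' => t' = t.setMem 2 v (n - i - 1)) (Runs.store S.le_cost hbt rfl rfl
      ?_ ?_ (hvn.trans S.n_lt) (lt_of_le_of_lt (by omega) S.n_lt) rfl) ?_
    · simp only [Expr.eval, c51, e7]
    · simp only [Expr.eval, Op.eval, c50, cR 0 (by norm_num), E.size]
    rintro t1 hbt1 rfl
    refine Runs.assign S.le_cost hbt1 (x := mask (F.erase v)) rfl ?_
      (S.mask_lt ((erase_subset _ _).trans cP.subset)) ?_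
    · simp only [Expr.eval, Op.eval, State.setMem_reg, c51]
      rw [State.setMem_mem_of_ne _ _ _ (by norm_num), State.setMem_mem_of_ne _ _ _ (by norm_num),
        e7, cM 10 (by norm_num), E.pow v hvn, mask_erase hv]
    · refine ⟨?_, by simp [State.setReg_reg], fun r hr => ?_, fun a ha => ?_, F.erase v,
        by simp [State.setReg_reg], ?_, hT'⟩
      · rw [State.setReg_reg, if_neg (by norm_num)]; exact c50
      · rw [State.setReg_reg, if_neg (by omega), State.setReg_reg, if_neg (by omega),
          State.setMem_reg, cR r hr]
      · rw [State.setReg_mem, State.setReg_mem, State.setMem_mem_of_ne _ _ _ ha, cM a ha]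
      · rw [State.setReg_mem, State.setReg_mem, State.setMem_mem_self]
        exact cP.step hv hD
  · rintro t - ⟨-, cR, cM, F, -, cP, cT⟩
    have hF : F = ∅ := card_eq_zero.1 (by have := cP.card; omega)
    subst hF
    refine ⟨cR, cM, ⟨fun v hv => (cP.mem v (by simpa using hv)).2, by simpa using cP.inj⟩, ?_⟩
    rw [cP.cost, mask_empty, cT.apply_zero]
    simp [inversionWeight, outWeight]

end

/-! ### Evaluating candidates -/

/-- The weight of the backward arcs if `A` comes first, then `T`, then the rest, with the vertices
of each of these blocks ordered by `r`. -/
def blockWeight (W : ℕ → ℕ → ℕ) (n : ℕ) (r : ℕ → ℕ) (A T : Finset ℕ) : ℕ :=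
  inversionWeight W r A + (∑ v ∈ T, outWeight W v A + inversionWeight W r T) +
    (∑ v ∈ (range n \ A) \ T, outWeight W v (A ∪ T) + inversionWeight W r ((range n \ A) \ T))

/-- Compute optimal orderings of the set in register `7`, the set in register `12`, and the rest of
the set in register `8`, one after the other. -/
def orderBlocks : Program :=
  .seq (.store 6 (.const 0) (.const 0)) <|
  .seq (.assign 16 (.const 0)) <| .seq (.assign 17 (.reg 7)) <| .seq extend <|
  .seq (.assign 16 (.reg 7)) <| .seq (.assign 17 (.reg 12)) <| .seq extend <|
  .seq (.assign 16 (.op .add (.reg 7) (.reg 12))) <|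
  .seq (.assign 17 (.op .sub (.reg 8) (.reg 12))) extend

/-- Write down the ordering described by the tables if it is better than the best one so far;
register `4` holds one plus the weight of the latter (or `0` if there is none). -/
def keepBest : Program :=
  .ite (.op .lor (.op .eq (.reg 4) (.const 0))
      (.op .lt (.op .add (.load 6 (.reg 1)) (.const 1)) (.reg 4)))
    (.seq (.assign 4 (.op .add (.load 6 (.reg 1)) (.const 1))) reconstruct) .skip

/-- Try the orderings that begin with the set number `k` on the list in memory `3`, where `k` is
the content of register `5`. -/
def tryPrefix : Program :=
  .seq (.assign 7 (.load 3 (.reg 5))) <|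
  .seq (.assign 8 (.op .sub (.reg 1) (.reg 7))) <|
  .seq minCut <|
  .seq orderBlocks keepBest

section

variable {n w Z K : ℕ} {W : ℕ → ℕ → ℕ}

/-- Three extensions, from `∅` by `A`, from `A` by `T` and from `A ∪ T` by the rest. Each keeps the
entry of its base set, so the three optimality bounds add up to `blockWeight`, for all rankings `r`
at once. -/
theorem runs_orderBlocks (S : Setup n w Z K W) {s : State} (hb : Bdd Z s) (E : Env n W s)
    {A T : Finset ℕ} (hA : A ⊆ range n) (hT : T ⊆ range n \ A) (h7 : s.reg 7 = mask A)
    (h8 : s.reg 8 = mask (range n \ A)) (h12 : s.reg 12 = mask T) {m : ℕ} (hmA : A.card ≤ m)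
    (hmT : T.card ≤ m) (hmU : ((range n \ A) \ T).card ≤ m) :
    Runs Z K orderBlocks s (3 * (2 ^ m * (5 * n * n + 21 * n + 10) + (7 * n + 10)) + 7) fun s' =>
      (∀ r < 16, s'.reg r = s.reg r) ∧
      (∀ a, a ≠ 5 → a ≠ 6 → a ≠ 7 → a ≠ 8 → s'.mem a = s.mem a) ∧
      Traceable W (s'.mem 6) (s'.mem 7) (range n) ∧
      ∀ r : ℕ → ℕ, Set.InjOn r (range n : Finset ℕ) →
        s'.mem 6 (mask (range n)) ≤ blockWeight W n r A T := by
  have hTn : T ⊆ range n := hT.trans sdiff_subset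
  have hAT : Disjoint A T := disjoint_of_subset_right hT disjoint_sdiff
  have hATn : A ∪ T ⊆ range n := union_subset hA hTn
  have hUn : (range n \ A) \ T ⊆ range n := sdiff_subset.trans sdiff_subset
  have hATU : Disjoint (A ∪ T) ((range n \ A) \ T) := by
    rw [sdiff_sdiff_left]; exact disjoint_sdiff
  have hall : (A ∪ T) ∪ ((range n \ A) \ T) = range n := by
    rw [sdiff_sdiff_left]; exact union_sdiff_of_subset hATn
  set t₀ := 5 * n * n + 21 * n + 10 with ht₀
  have htime : ∀ X : Finset ℕ, X.card ≤ m →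
      2 ^ X.card * t₀ + (7 * n + 10) ≤ 2 ^ m * t₀ + (7 * n + 10) := fun X hX =>
    Nat.add_le_add_right (Nat.mul_le_mul_right _ (Nat.pow_le_pow_right (by norm_num) hX)) _
  set τ := 2 ^ m * t₀ + (7 * n + 10) with hτ
  refine Runs.mono_time (T := 1 + (1 + (1 + (τ + (1 + (1 + (τ + (1 + (1 + τ)))))))))
    ?_ (le_of_eq (by ring))
  refine Runs.seq (R := fun t => t = s.setMem 6 0 0) (Runs.store S.le_cost hb rfl rfl rfl rfl
    (by positivity) (by positivity) rfl) ?_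
  rintro s1 hb1 rfl
  refine Runs.seq (R := fun t => t = (s.setMem 6 0 0).setReg 16 0) (Runs.assign S.le_cost hb1
    rfl rfl (by positivity) rfl) ?_
  rintro s2 hb2 rfl
  refine Runs.seq (R := fun t => t = ((s.setMem 6 0 0).setReg 16 0).setReg 17 (mask A))
    (Runs.assign S.le_cost hb2 rfl
      (by simp [Expr.eval, State.setReg_reg, State.setMem_reg, h7]) (S.mask_lt hA) rfl) ?_
  rintro s3 hb3 rfl
  have E3 : Env n W (((s.setMem 6 0 0).setReg 16 0).setReg 17 (mask A)) := by
    refine E.congr ?_ ?_ ?_ ?_ ?_ <;>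
      simp [State.setReg_reg, State.setReg_mem, State.setMem_reg, State.setMem_mem]
  refine Runs.seq ((runs_extend S hb3 E3 (B := ∅) (X := A) (by simp) hA (by simp)
    (by simp [State.setReg_reg, mask_empty]) (by simp [State.setReg_reg]) (.empty ?_)).mono_time
    (htime A hmA)) ?_
  · simp [State.setReg_mem, State.setMem_mem]
  rintro s4 hb4 ⟨aR, aM, a6, aX⟩
  have a6' : s4.mem 6 (mask ∅) = 0 := by
    rw [a6]; simp [State.setReg_mem, State.setMem_mem, mask_empty]
  have aR' : ∀ r < 16, s4.reg r = s.reg r := fun r hr => by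
    rw [aR r hr, State.setReg_reg, if_neg (by omega), State.setReg_reg, if_neg (by omega)]; rfl
  have aM' : ∀ a, a ≠ 5 → a ≠ 6 → a ≠ 7 → a ≠ 8 → s4.mem a = s.mem a := fun a h5 h6 h7 h8 => by
    rw [aM a h5 h6 h7 h8, State.setReg_mem, State.setReg_mem, State.setMem_mem_of_ne _ _ _ h6]
  refine Runs.seq (R := fun t => t = s4.setReg 16 (mask A)) (Runs.assign S.le_cost hb4 rfl
    ((aR' 7 (by norm_num)).trans h7) (S.mask_lt hA) rfl) ?_
  rintro s5 hb5 rfl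
  refine Runs.seq (R := fun t => t = (s4.setReg 16 (mask A)).setReg 17 (mask T)) (Runs.assign
    S.le_cost hb5 rfl (by simp [Expr.eval, State.setReg_reg, aR', h12]) (S.mask_lt hTn) rfl) ?_
  rintro s6 hb6 rfl
  have E6 : Env n W ((s4.setReg 16 (mask A)).setReg 17 (mask T)) := by
    refine E.congr ?_ ?_ ?_ ?_ ?_ <;> simp [State.setReg_reg, State.setReg_mem, aR', aM']
  refine Runs.seq ((runs_extend S hb6 E6 hA hTn hAT (by simp [State.setReg_reg])
    (by simp [State.setReg_reg]) ?_).mono_time (htime T hmT)) ?_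
  · simpa [State.setReg_mem] using aX.traceable A subset_rfl
  rintro s7 hb7 ⟨bR, bM, b6, bX⟩
  rw [State.setReg_mem, State.setReg_mem] at b6
  have bR' : ∀ r < 16, s7.reg r = s.reg r := fun r hr => by
    rw [bR r hr, State.setReg_reg, if_neg (by omega), State.setReg_reg, if_neg (by omega),
      aR' r hr]
  have bM' : ∀ a, a ≠ 5 → a ≠ 6 → a ≠ 7 → a ≠ 8 → s7.mem a = s.mem a := fun a h5 h6 h7 h8 => by
    rw [bM a h5 h6 h7 h8, State.setReg_mem, State.setReg_mem, aM' a h5 h6 h7 h8]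
  refine Runs.seq (R := fun t => t = s7.setReg 16 (mask (A ∪ T))) (Runs.assign S.le_cost hb7 rfl
    (by simp [Expr.eval, Op.eval, bR', h7, h12, mask_union hAT]) (S.mask_lt hATn) rfl) ?_
  rintro s8 hb8 rfl
  refine Runs.seq (R := fun t => t = (s7.setReg 16 (mask (A ∪ T))).setReg 17
    (mask ((range n \ A) \ T))) (Runs.assign S.le_cost hb8 rfl
    (by simp [Expr.eval, Op.eval, State.setReg_reg, bR', h8, h12, mask_sdiff hT]) (S.mask_lt hUn)
    rfl) ?_
  rintro s9 hb9 rfl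
  have E9 : Env n W ((s7.setReg 16 (mask (A ∪ T))).setReg 17 (mask ((range n \ A) \ T))) := by
    refine E.congr ?_ ?_ ?_ ?_ ?_ <;> simp [State.setReg_reg, State.setReg_mem, bR', bM']
  refine (runs_extend S hb9 E9 hATn hUn hATU (by simp [State.setReg_reg])
    (by simp [State.setReg_reg]) ?_).mono (htime _ hmU) ?_
  · simpa [State.setReg_mem] using bX.traceable T subset_rfl
  rintro s10 - ⟨cR, cM, c6, cX⟩
  rw [State.setReg_mem, State.setReg_mem] at c6
  refine ⟨fun r hr => ?_, fun a h5 h6 h7 h8 => ?_, ?_, fun r hr => ?_⟩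
  · rw [cR r hr, State.setReg_reg, if_neg (by omega), State.setReg_reg, if_neg (by omega),
      bR' r hr]
  · rw [cM a h5 h6 h7 h8, State.setReg_mem, State.setReg_mem, bM' a h5 h6 h7 h8]
  · have := cX.traceable _ subset_rfl
    rwa [hall] at this
  · have hr' : ∀ X ⊆ range n, Set.InjOn r (X : Set ℕ) := fun X hX =>
      hr.mono (coe_subset.2 hX)
    have i1 := aX.le_inversionWeight (by simp) (hr' A hA) A subset_rfl
    have i2 := bX.le_inversionWeight hAT (hr' T hTn) T subset_rfl
    have i3 := cX.le_inversionWeight hATU (hr' _ hUn) _ subset_rfl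
    rw [hall, c6] at i3
    rw [b6] at i2
    rw [a6', empty_union] at i1
    have : ∑ v ∈ A, outWeight W v ∅ = 0 := by simp [outWeight]
    rw [blockWeight]
    omega

/-- Register `4` holds one plus the weight of the ordering in memory `2`, unless it is `0`. -/
def HoldsBest (n : ℕ) (W : ℕ → ℕ → ℕ) (s : State) : Prop :=
  s.reg 4 ≠ 0 → IsOrdering n (s.mem 2) ∧ s.reg 4 = inversionWeight W (s.mem 2) (range n) + 1

theorem runs_keepBest (S : Setup n w Z K W) {s : State} (hb : Bdd Z s) (E : Env n W s)
    (hT : Traceable W (s.mem 6) (s.mem 7) (range n)) (hB : HoldsBest n W s) :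
    Runs Z K keepBest s (4 * n + 6) fun s' =>
      (∀ r < 50, r ≠ 4 → s'.reg r = s.reg r) ∧ (∀ a, a ≠ 2 → s'.mem a = s.mem a) ∧
      HoldsBest n W s' ∧ s'.reg 4 ≠ 0 ∧ (s.reg 4 ≠ 0 → s'.reg 4 ≤ s.reg 4) ∧
      s'.reg 4 ≤ s.mem 6 (mask (range n)) + 1 := by
  have hval : (Expr.op .add (.load 6 (.reg 1)) (.const 1)).eval s =
      s.mem 6 (mask (range n)) + 1 := by
    simp only [Expr.eval, Op.eval, E.full]
  have hle := hT.le S subset_rfl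
  rw [card_range, ← mul_assoc] at hle
  refine Runs.mono_time (T := (1 + (4 * n + 3)) + 2) ?_ (le_of_eq (by ring))
  refine Runs.when S.le_cost hb rfl (fun h0 => ?_) (fun h0 => ?_)
  · rw [improves_ne_zero, hval] at h0
    simp only [Expr.eval] at h0
    refine Runs.seq (R := fun t => t = s.setReg 4 (s.mem 6 (mask (range n)) + 1)) (Runs.assign
      S.le_cost hb rfl hval (S.lt_of_le_weight (by omega)) rfl) ?_
    rintro s1 hb1 rfl
    have E1 : Env n W (s.setReg 4 (s.mem 6 (mask (range n)) + 1)) :=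
      E.congr (by simp [State.setReg_reg]) (by simp [State.setReg_reg]) rfl rfl rfl
    refine (runs_reconstruct S hb1 E1 hT).mono le_rfl ?_
    rintro s2 - ⟨aR, aM, aO, aW⟩
    have a4 : s2.reg 4 = s.mem 6 (mask (range n)) + 1 := by
      rw [aR 4 (by norm_num), State.setReg_reg, if_pos rfl]
    refine ⟨fun r hr h4 => ?_, aM, fun _ => ⟨aO, ?_⟩, by omega, fun h => ?_, a4.le⟩
    · rw [aR r hr, State.setReg_reg, if_neg h4]
    · rw [a4, ← aW]; rfl
    · rw [a4]
      omega
  · have h0' := mt improves_ne_zero.2 (not_not.2 h0)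
    rw [hval] at h0'
    simp only [Expr.eval, not_or, not_lt] at h0'
    exact ⟨fun _ _ _ => rfl, fun _ _ => rfl, hB, h0'.1, fun _ => le_rfl, h0'.2⟩

/-- The number `c` is at most one plus the weight of the backward arcs whenever `A` comes first,
followed by a minimum cut with `b` vertices. -/
def Beats (n : ℕ) (W : ℕ → ℕ → ℕ) (b : ℕ) (A : Finset ℕ) (c : ℕ) : Prop :=
  ∃ T, IsMinCut W (range n \ A) b T ∧ ∀ r : ℕ → ℕ, Set.InjOn r (range n : Finset ℕ) →
    c ≤ blockWeight W n r A T + 1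

theorem Beats.mono {b : ℕ} {A : Finset ℕ} {c c' : ℕ} (h : Beats n W b A c) (hc : c' ≤ c) :
    Beats n W b A c' := by
  obtain ⟨T, h1, h2⟩ := h
  exact ⟨T, h1, fun r hr => hc.trans (h2 r hr)⟩

/-- Both `A` and `T` have at most `A.card + b ≤ n - b` elements, and the rest has `n - A.card - b`;
hence the exponent `n - b`. The set `T` found is independent of the ranking, as `Beats` demands. -/
theorem runs_tryPrefix (S : Setup n w Z K W) {s : State} (hb : Bdd Z s) (E : Env n W s)
    (hB : HoldsBest n W s) {A : Finset ℕ} (hA : A ⊆ range n) {b : ℕ} (h3 : s.reg 3 = b)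
    (hAb : A.card + b ≤ n) (hAb' : A.card + b ≤ n - b) (h5 : s.mem 3 (s.reg 5) = mask A) :
    Runs Z K tryPrefix s (smallSets n b * (5 * n * n + 17 * n + 12) +
        3 * (2 ^ (n - b) * (5 * n * n + 21 * n + 10)) + (32 * n + 56)) fun s' =>
      (∀ r < 7, r ≠ 4 → s'.reg r = s.reg r) ∧ s'.mem 3 = s.mem 3 ∧ Env n W s' ∧
      HoldsBest n W s' ∧ s'.reg 4 ≠ 0 ∧ (s.reg 4 ≠ 0 → s'.reg 4 ≤ s.reg 4) ∧
      Beats n W b A (s'.reg 4) := by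
  have hR : range n \ A ⊆ range n := sdiff_subset
  have hRc : (range n \ A).card = n - A.card := by rw [card_sdiff_of_subset hA, card_range]
  refine Runs.mono_time (T := 1 + (1 + ((smallSets n b * (5 * n * n + 17 * n + 12) + (7 * n + 11)) +
    ((3 * (2 ^ (n - b) * (5 * n * n + 21 * n + 10) + (7 * n + 10)) + 7) + (4 * n + 6))))) ?_
    (le_of_eq (by ring))
  refine Runs.seq (R := fun t => t = s.setReg 7 (mask A)) (Runs.assign S.le_cost hb rfl h5
    (S.mask_lt hA) rfl) ?_
  rintro s1 hb1 rfl
  refine Runs.seq (R := fun t => t = (s.setReg 7 (mask A)).setReg 8 (mask (range n \ A)))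
    (Runs.assign S.le_cost hb1 rfl
      (by simp [Expr.eval, Op.eval, State.setReg_reg, E.full, mask_sdiff hA]) (S.mask_lt hR)
      rfl) ?_
  rintro s2 hb2 rfl
  have E2 : Env n W ((s.setReg 7 (mask A)).setReg 8 (mask (range n \ A))) :=
    E.congr (by simp [State.setReg_reg]) (by simp [State.setReg_reg]) rfl rfl rfl
  refine Runs.seq (runs_minCut S hb2 E2 hR (b := b) (by omega) (by simp [State.setReg_reg])
    (by simp [State.setReg_reg, h3])) ?_
  rintro s3 hb3 ⟨⟨T, hT, a12⟩, aR, aM⟩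
  have E3 : Env n W s3 :=
    E2.congr (aR 0 (by norm_num)) (aR 1 (by norm_num)) (aM 1 (by norm_num) (by norm_num))
      (aM 9 (by norm_num) (by norm_num)) (aM 10 (by norm_num) (by norm_num))
  have hTc := hT.card
  have hUc : ((range n \ A) \ T).card = n - A.card - b := by
    rw [card_sdiff_of_subset hT.subset, hRc, hTc]
  refine Runs.seq (runs_orderBlocks S hb3 E3 hA hT.subset (by simp [aR, State.setReg_reg])
    (by simp [aR, State.setReg_reg]) a12 (m := n - b) (by omega) (by omega) (by omega)) ?_
  rintro s4 hb4 ⟨bR, bM, bT, bW⟩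
  have E4 : Env n W s4 := by
    refine E3.congr ?_ ?_ ?_ ?_ ?_ <;> simp [bR, bM]
  have bR' : ∀ r < 7, s4.reg r = s.reg r := fun r hr => by
    rw [bR r (by omega), aR r (by omega), State.setReg_reg, if_neg (by omega), State.setReg_reg,
      if_neg (by omega)]
  have bM' : ∀ a, a ≠ 4 → a ≠ 5 → a ≠ 6 → a ≠ 7 → a ≠ 8 → s4.mem a = s.mem a :=
    fun a h4 h5 h6 h7 h8 => by
      rw [bM a h5 h6 h7 h8, aM a h4 h8, State.setReg_mem, State.setReg_mem]
  have b4 := bR' 4 (by norm_num)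
  have b2 := bM' 2 (by norm_num) (by norm_num) (by norm_num) (by norm_num) (by norm_num)
  refine (runs_keepBest S hb4 E4 bT (by rw [HoldsBest, b4, b2]; exact hB)).mono le_rfl ?_
  rintro s5 - ⟨cR, cM, cB, c0, cle, cle'⟩
  refine ⟨fun r hr h4 => ?_, ?_, ?_, cB, c0, by rw [← b4]; exact cle, T, hT, fun r hr =>
    cle'.trans (Nat.add_le_add_right (bW r hr) 1)⟩
  · rw [cR r (by omega) h4, bR' r hr]
  · rw [cM 3 (by norm_num), bM' 3 (by norm_num) (by norm_num) (by norm_num) (by norm_num)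
      (by norm_num)]
  · refine E4.congr ?_ ?_ ?_ ?_ ?_ <;> simp [cR, cM]

/-! ### The complete program -/

/-- Try all prefixes with at most `n / p` vertices, followed by minimum cuts with
`n / q - n / p` vertices. -/
def stage (p q : ℕ) : Program :=
  .seq (.assign 2 (.op .div (.reg 0) (.const p))) <|
  .seq (.assign 3 (.op .div (.reg 0) (.const q))) <|
  .seq (.assign 3 (.op .sub (.reg 3) (.reg 2))) <|
  .seq (.assign 40 (.reg 1)) <|
  .seq (.assign 41 (.reg 2)) <|
  .seq (listSubsets 3) <|
  .seq (.assign 6 (.reg 45)) <|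
  forLoop 5 6 tryPrefix

/-- Division is not a `linear` operation, being charged the product of the bit lengths. The divisor
is a constant of the program, so its length can be put into `K`. -/
theorem runs_assign_div {p r : ℕ} {s : State} (hb : Bdd Z s) (hp : (Z + 20) * (p.size + 10) ≤ K)
    {Q : State → Prop} (hQ : Q (s.setReg r (s.reg 0 / p))) :
    Runs Z K (.assign r (.op .div (.reg 0) (.const p))) s 1 Q := by
  have h0 := hb.1 0
  have hlt : s.reg 0 / p < 2 ^ Z := lt_of_le_of_lt (Nat.div_le_self _ _) h0
  refine ⟨_, _, .assign s r _, ?_, hb.setReg hlt, hQ⟩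
  have h1 : (s.reg 0).size ≤ Z := Nat.size_le.2 h0
  have h2 : (s.reg 0 / p).size ≤ Z := Nat.size_le.2 hlt
  simp only [Expr.cost, Expr.eval, Op.cost, Op.eval]
  nlinarith

theorem runs_stage (S : Setup n w Z K W) {p q : ℕ} (hp : (Z + 20) * (p.size + 10) ≤ K)
    (hq : (Z + 20) * (q.size + 10) ≤ K) (hpq : n / p ≤ n / q) (hq2 : 2 * (n / q) ≤ n) {s : State}
    (hb : Bdd Z s) (E : Env n W s) (hB : HoldsBest n W s) :
    Runs Z K (stage p q) s (smallSets n (n / p) * (smallSets n (n / q - n / p) *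
        (5 * n * n + 17 * n + 12) + 3 * (2 ^ (n - (n / q - n / p)) * (5 * n * n + 21 * n + 10)) +
        (39 * n + 58)) + (7 * n + 13)) fun s' =>
      Env n W s' ∧ HoldsBest n W s' ∧ s'.reg 4 ≠ 0 ∧ (s.reg 4 ≠ 0 → s'.reg 4 ≤ s.reg 4) ∧
      ∀ A ⊆ range n, A.card ≤ n / p → Beats n W (n / q - n / p) A (s'.reg 4) := by
  set a := n / p with ha
  set b := n / q - a with hbdef
  -- For `x = n / p` and `y = n / q`: prefix and cut together have at most `y ≤ n - y` vertices,
  -- hence at most `n - (y - x)`.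
  have key : ∀ x y, x ≤ y → 2 * y ≤ n →
      x + (y - x) ≤ n ∧ x + (y - x) ≤ n - (y - x) ∧ y - x ≤ n := by omega
  obtain ⟨hab, hab', hbn⟩ : a + b ≤ n ∧ a + b ≤ n - b ∧ b ≤ n := key _ _ hpq hq2
  clear_value b
  set l := subsList (range n) a n with hl
  have hlen : l.length ≤ smallSets n a := length_subsList_le_smallSets
  have hlenn : l.length ≤ 2 ^ n := length_subsList_le_two_pow
  have hlpos : 0 < l.length := List.length_pos_of_mem empty_mem_subsList
  have hpow := S.pow_lt
  rw [pow_succ] at hpow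
  set τ := smallSets n b * (5 * n * n + 17 * n + 12) +
    3 * (2 ^ (n - b) * (5 * n * n + 21 * n + 10)) + (32 * n + 56) with hτ
  refine Runs.mono_time (T := 1 + (1 + (1 + (1 + (1 + ((n * (7 * l.length + 7) + 5) + (1 +
    (l.length * (τ + 2) + 2)))))))) ?_ ?_
  swap
  · calc _ = l.length * (τ + (7 * n + 2)) + (7 * n + 13) := by ring
      _ ≤ smallSets n a * (τ + (7 * n + 2)) + (7 * n + 13) :=
        Nat.add_le_add_right (Nat.mul_le_mul_right _ hlen) _
      _ = _ := by rw [hτ]; ring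
  refine Runs.seq (R := fun t => t = s.setReg 2 a) (runs_assign_div hb hp (by rw [E.size])) ?_
  rintro s1 hb1 rfl
  refine Runs.seq (R := fun t => t = (s.setReg 2 a).setReg 3 (n / q)) (runs_assign_div hb1 hq
    (by simp [State.setReg_reg, E.size])) ?_
  rintro s2 hb2 rfl
  refine Runs.seq (R := fun t => (∀ r < 40, r ≠ 2 → r ≠ 3 → t.reg r = s.reg r) ∧ t.reg 2 = a ∧
    t.reg 3 = b ∧ t.mem = s.mem) (Runs.assign S.le_cost hb2 (x := b) rfl
    (by simp [Expr.eval, Op.eval, State.setReg_reg, hbdef])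
    (lt_of_le_of_lt hbn S.n_lt) ⟨fun r _ h2 h3 => by simp [State.setReg_reg, h2, h3],
      by simp [State.setReg_reg], by simp [State.setReg_reg], rfl⟩) ?_
  rintro s3 hb3 ⟨aR, a2, a3, aM⟩
  have E3 : Env n W s3 := by
    refine E.congr ?_ ?_ ?_ ?_ ?_ <;> simp [aR, aM]
  refine Runs.seq (R := fun t => t = s3.setReg 40 (mask (range n))) (Runs.assign S.le_cost hb3 rfl
    E3.full (S.mask_lt subset_rfl) rfl) ?_
  rintro s4 hb4 rfl
  refine Runs.seq (R := fun t => t = (s3.setReg 40 (mask (range n))).setReg 41 a) (Runs.assign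
    S.le_cost hb4 rfl (by simp [Expr.eval, State.setReg_reg, a2]) (a2 ▸ hb3.1 2) rfl) ?_
  rintro s5 hb5 rfl
  have E5 : Env n W ((s3.setReg 40 (mask (range n))).setReg 41 a) :=
    E3.congr (by simp [State.setReg_reg]) (by simp [State.setReg_reg]) rfl rfl rfl
  refine Runs.seq (runs_listSubsets S (m := 3) (by norm_num) (by norm_num) hb5 E5 (U := range n)
    (a := a) (by simp [State.setReg_reg]) (by simp [State.setReg_reg])) ?_
  rw [← hl]
  rintro s6 hb6 hL
  have E6 := hL.env (by norm_num) (by norm_num) E5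
  have lR : ∀ r < 40, s6.reg r = s3.reg r := fun r hr => by
    rw [hL.regs r (by omega), State.setReg_reg, if_neg (by omega), State.setReg_reg,
      if_neg (by omega)]
  have l4 : s6.reg 4 = s.reg 4 := by simp [lR, aR]
  have l2 : s6.mem 2 = s.mem 2 := by
    rw [hL.mems 2 (by norm_num) (by norm_num), State.setReg_mem, State.setReg_mem, aM]
  have l3 : s6.reg 3 = b := by simp [lR, a3]
  refine Runs.seq (R := fun t => t = s6.setReg 6 l.length) (Runs.assign S.le_cost hb6 rfl
    (by simpa [Expr.eval] using hL.length) (by omega) rfl) ?_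
  rintro s7 hb7 rfl
  refine Runs.forLoop (N := l.length) (fun k t => t.reg 5 = k ∧ t.reg 6 = l.length ∧
    t.reg 3 = b ∧ Listed l (t.mem 3) ∧ Env n W t ∧ HoldsBest n W t ∧ (0 < k → t.reg 4 ≠ 0) ∧
    (s.reg 4 ≠ 0 → t.reg 4 ≠ 0 ∧ t.reg 4 ≤ s.reg 4) ∧
    ∀ i (h : i < l.length), i < k → Beats n W b l[i] (t.reg 4)) S.le_cost hb7 (by omega) ?_ ?_ ?_ ?_
  · refine ⟨by simp [State.setReg_reg], by simp [State.setReg_reg], by simp [State.setReg_reg, l3],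
      hL.listed, E6.congr (by simp [State.setReg_reg]) (by simp [State.setReg_reg]) rfl rfl rfl, ?_,
      fun h => absurd h (lt_irrefl 0), ?_, fun i _ h => absurd h (Nat.not_lt_zero i)⟩
    · simp only [HoldsBest, State.setReg_reg, State.setReg_mem]
      norm_num
      rw [l4, l2]
      exact hB
    · simp [State.setReg_reg, l4]
  · rintro k t ⟨h1, h2, -⟩; exact ⟨h1, h2⟩
  · rintro k t hk hbt ⟨c5, c6, c3, cL, cE, cB, cpos, cs, cI⟩
    have hsub := mem_subsList.1 (List.getElem_mem hk)
    refine (runs_tryPrefix S hbt cE cB (A := l[k]) hsub.1 c3 (by have := hsub.2.2; omega)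
      (by have := hsub.2.2; omega) (by rw [c5, cL k hk])).mono le_rfl ?_
    rintro t' - ⟨dR, dM, dE, dB, d0, dle, dBe⟩
    refine ⟨(dR 5 (by norm_num) (by norm_num)).trans c5, by simp [State.setReg_reg], ?_, ?_, ?_,
      dE.congr (by simp [State.setReg_reg]) (by simp [State.setReg_reg]) rfl rfl rfl, ?_,
      fun _ => by simpa [State.setReg_reg] using d0, fun h => ?_, fun i h hik => ?_⟩
    · simp [State.setReg_reg, dR, c6]
    · simp [State.setReg_reg, dR, c3]
    · rw [State.setReg_mem, dM]; exact cL
    · simpa [HoldsBest, State.setReg_reg, State.setReg_mem] using dB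
    · rw [State.setReg_reg, if_neg (by norm_num)]
      exact ⟨d0, (dle (cs h).1).trans (cs h).2⟩
    · rw [State.setReg_reg, if_neg (by norm_num)]
      rcases Nat.lt_succ_iff_lt_or_eq.1 hik with h' | rfl
      -- Zero stands for the absence of a candidate, which is impossible after a first round;
      -- otherwise register 4 only decreases and earlier bounds persist.
      · by_cases h4 : t.reg 4 = 0
        · exact absurd h4 (cpos (by omega))
        · exact (cI i h h').mono (dle h4)
      · exact dBe
  · rintro t - ⟨-, -, -, -, cE, cB, cpos, cs, cI⟩
    refine ⟨cE, cB, cpos hlpos, fun h => (cs h).2, fun A hA hAc => ?_⟩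
    obtain ⟨i, hi, rfl⟩ := List.getElem_of_mem (l := l) (mem_subsList.2 ⟨hA, hA, hAc⟩)
    exact cI i hi hi

/-- Compute the tables of row offsets and powers of two, and the mask of all vertices. -/
def prepare : Program :=
  .seq (.assign 1 (.const 1)) <|
  .seq (.assign 2 (.const 0)) <|
  .seq (forLoop 5 0 <|
    .seq (.store 10 (.reg 5) (.reg 1)) <|
    .seq (.store 9 (.reg 5) (.reg 2)) <|
    .seq (.assign 1 (.op .add (.reg 1) (.reg 1))) <|
    .assign 2 (.op .add (.reg 2) (.reg 0))) <|
  .assign 1 (.op .sub (.reg 1) (.const 1))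

/-- Powers and row offsets are obtained by repeated addition, which avoids products. The last power
`2 ^ n`, minus one, is the mask of all vertices. -/
theorem runs_prepare (S : Setup n w Z K W) {s : State} (hb : Bdd Z s) (h0 : s.reg 0 = n)
    (h1 : ∀ u < n, ∀ v < n, s.mem 1 (u * n + v) = W u v) :
    Runs Z K prepare s (6 * n + 5) fun s' => Env n W s' ∧ s'.reg 4 = s.reg 4 := by
  have h2Z : 1 < 2 ^ Z := S.lt_of_le_weight (by omega)
  have hpow := S.pow_lt
  have hsq : ∀ k ≤ n, k * n < 2 ^ Z := fun k hk => by
    have : k * n ≤ n * n := Nat.mul_le_mul_right _ hk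
    have := S.lt_two_pow
    have h3 : n * n < n * n * w + 2 ^ (n + 1) + n * n + 2 := by
      have := Nat.zero_le (n * n * w + 2 ^ (n + 1))
      omega
    omega
  have hpk : ∀ k ≤ n + 1, 2 ^ k < 2 ^ Z := fun k hk =>
    lt_of_le_of_lt (Nat.pow_le_pow_right (by norm_num) hk) hpow
  refine Runs.mono_time (T := 1 + (1 + ((n * ((1 + (1 + (1 + 1))) + 2) + 2) + 1))) ?_
    (le_of_eq (by ring))
  refine Runs.seq (R := fun t => t = s.setReg 1 1) (Runs.assign S.le_cost hb rfl rfl h2Z rfl) ?_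
  rintro s1 hb1 rfl
  refine Runs.seq (R := fun t => t = (s.setReg 1 1).setReg 2 0) (Runs.assign S.le_cost hb1 rfl rfl
    (by positivity) rfl) ?_
  rintro s2 hb2 rfl
  refine Runs.seq (R := fun t => t.reg 0 = n ∧ t.reg 1 = 2 ^ n ∧ t.reg 4 = s.reg 4 ∧
    t.mem 1 = s.mem 1 ∧ (∀ u < n, t.mem 10 u = 2 ^ u) ∧ ∀ u < n, t.mem 9 u = u * n) ?_ ?_
  · refine Runs.forLoop (N := n) (fun k t => t.reg 5 = k ∧ t.reg 0 = n ∧ t.reg 1 = 2 ^ k ∧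
      t.reg 2 = k * n ∧ t.reg 4 = s.reg 4 ∧ t.mem 1 = s.mem 1 ∧ (∀ u < k, t.mem 10 u = 2 ^ u) ∧
      ∀ u < k, t.mem 9 u = u * n) S.le_cost hb2 S.n_lt ?_ ?_ ?_ ?_
    · simp [State.setReg_reg, State.setReg_mem, h0]
    · rintro k t ⟨g1, g2, -⟩; exact ⟨g1, g2⟩
    · rintro k t hk hbt ⟨c5, c0, c1, c2, c4, cM, c10, c9⟩
      refine Runs.seq (T := 1) (T' := 3) (R := fun t' => t' = t.setMem 10 k (2 ^ k))
        (Runs.store S.le_cost hbt rfl rfl c5 c1 (c5 ▸ hbt.1 5) (hpk k (by omega)) rfl) ?_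
      rintro t1 hbt1 rfl
      refine Runs.seq (T := 1) (T' := 2) (R := fun t' => t' =
        (t.setMem 10 k (2 ^ k)).setMem 9 k (k * n)) (Runs.store S.le_cost hbt1 (i := .reg 5) (e := .reg 2) rfl rfl c5 c2 (c5 ▸ hbt.1 5) (hsq k hk.le) rfl) ?_
      rintro t2 hbt2 rfl
      refine Runs.seq (T := 1) (T' := 1) (R := fun t' => t' =
        ((t.setMem 10 k (2 ^ k)).setMem 9 k (k * n)).setReg 1 (2 ^ (k + 1))) (Runs.assign S.le_cost hbt2 rfl ?_ (hpk _ (by omega)) rfl) ?_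
      · simp only [Expr.eval, Op.eval, State.setMem_reg, c1]; ring
      rintro t3 hbt3 rfl
      refine Runs.assign S.le_cost hbt3 (x := (k + 1) * n) rfl ?_ (hsq _ hk) ?_
      · simp only [Expr.eval, Op.eval, State.setMem_reg, State.setReg_reg, c2, c0]
        norm_num; ring
      · simp only [State.setReg_reg, State.setReg_mem, State.setMem_mem, State.setMem_reg]
        norm_num
        refine ⟨c5, c0, c4, cM, fun u hu => ?_, fun u hu => ?_⟩
        · rw [Function.update_apply]
          split_ifs with h
          · rw [h]
          · exact c10 u (by omega)
        · rw [Function.update_apply]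
          split_ifs with h
          · rw [h]
          · exact c9 u (by omega)
    · rintro t - ⟨-, c0, c1, -, c4, cM, c10, c9⟩
      exact ⟨c0, c1, c4, cM, c10, c9⟩
  · rintro t hbt ⟨c0, c1, c4, cM, c10, c9⟩
    refine Runs.assign S.le_cost hbt (x := 2 ^ n - 1) rfl (by simp [Expr.eval, Op.eval, c1])
      (lt_of_le_of_lt (Nat.sub_le _ _) (hpk n (by omega))) ⟨⟨?_, ?_, ?_, c9, c10⟩, ?_⟩
    · simp [State.setReg_reg, c0]
    · simp [State.setReg_reg, mask_range]
    · rw [State.setReg_mem, cM]; exact h1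
    · simp [State.setReg_reg, c4]

/-- Perform the stages for the given pairs of denominators. -/
def stages : List (ℕ × ℕ) → Program
  | [] => .skip
  | x :: l => .seq (stage x.1 x.2) (stages l)

theorem runs_stages (S : Setup n w Z K W) {τ : ℕ} (l : List (ℕ × ℕ))
    (hl : ∀ x ∈ l, (Z + 20) * (x.1.size + 10) ≤ K ∧ (Z + 20) * (x.2.size + 10) ≤ K ∧
      n / x.1 ≤ n / x.2 ∧ 2 * (n / x.2) ≤ n ∧
      smallSets n (n / x.1) * (smallSets n (n / x.2 - n / x.1) *
        (5 * n * n + 17 * n + 12) + 3 * (2 ^ (n - (n / x.2 - n / x.1)) *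
        (5 * n * n + 21 * n + 10)) + (39 * n + 58)) + (7 * n + 13) ≤ τ) {s : State}
    (hb : Bdd Z s) (E : Env n W s) (hB : HoldsBest n W s) :
    Runs Z K (stages l) s (l.length * τ + 1) fun s' =>
      HoldsBest n W s' ∧ (s.reg 4 ≠ 0 ∨ l ≠ [] → s'.reg 4 ≠ 0) ∧
      (s.reg 4 ≠ 0 → s'.reg 4 ≤ s.reg 4) ∧
      ∀ x ∈ l, ∀ A ⊆ range n, A.card ≤ n / x.1 →
        Beats n W (n / x.2 - n / x.1) A (s'.reg 4) := by
  induction l generalizing s with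
  | nil =>
    refine (Runs.skip S.le_cost hb ⟨hB, ?_, fun _ => le_rfl, by simp⟩).mono_time (by omega)
    rintro (h | h)
    · exact h
    · exact absurd rfl h
  | cons x l ih =>
    obtain ⟨k1, k2, k3, k4, k5⟩ := hl x List.mem_cons_self
    refine Runs.mono_time (T := τ + (l.length * τ + 1)) ?_
      (le_of_eq (by rw [List.length_cons]; ring))
    refine Runs.seq ((runs_stage S k1 k2 k3 k4 hb E hB).mono_time k5) ?_
    rintro s1 hb1 ⟨aE, aB, a0, ale, aA⟩
    refine (ih (fun y hy => hl y (List.mem_cons_of_mem x hy)) hb1 aE aB).mono le_rfl ?_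
    rintro s2 - ⟨cB, c0, cle, cA⟩
    refine ⟨cB, fun _ => c0 (.inl a0), fun h => (cle a0).trans (ale h), fun y hy A hA hAc => ?_⟩
    rcases List.mem_cons.1 hy with rfl | hy
    · exact (aA A hA hAc).mono (cle a0)
    · exact cA y hy A hA hAc

end

/-! ### Comparing with an arbitrary ordering -/

section

variable {n : ℕ} {W : ℕ → ℕ → ℕ} {r : ℕ → ℕ}

theorem outWeight_mono (v : ℕ) {F G : Finset ℕ} (h : F ⊆ G) : outWeight W v F ≤ outWeight W v G :=
  sum_le_sum_of_subset h

/-- Since `A` is an initial segment of `r`, all arcs into `A` from outside are backward for `r` too,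
and within blocks the order is that of `r`. Only arcs from the last block to `T` can be new, and
they form the cut. -/
theorem blockWeight_le {a : ℕ} {A T : Finset ℕ} (hA : A = (range n).filter fun v => r v < a)
    (hT : T ⊆ range n \ A) :
    blockWeight W n r A T ≤ inversionWeight W r (range n) + cutWeight W (range n \ A) T := by
  have hAn : A ⊆ range n := hA ▸ filter_subset _ _
  have hAT : Disjoint A T := disjoint_of_subset_right hT disjoint_sdiff
  have hafter : ∀ v ∈ range n \ A, ∀ X ⊆ range n \ A,
      outWeight W v A + outWeight W v (X.filter fun u => r u < r v) ≤
        outWeight W v ((range n).filter fun u => r u < r v) := by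
    intro v hv X hX
    have hva : a ≤ r v := by
      by_contra hlt
      rw [hA] at hv
      simp at hv
      omega
    rw [← outWeight_union v (disjoint_of_subset_right ((filter_subset _ X).trans hX) disjoint_sdiff)]
    refine outWeight_mono v (union_subset (fun u hu => ?_)
      (filter_subset_filter _ (hX.trans sdiff_subset)))
    rw [hA] at hu
    have := mem_filter.1 hu
    exact mem_filter.2 ⟨this.1, by omega⟩
  have e : inversionWeight W r (range n) =
      ∑ v ∈ A, outWeight W v ((range n).filter fun u => r u < r v) +
      (∑ v ∈ T, outWeight W v ((range n).filter fun u => r u < r v) +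
      ∑ v ∈ (range n \ A) \ T, outWeight W v ((range n).filter fun u => r u < r v)) := by
    rw [inversionWeight, ← sum_sdiff hAn, ← sum_sdiff hT]
    ring
  have e2 : ∑ v ∈ (range n \ A) \ T, outWeight W v (A ∪ T) =
      ∑ v ∈ (range n \ A) \ T, outWeight W v A + cutWeight W (range n \ A) T := by
    rw [cutWeight, ← sum_add_distrib]
    exact sum_congr rfl fun v _ => outWeight_union v hAT
  have h1 : inversionWeight W r A ≤
      ∑ v ∈ A, outWeight W v ((range n).filter fun u => r u < r v) :=
    sum_le_sum fun v _ => outWeight_mono v (filter_subset_filter _ hAn)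
  have h2 : ∑ v ∈ T, outWeight W v A + inversionWeight W r T ≤
      ∑ v ∈ T, outWeight W v ((range n).filter fun u => r u < r v) := by
    rw [inversionWeight, ← sum_add_distrib]
    exact sum_le_sum fun v hv => hafter v (hT hv) T hT
  have h3 : ∑ v ∈ (range n \ A) \ T, outWeight W v A + inversionWeight W r ((range n \ A) \ T) ≤
      ∑ v ∈ (range n \ A) \ T, outWeight W v ((range n).filter fun u => r u < r v) := by
    rw [inversionWeight, ← sum_add_distrib]
    exact sum_le_sum fun v hv => hafter v (sdiff_subset hv) _ sdiff_subset
  rw [blockWeight, e, e2]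
  omega

/-- The weight of the backward arcs whose head is among the first `a` vertices. -/
def headWeight (W : ℕ → ℕ → ℕ) (n : ℕ) (r : ℕ → ℕ) (a : ℕ) : ℕ :=
  ∑ v ∈ range n, outWeight W v ((range n).filter fun u => r u < a ∧ r u < r v)

theorem headWeight_le (a : ℕ) : headWeight W n r a ≤ inversionWeight W r (range n) :=
  sum_le_sum fun v _ => outWeight_mono v fun u hu => by
    have := mem_filter.1 hu
    exact mem_filter.2 ⟨this.1, this.2.2⟩

/-- Vertices neither among the first `a` nor in the band `[a, a')` come after the band. So the arcs
of this cut are backward, with heads that `headWeight` counts for `a'` but not for `a`. -/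
theorem cutWeight_add_headWeight_le {a a' : ℕ} (h : a ≤ a') :
    cutWeight W (range n \ (range n).filter fun v => r v < a)
      ((range n).filter fun v => a ≤ r v ∧ r v < a') + headWeight W n r a ≤
        headWeight W n r a' := by
  set I := (range n).filter fun v => a ≤ r v ∧ r v < a' with hI
  have h1 : cutWeight W (range n \ (range n).filter fun v => r v < a) I ≤
      ∑ v ∈ range n, outWeight W v (I.filter fun u => r u < r v) := by
    rw [cutWeight]
    refine (sum_le_sum fun v hv => ?_).trans (sum_le_sum_of_subset
      (sdiff_subset.trans sdiff_subset))
    refine outWeight_mono v fun u hu => mem_filter.2 ⟨hu, ?_⟩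
    have hu' := (mem_filter.1 hu).2
    simp [hI] at hv
    by_contra hcon
    have := hv.2 hv.1.1 (hv.1.2 hv.1.1)
    omega
  refine (Nat.add_le_add_right h1 _).trans ?_
  rw [headWeight, headWeight, ← sum_add_distrib]
  refine sum_le_sum fun v _ => ?_
  rw [← outWeight_union]
  · refine outWeight_mono v fun u hu => ?_
    simp only [hI, mem_union, mem_filter] at hu ⊢
    refine ⟨?_, ?_⟩
    · tauto
    · omega
  · rw [disjoint_left]
    intro u hu hu'
    simp only [hI, mem_filter] at hu hu'
    omega

theorem card_filter_rank_lt (hr : IsOrdering n r) {a : ℕ} (ha : a ≤ n) :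
    ((range n).filter fun v => r v < a).card = a := by
  have himg : (range n).image r = range n :=
    eq_of_subset_of_card_le (fun x hx => by
      obtain ⟨v, hv, rfl⟩ := mem_image.1 hx
      exact mem_range.2 (hr.lt v (mem_range.1 hv)))
      (by rw [card_image_of_injOn hr.inj])
  have : ((range n).filter fun v => r v < a).image r = range a := by
    ext x
    simp only [mem_image, mem_filter, mem_range]
    constructor
    · rintro ⟨v, ⟨-, h⟩, rfl⟩; exact h
    · intro hx
      have : x ∈ (range n).image r := by rw [himg]; exact mem_range.2 (by omega)
      obtain ⟨v, hv, rfl⟩ := mem_image.1 this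
      exact ⟨v, ⟨mem_range.1 hv, hx⟩, rfl⟩
  rw [← card_image_of_injOn (hr.inj.mono (coe_subset.2 (filter_subset _ _))), this, card_range]

theorem card_filter_rank_band (hr : IsOrdering n r) {a a' : ℕ} (h : a ≤ a') (ha : a' ≤ n) :
    ((range n).filter fun v => a ≤ r v ∧ r v < a').card = a' - a := by
  have : (range n).filter (fun v => a ≤ r v ∧ r v < a') =
      (range n).filter (fun v => r v < a') \ (range n).filter fun v => r v < a := by
    ext v; simp only [mem_filter, mem_sdiff]; constructor
    · rintro ⟨h1, h2, h3⟩; exact ⟨⟨h1, h3⟩, fun h => by omega⟩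
    · rintro ⟨⟨h1, h2⟩, h3⟩; exact ⟨h1, not_lt.1 fun h => h3 ⟨h1, h⟩, h2⟩
  rw [this, card_sdiff_of_subset, card_filter_rank_lt hr ha, card_filter_rank_lt hr (h.trans ha)]
  exact fun v hv => mem_filter.2 ⟨(mem_filter.1 hv).1, by have := (mem_filter.1 hv).2; omega⟩

/-- If `c` beats the candidates at all scales `a 0 ≤ a 1 ≤ … ≤ a k`, then `c - 1` exceeds the
weight of every ordering by a factor of at most `1 + 1 / k`. -/
theorem mul_le_of_beats {k c : ℕ} {a : ℕ → ℕ} (ha : ∀ j < k, a j ≤ a (j + 1))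
    (han : ∀ j ≤ k, a j ≤ n)
    (hc : ∀ j < k, ∀ A ⊆ range n, A.card ≤ a j → Beats n W (a (j + 1) - a j) A (c + 1))
    (hr : IsOrdering n r) :
    k * c ≤ (k + 1) * inversionWeight W r (range n) := by
  -- Take the true prefix of `r` for `A`: the excess of `c` over the weight of `r` is at most the
  -- minimum cut, and the band of `r` bounds that cut.
  have hstep : ∀ j < k, c + headWeight W n r (a j) ≤
      inversionWeight W r (range n) + headWeight W n r (a (j + 1)) := by
    intro j hj
    set A := (range n).filter fun v => r v < a j with hA
    obtain ⟨T, hT, hle⟩ := hc j hj A (filter_subset _ _)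
      (card_filter_rank_lt hr (han j hj.le)).le
    have h1 := hle r hr.inj
    have h2 := blockWeight_le (W := W) (r := r) hA hT.subset
    have h3 := hT.le ((range n).filter fun v => a j ≤ r v ∧ r v < a (j + 1)) (by
      intro v hv
      have := mem_filter.1 hv
      simp only [hA, mem_sdiff, mem_filter]
      exact ⟨this.1, fun h => by omega⟩) (card_filter_rank_band hr (ha j hj) (han _ hj))
    have h4 := cutWeight_add_headWeight_le (W := W) (n := n) (r := r) (ha j hj)
    rw [← hA] at h4
    omega
  -- The head weights telescope, and the last one is at most the weight of `r`.
  have hsum : ∀ j ≤ k, j * c + headWeight W n r (a 0) ≤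
      j * inversionWeight W r (range n) + headWeight W n r (a j) := by
    intro j
    induction j with
    | zero => simp
    | succ j ih =>
      intro hj
      have h1 := ih (by omega)
      have h2 := hstep j (by omega)
      rw [add_mul, add_mul]
      omega
  have h1 := hsum k le_rfl
  have h2 := headWeight_le (W := W) (n := n) (r := r) (a k)
  rw [add_mul]
  omega

end

/-! ### Graphs as machine inputs -/

namespace WeightedDigraph

variable {n : ℕ} (G : WeightedDigraph n)

/-- The weight matrix of a graph, with entries `0` for the pairs that are not arcs. -/
def weightMatrix (u v : ℕ) : ℕ :=
  if h : u < n ∧ v < n then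
    if (⟨⟨u, h.1⟩, ⟨v, h.2⟩⟩ : Fin n × Fin n) ∈ G.arcs then G.weight ⟨⟨u, h.1⟩, ⟨v, h.2⟩⟩ else 0
  else 0

theorem weightMatrix_fin (u v : Fin n) :
    G.weightMatrix u v = if (u, v) ∈ G.arcs then G.weight (u, v) else 0 := by
  simp [weightMatrix]

theorem weightMatrix_le (u v : ℕ) : G.weightMatrix u v ≤ G.maxWeight := by
  rw [weightMatrix]
  split_ifs with h h'
  · exact Finset.le_sup (f := G.weight) h'
  all_goals exact Nat.zero_le _

theorem inputState_mem_one {u v : ℕ} (hu : u < n) (hv : v < n) :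
    G.inputState.mem 1 (u * n + v) = G.weightMatrix u v := by
  have hlt : u * n + v < n * n := by nlinarith
  have he : finProdFinEquiv.symm (⟨u * n + v, hlt⟩ : Fin (n * n)) = (⟨u, hu⟩, ⟨v, hv⟩) := by
    rw [Equiv.symm_apply_eq]
    ext
    simp [finProdFinEquiv]
    ring
  simp only [inputState, hlt, he, weightMatrix, hu, hv]
  simp

theorem bdd_inputState {Z : ℕ} (hn : n < 2 ^ Z) (hw : G.maxWeight < 2 ^ Z) (hZ : 1 < 2 ^ Z) :
    Bdd Z G.inputState := by
  constructor
  · intro r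
    simp only [inputState]
    split_ifs <;> omega
  · intro a i
    simp only [inputState]
    split_ifs with h1 h2 h3 h4
    · exact hZ
    · exact lt_of_le_of_lt (Finset.le_sup (f := G.weight) h2) hw
    all_goals positivity

theorem fasCost_eq {π : Equiv.Perm (Fin n)} {r : ℕ → ℕ} (h : ∀ v : Fin n, r v = π v) :
    G.fasCost π = inversionWeight G.weightMatrix r (range n) := by
  have hr : inversionWeight G.weightMatrix r (range n) =
      ∑ v : Fin n, ∑ u : Fin n, if π u < π v then G.weightMatrix v u else 0 := by
    rw [inversionWeight, sum_range]
    refine sum_congr rfl fun v _ => ?_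
    rw [outWeight, sum_filter, sum_range]
    refine sum_congr rfl fun u _ => ?_
    rw [h, h]
    rfl
  rw [hr, ← Fintype.sum_prod_type' (f := fun v u : Fin n => if π u < π v then
    G.weightMatrix v u else 0), ← sum_filter, fasCost, backwardArcs]
  rw [← sum_subset (s₁ := G.arcs.filter fun a => ¬π a.1 < π a.2)
    (s₂ := univ.filter fun a : Fin n × Fin n => π a.2 < π a.1)]
  · refine sum_congr rfl fun a ha => ?_
    rw [weightMatrix_fin, if_pos (mem_filter.1 ha).1]
  · intro a ha
    have ha' := mem_filter.1 ha
    -- Backward means not forward; equal positions would make the arc a loop.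
    refine mem_filter.2 ⟨mem_univ _, lt_of_le_of_ne (not_lt.1 ha'.2) fun e => ?_⟩
    have : a.2 = a.1 := π.injective e
    exact G.loopless a.1 (by rw [show (a.1, a.1) = a from Prod.ext rfl this.symm]; exact ha'.1)
  · intro a ha ha'
    have h1 := (mem_filter.1 ha).2
    rw [weightMatrix_fin, if_neg fun hmem => ha' (mem_filter.2 ⟨hmem, not_lt.2 h1.le⟩)]

theorem exists_rank (π : Equiv.Perm (Fin n)) :
    ∃ r : ℕ → ℕ, IsOrdering n r ∧ ∀ v : Fin n, r v = π v := by
  refine ⟨fun v => if h : v < n then π ⟨v, h⟩ else v, ⟨fun v hv => ?_, ?_⟩, fun v => by simp⟩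
  · simp [hv]
  · intro u hu v hv huv
    have hu' : u < n := by simpa using hu
    have hv' : v < n := by simpa using hv
    simp only [hu', hv', dif_pos] at huv
    simpa using π.injective (Fin.ext huv)

theorem exists_perm {pos : ℕ → ℕ} (h : IsOrdering n pos) :
    ∃ π : Equiv.Perm (Fin n), ∀ v : Fin n, pos v = π v := by
  have hinj : Function.Injective fun v : Fin n => (⟨pos v, h.lt v v.2⟩ : Fin n) := by
    intro u v huv
    exact Fin.ext (h.inj (by simp) (by simp) (Fin.mk.inj_iff.1 huv))
  exact ⟨Equiv.ofBijective _ (Finite.injective_iff_bijective.1 hinj), fun v => rfl⟩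

end WeightedDigraph

/-! ### Counting small sets -/

theorem smallSets_mono {n a a' : ℕ} (h : a ≤ a') : smallSets n a ≤ smallSets n a' :=
  card_le_card fun F hF => by
    have := mem_filter.1 hF
    exact mem_filter.2 ⟨this.1, this.2.trans h⟩

/-- Give each set `F` the weight `x ^ F.card`: all sets together weigh `(x + 1) ^ n`, and a set with
at most `a` elements weighs at least `x ^ a`. -/
theorem smallSets_mul_pow_le {x : ℝ} (h0 : 0 ≤ x) (h1 : x ≤ 1) (n a : ℕ) :
    smallSets n a * x ^ a ≤ (x + 1) ^ n := by
  have h := Finset.sum_pow_mul_eq_add_pow x 1 (range n)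
  rw [card_range] at h
  rw [← h, smallSets, ← nsmul_eq_mul, ← sum_const]
  refine (sum_le_sum fun F hF => ?_).trans
    (sum_le_sum_of_subset_of_nonneg (filter_subset _ _) fun F _ _ => by positivity)
  rw [one_pow, mul_one]
  exact pow_le_pow_of_le_one h0 h1 (mem_filter.1 hF).2

/-- Split `η = θ * θ`. A small `x` makes `x + 1 ≤ θ`, and a large `q` makes `x⁻¹ ≤ θ ^ q`, so the
loss of `x ^ (n / q)` costs no more than the other factor `θ ^ n`. -/
theorem exists_smallSets_le {η : ℝ} (hη : 1 < η) (N : ℕ) :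
    ∃ q, N ≤ q ∧ ∀ n, (smallSets n (n / q) : ℝ) ≤ η ^ n := by
  set θ := Real.sqrt η with hθ
  have hθ1 : 1 < θ := Real.lt_sqrt_of_sq_lt (by simpa using hη)
  have hθ2 : θ * θ = η := Real.mul_self_sqrt (by linarith)
  set x := min 1 (θ - 1) with hx
  have hx0 : 0 < x := lt_min one_pos (by linarith)
  have hx1 : x ≤ 1 := min_le_left _ _
  have hxθ : x + 1 ≤ θ := by have := min_le_right 1 (θ - 1); linarith
  obtain ⟨q, hq⟩ := pow_unbounded_of_one_lt x⁻¹ hθ1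
  refine ⟨max N q, le_max_left _ _, fun n => ?_⟩
  set Q := max N q with hQ
  have hxQ : 1 ≤ x * θ ^ Q := by
    have h1 : x⁻¹ ≤ θ ^ Q := hq.le.trans (pow_le_pow_right₀ hθ1.le (le_max_right _ _))
    calc (1 : ℝ) = x * x⁻¹ := (mul_inv_cancel₀ hx0.ne').symm
      _ ≤ x * θ ^ Q := mul_le_mul_of_nonneg_left h1 hx0.le
  have hpow : 1 ≤ x ^ (n / Q) * θ ^ n := by
    calc (1 : ℝ) ≤ (x * θ ^ Q) ^ (n / Q) := one_le_pow₀ hxQ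
      _ = x ^ (n / Q) * θ ^ (Q * (n / Q)) := by rw [mul_pow, pow_mul]
      _ ≤ x ^ (n / Q) * θ ^ n := by
        gcongr
        · exact hθ1.le
        · exact Nat.mul_div_le n Q
  calc (smallSets n (n / Q) : ℝ) ≤ smallSets n (n / Q) * (x ^ (n / Q) * θ ^ n) :=
        le_mul_of_one_le_right (Nat.cast_nonneg _) hpow
    _ = smallSets n (n / Q) * x ^ (n / Q) * θ ^ n := (mul_assoc _ _ _).symm
    _ ≤ (x + 1) ^ n * θ ^ n := by gcongr; exact smallSets_mul_pow_le hx0.le hx1 n _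
    _ ≤ θ ^ n * θ ^ n := by gcongr
    _ = η ^ n := by rw [← mul_pow, hθ2]

/-! ### The running time -/

/-- A sequence of denominators, each so large compared to the previous one that there are few sets
of the corresponding size. -/
theorem exists_denominators :
    ∃ q : ℕ → ℕ, (∀ i, 2 ≤ q i ∧ 2 * q i ≤ q (i + 1)) ∧
      (∀ i n, (smallSets n (n / q i) : ℝ) ≤ ((2 : ℝ) ^ (1 / 4 : ℝ)) ^ n) ∧
      ∀ i n, (smallSets n (n / q (i + 1)) : ℝ) ≤ ((2 : ℝ) ^ (1 / (4 * q i) : ℝ)) ^ n := by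
  have h2 : (1 : ℝ) < 2 ^ (1 / 4 : ℝ) := Real.one_lt_rpow (by norm_num) (by norm_num)
  obtain ⟨q₀, hq₀, hq₀'⟩ := exists_smallSets_le h2 2
  have hstep : ∀ q : ℕ, ∃ q', 2 * q ≤ q' ∧
      (0 < q → ∀ n, (smallSets n (n / q') : ℝ) ≤ ((2 : ℝ) ^ (1 / (4 * q) : ℝ)) ^ n) := by
    intro q
    by_cases hq : 0 < q
    · obtain ⟨q', h1, h2⟩ := exists_smallSets_le
        (Real.one_lt_rpow (x := 2) (by norm_num) (by positivity : (0 : ℝ) < 1 / (4 * q))) (2 * q)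
      exact ⟨q', h1, fun _ => h2⟩
    · exact ⟨2 * q, le_rfl, fun h => absurd h hq⟩
  choose f hf1 hf2 using hstep
  let q : ℕ → ℕ := fun i => Nat.rec q₀ (fun _ x => f x) i
  have hq : ∀ i, q₀ ≤ q i := by
    intro i
    induction i with
    | zero => exact le_rfl
    | succ i ih => exact ih.trans ((Nat.le_mul_of_pos_left _ two_pos).trans (hf1 (q i)))
  refine ⟨q, fun i => ⟨hq₀.trans (hq i), hf1 (q i)⟩, fun i n => ?_, fun i n => hf2 (q i)
    (lt_of_lt_of_le (by omega) (hq i)) n⟩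
  refine le_trans ?_ (hq₀' n)
  exact_mod_cast smallSets_mono (Nat.div_le_div_left (hq i) (by omega))

/-- The exponential terms are prefixes times cuts, at most 2^(n/4) · 2^(n/4), and prefixes times
dynamic programs, where the prefixes cost 2^(n/(4q)) and the reduced block size saves 2^(n/(2q)). -/
theorem stage_steps_le {n p q : ℕ} {ρ : ℝ} (hq : 2 ≤ q) (hpq : 2 * q ≤ p)
    (h1 : (smallSets n (n / p) : ℝ) ≤ ((2 : ℝ) ^ (1 / 4 : ℝ)) ^ n)
    (h2 : (smallSets n (n / q) : ℝ) ≤ ((2 : ℝ) ^ (1 / 4 : ℝ)) ^ n)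
    (h3 : (smallSets n (n / p) : ℝ) ≤ ((2 : ℝ) ^ (1 / (4 * q) : ℝ)) ^ n)
    (hρ : (2 : ℝ) ^ (1 - 1 / (4 * q) : ℝ) ≤ ρ) :
    ((smallSets n (n / p) * (smallSets n (n / q - n / p) * (5 * n * n + 17 * n + 12) +
      3 * (2 ^ (n - (n / q - n / p)) * (5 * n * n + 21 * n + 10)) + (39 * n + 58)) +
      (7 * n + 13) : ℕ) : ℝ) ≤ 1000 * (n + 1) ^ 2 * ρ ^ n := by
  have hqR : (2 : ℝ) ≤ q := by exact_mod_cast hq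
  have hq4 : (1 : ℝ) / (4 * q) ≤ 1 / 8 := by
    apply one_div_le_one_div_of_le <;> linarith
  have hρ0 : (2 : ℝ) ^ (1 / 2 : ℝ) ≤ ρ :=
    (Real.rpow_le_rpow_of_exponent_le (by norm_num) (by linarith)).trans hρ
  have hρ1 : 1 ≤ ρ := (Real.one_le_rpow (by norm_num) (by norm_num)).trans hρ0
  have e4 : (2 : ℝ) ^ (1 / 4 : ℝ) * 2 ^ (1 / 4 : ℝ) = 2 ^ (1 / 2 : ℝ) := by
    rw [← Real.rpow_add (by norm_num)]; norm_num
  set α : ℝ := (smallSets n (n / p) : ℝ) with hα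
  have hα0 : 0 ≤ α := Nat.cast_nonneg _
  have hαρ : α ≤ ρ ^ n := by
    refine h1.trans (pow_le_pow_left₀ (by positivity) (le_trans ?_ hρ0) n)
    exact Real.rpow_le_rpow_of_exponent_le (by norm_num) (by norm_num)
  have hαβ : α * smallSets n (n / q - n / p) ≤ ρ ^ n := by
    have hb : (smallSets n (n / q - n / p) : ℝ) ≤ ((2 : ℝ) ^ (1 / 4 : ℝ)) ^ n := by
      refine le_trans ?_ h2
      exact_mod_cast smallSets_mono (Nat.sub_le _ _)
    calc α * smallSets n (n / q - n / p) ≤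
          ((2 : ℝ) ^ (1 / 4 : ℝ)) ^ n * ((2 : ℝ) ^ (1 / 4 : ℝ)) ^ n := by gcongr
      _ = ((2 : ℝ) ^ (1 / 2 : ℝ)) ^ n := by rw [← mul_pow, e4]
      _ ≤ ρ ^ n := pow_le_pow_left₀ (by positivity) hρ0 n
  -- Rounding `n / q` down loses less than one, and `n / p` is at most half of the real quotient
  -- n/q.
  have hb : (n : ℝ) / (2 * q) - 1 ≤ (n / q - n / p : ℕ) := by
    have hle : n / p ≤ n / q := Nat.div_le_div_left (by omega) (by omega)
    have hq1 : (n : ℝ) / q < (n / q : ℕ) + 1 := by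
      rw [div_lt_iff₀ (by linarith)]
      have h5 : n < (n / q + 1) * q := by
        have h6 := Nat.div_add_mod n q
        have h7 := Nat.mod_lt n (by omega : q > 0)
        rw [add_mul, mul_comm (n / q)]
        omega
      exact_mod_cast h5
    have hp1 : ((n / p : ℕ) : ℝ) ≤ n / (2 * q) := by
      refine Nat.cast_div_le.trans ?_
      apply div_le_div_of_nonneg_left (by positivity) (by positivity)
      exact_mod_cast hpq
    have : (n : ℝ) / q = n / (2 * q) + n / (2 * q) := by field_simp; ring
    rw [Nat.cast_sub hle]
    linarith
  have hγ : α * (2 : ℝ) ^ (n - (n / q - n / p)) ≤ 2 * ρ ^ n := by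
    have hbn : n / q - n / p ≤ n := (Nat.sub_le _ _).trans (Nat.div_le_self _ _)
    have hpw : (2 : ℝ) ^ (n - (n / q - n / p)) ≤ 2 ^ (n - n / (2 * q) + 1 : ℝ) := by
      rw [← Real.rpow_natCast]
      apply Real.rpow_le_rpow_of_exponent_le (by norm_num)
      rw [Nat.cast_sub hbn]
      linarith
    calc α * (2 : ℝ) ^ (n - (n / q - n / p)) ≤
          ((2 : ℝ) ^ (1 / (4 * q) : ℝ)) ^ n * 2 ^ (n - n / (2 * q) + 1 : ℝ) := by gcongr
      -- Exponents: n/(4q) + n - n/(2q) + 1 = 1 + (1 - 1/(4q)) n.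
      _ = 2 * ((2 : ℝ) ^ (1 - 1 / (4 * q) : ℝ)) ^ n := by
        rw [← Real.rpow_natCast, ← Real.rpow_natCast, ← Real.rpow_mul (by norm_num),
          ← Real.rpow_mul (by norm_num), ← Real.rpow_add (by norm_num)]
        conv_rhs => rw [← Real.rpow_one_add' (by norm_num) (by
          have : (0 : ℝ) ≤ (1 - 1 / (4 * q)) * n := mul_nonneg (by linarith) (by positivity)
          linarith)]
        congr 1
        field_simp
        ring
      _ ≤ 2 * ρ ^ n := by gcongr
  have hρn : 1 ≤ ρ ^ n := one_le_pow₀ hρ1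
  have hn : (0 : ℝ) ≤ n := Nat.cast_nonneg n
  push_cast
  rw [← hα]
  calc α * (smallSets n (n / q - n / p) * (5 * n * n + 17 * n + 12) +
        3 * (2 ^ (n - (n / q - n / p)) * (5 * n * n + 21 * n + 10)) + (39 * n + 58)) + (7 * n + 13)
      = (α * smallSets n (n / q - n / p)) * (5 * n * n + 17 * n + 12) +
        (α * 2 ^ (n - (n / q - n / p))) * (3 * (5 * n * n + 21 * n + 10)) +
        α * (39 * n + 58) + 1 * (7 * n + 13) := by ring
    _ ≤ ρ ^ n * (5 * n * n + 17 * n + 12) + (2 * ρ ^ n) * (3 * (5 * n * n + 21 * n + 10)) +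
        ρ ^ n * (39 * n + 58) + ρ ^ n * (7 * n + 13) := by gcongr
    _ = (35 * n ^ 2 + 189 * n + 143) * ρ ^ n := by ring
    _ ≤ 1000 * (n + 1) ^ 2 * ρ ^ n := by
      gcongr
      nlinarith

/-- For `θ` strictly between `ρ / σ` and 1, the sequence `n ^ k * θ ^ n` is bounded. It is used at
`n + 1`, which costs a factor `θ`. -/
theorem exists_poly_mul_pow_le {ρ σ : ℝ} (h0 : 0 ≤ ρ) (h : ρ < σ) (k : ℕ) :
    ∃ C, 0 ≤ C ∧ ∀ n : ℕ, (n + 1 : ℝ) ^ k * ρ ^ n ≤ C * σ ^ n := by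
  have hσ : 0 < σ := lt_of_le_of_lt h0 h
  have hmid : ρ / σ < (ρ / σ + 1) / 2 := by
    have : ρ / σ < 1 := (div_lt_one hσ).2 h
    linarith
  set θ := (ρ / σ + 1) / 2 with hθ
  have hθ0 : 0 < θ := lt_of_le_of_lt (by positivity) hmid
  have hθ1 : θ < 1 := by
    have : ρ / σ < 1 := (div_lt_one hσ).2 h
    rw [hθ]; linarith
  obtain ⟨B, hB⟩ := (tendsto_pow_const_mul_const_pow_of_abs_lt_one k
    (by rw [abs_of_pos hθ0]; exact hθ1)).bddAbove_range
  have hB' : ∀ n : ℕ, (n : ℝ) ^ k * θ ^ n ≤ B := fun n => hB ⟨n, rfl⟩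
  refine ⟨max 0 (B / θ), le_max_left _ _, fun n => ?_⟩
  have h1 := hB' (n + 1)
  push_cast at h1
  have h2 : (n + 1 : ℝ) ^ k * θ ^ n ≤ B / θ := by
    rw [le_div_iff₀ hθ0, mul_assoc, ← pow_succ]
    exact h1
  have h3 : ρ ^ n ≤ θ ^ n * σ ^ n := by
    rw [← mul_pow]
    exact pow_le_pow_left₀ h0 ((div_le_iff₀ hσ).1 hmid.le) n
  calc (n + 1 : ℝ) ^ k * ρ ^ n ≤ (n + 1 : ℝ) ^ k * (θ ^ n * σ ^ n) := by gcongr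
    _ = (n + 1 : ℝ) ^ k * θ ^ n * σ ^ n := by ring
    _ ≤ max 0 (B / θ) * σ ^ n := by gcongr; exact h2.trans (le_max_right _ _)

/-- For `w > 0` the bit length is at most `Real.logb 2 w + 1`; for `w = 0` it is 0. -/
theorem size_le_two_mul_logb (w : ℕ) : (w.size : ℝ) ≤ 2 * max 1 (Real.logb 2 w) := by
  rcases Nat.eq_zero_or_pos w with rfl | hw
  · simp
  · have h1 : 2 ^ (w.size - 1) ≤ w := Nat.lt_size.1 (by have := Nat.size_pos.2 hw; omega)
    have h2 : ((w.size - 1 : ℕ) : ℝ) ≤ Real.logb 2 w := by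
      rw [Real.le_logb_iff_rpow_le (by norm_num) (by exact_mod_cast hw), Real.rpow_natCast]
      exact_mod_cast h1
    rw [Nat.cast_sub (Nat.size_pos.2 hw)] at h2
    have h3 := le_max_left 1 (Real.logb 2 w)
    have h4 := le_max_right 1 (Real.logb 2 w)
    push_cast at h2
    linarith

/-- With P = 2^n · 2^n · 2^`w.size`, the numbers to accommodate add up to at most 6P, and `2 ^ Z` is
8P. -/
theorem setup_of_size (n w c : ℕ) {W : ℕ → ℕ → ℕ} (hW : ∀ u v, W u v ≤ w) (hc : 100 ≤ c) :
    Setup n w (2 * n + w.size + 3) ((2 * n + w.size + 3 + 20) * c) W := by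
  refine ⟨hW, ?_, by rw [mul_comm]; exact Nat.mul_le_mul_left _ hc⟩
  have h1 : n < 2 ^ n := Nat.lt_two_pow_self
  have h2 : w < 2 ^ w.size := Nat.lt_size_self w
  have hp : (1 : ℕ) ≤ 2 ^ n := Nat.one_le_two_pow
  have hs : (1 : ℕ) ≤ 2 ^ w.size := Nat.one_le_two_pow
  have e : 2 ^ (2 * n + w.size + 3) = 8 * (2 ^ n * 2 ^ n * 2 ^ w.size) := by
    rw [pow_add, pow_add, two_mul, pow_add]; ring
  have a1 : n * n * w ≤ 2 ^ n * 2 ^ n * 2 ^ w.size := by gcongr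
  have a2 : n * n * 1 ≤ 2 ^ n * 2 ^ n * 2 ^ w.size := by gcongr
  have a3 : 2 ^ n * 1 * 1 ≤ 2 ^ n * 2 ^ n * 2 ^ w.size := by gcongr
  have a4 : 1 * 1 * 1 ≤ 2 ^ n * 2 ^ n * 2 ^ w.size := by gcongr
  rw [e, pow_succ]
  omega

/-! ### The approximation algorithm -/

/-- The approximation algorithm with `k` stages for a sequence of denominators. -/
def approximationProgram (q : ℕ → ℕ) (k : ℕ) : Program :=
  .seq prepare (stages ((List.range k).map fun j => (q (k - j), q (k - (j + 1)))))

/-- After all stages the ordering in memory 2 beats the candidates at every scale;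
`mul_le_of_beats`, applied to an optimal permutation, gives the ratio. As `k > 0`, some ordering has
been written. -/
theorem runs_approximationProgram {n Z K τ k : ℕ} {q : ℕ → ℕ} (hk : 0 < k)
    (hq : ∀ i, 2 ≤ q i ∧ 2 * q i ≤ q (i + 1)) (G : WeightedDigraph n)
    (S : Setup n G.maxWeight Z K G.weightMatrix)
    (hK : ∀ i ≤ k, (Z + 20) * ((q i).size + 10) ≤ K)
    (hτ : ∀ i < k, smallSets n (n / q (i + 1)) * (smallSets n (n / q i - n / q (i + 1)) *
        (5 * n * n + 17 * n + 12) + 3 * (2 ^ (n - (n / q i - n / q (i + 1))) *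
        (5 * n * n + 21 * n + 10)) + (39 * n + 58)) + (7 * n + 13) ≤ τ) :
    Runs Z K (approximationProgram q k) G.inputState ((6 * n + 5) + (k * τ + 1)) fun s =>
      ∃ π : Equiv.Perm (Fin n), WeightedDigraph.OutputIs s π ∧
        k * G.fasCost π ≤ (k + 1) * G.fasOpt := by
  have hw : G.maxWeight < 2 ^ Z := by
    rcases Nat.eq_zero_or_pos n with rfl | hn
    · have : G.maxWeight = 0 := by
        rw [WeightedDigraph.maxWeight, (Finset.sup_eq_bot_iff _ _).2 fun a _ => a.1.elim0]
        rfl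
      rw [this]; positivity
    · refine S.lt_of_le_weight ?_
      have : 1 * G.maxWeight ≤ n * n * G.maxWeight :=
        Nat.mul_le_mul_right _ (Nat.mul_pos hn hn)
      omega
  have hb := G.bdd_inputState S.n_lt hw (S.lt_of_le_weight (by omega))
  have hdiv : ∀ i, n / q (i + 1) ≤ n / q i := fun i =>
    Nat.div_le_div_left (by have := hq i; omega) (by have := hq i; omega)
  have hhalf : ∀ i, 2 * (n / q i) ≤ n := fun i =>
    (Nat.mul_le_mul_right _ (hq i).1).trans (Nat.mul_div_le n (q i))
  have hsucc : ∀ j < k, k - j = k - (j + 1) + 1 := fun j hj => by omega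
  refine Runs.seq (runs_prepare S hb (by simp [WeightedDigraph.inputState]) fun u hu v hv =>
    G.inputState_mem_one hu hv) ?_
  rintro s1 hb1 ⟨E1, h4⟩
  have h40 : s1.reg 4 = 0 := by rw [h4]; simp [WeightedDigraph.inputState]
  refine (runs_stages S (τ := τ) _ ?_ hb1 E1 fun h => absurd h40 h).mono
    (le_of_eq (by rw [List.length_map, List.length_range])) ?_
  · intro x hx
    obtain ⟨j, hj, rfl⟩ := List.mem_map.1 hx
    have hj' := List.mem_range.1 hj
    simp only [hsucc j hj']
    exact ⟨hK _ (by omega), hK _ (by omega), hdiv _, hhalf _, hτ _ (by omega)⟩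
  · rintro s2 - ⟨hB, h0, -, hA⟩
    have hne : s2.reg 4 ≠ 0 := h0 (.inr (by simp; omega))
    obtain ⟨hO, hcost⟩ := hB hne
    obtain ⟨π, hπ⟩ := WeightedDigraph.exists_perm hO
    obtain ⟨π₀, -, hπ₀⟩ := Finset.exists_mem_eq_inf'
      (Finset.univ_nonempty (α := Equiv.Perm (Fin n))) G.fasCost
    obtain ⟨r, hr, hrπ⟩ := WeightedDigraph.exists_rank π₀
    refine ⟨π, hπ, ?_⟩
    rw [WeightedDigraph.fasOpt, hπ₀, G.fasCost_eq hrπ, G.fasCost_eq hπ]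
    -- Denominators increase with their index, so scales that increase with `j` need the indices
    -- reversed.
    refine mul_le_of_beats (a := fun j => n / q (k - j)) (fun j hj => ?_) (fun j _ =>
      Nat.div_le_self _ _) (fun j hj A hAn hAc => ?_) hr
    · simp only [hsucc j hj]; exact hdiv _
    · rw [← hcost]
      exact hA _ (List.mem_map.2 ⟨j, List.mem_range.2 hj, rfl⟩) A hAn hAc

theorem mainTheorem2 (ε : ℝ) (hε : 0 < ε) :
    ∃ δ : ℝ, 0 < δ ∧ δ < 1 ∧
      ∃ (p : RAM.Program) (C : ℝ),
        ApproximatesWeightedFAS p (1 + ε)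
          (fun n w => C * ((2 - δ) ^ n * max 1 (Real.logb 2 (w : ℝ)))) := by
  obtain ⟨q, hq, hq4, hqs⟩ := exists_denominators
  obtain ⟨k, hk⟩ := exists_nat_gt (1 / ε)
  have hkR : (0 : ℝ) < k := lt_trans (by positivity) hk
  have hk0 : 0 < k := by exact_mod_cast hkR
  have hmono : Monotone q := monotone_nat_of_le_succ fun i => by have := hq i; omega
  -- The base of the slowest stage allowed for: all stages have `i < k`, and `q i ≤ q k`.
  set ρ : ℝ := 2 ^ (1 - 1 / (4 * q k) : ℝ) with hρ
  have hqpos : ∀ i, (2 : ℝ) ≤ q i := fun i => by exact_mod_cast (hq i).1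
  have hρ2 : ρ < 2 := by
    have hpos : (0 : ℝ) < 1 / (4 * q k) := by have := hqpos k; positivity
    calc ρ < 2 ^ (1 : ℝ) := Real.rpow_lt_rpow_of_exponent_lt (by norm_num) (by linarith)
      _ = 2 := Real.rpow_one 2
  have hρ1 : 1 ≤ ρ := by
    refine Real.one_le_rpow (by norm_num) ?_
    have : (1 : ℝ) / (4 * q k) ≤ 1 := by
      rw [div_le_one (by have := hqpos k; positivity)]
      have := hqpos k
      linarith
    linarith
  -- Makes `2 - δ` the midpoint of `ρ` and 2, leaving a gap for the polynomial factor.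
  set δ : ℝ := (2 - ρ) / 2 with hδ
  have hρδ : ρ < 2 - δ := by rw [hδ]; linarith
  obtain ⟨C, hC0, hC⟩ := exists_poly_mul_pow_le (by linarith : (0 : ℝ) ≤ ρ) hρδ 3
  -- Covers ordinary steps and the divisions by all the denominators in use.
  set c := 100 + (q k).size with hc
  refine ⟨δ, by rw [hδ]; linarith, by rw [hδ]; linarith, approximationProgram q k,
    (6 + 1000 * k) * (25 * c) * C, fun n G => ?_⟩
  set w := G.maxWeight with hw
  have S := setup_of_size n w c G.weightMatrix_le (Nat.le_add_right 100 _)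
  set τ := ⌊1000 * (n + 1 : ℝ) ^ 2 * ρ ^ n⌋₊ with hτ
  obtain ⟨s, t, hex, ht, -, π, hout, hcost⟩ := runs_approximationProgram (τ := τ) hk0 hq G S
    (fun i hi => Nat.mul_le_mul_left _ (by
      have := Nat.size_le_size (hmono hi)
      omega))
    (fun i hi => Nat.le_floor (stage_steps_le (hq i).1 (hq i).2 (hq4 _ n) (hq4 _ n) (hqs i n) (by
      refine Real.rpow_le_rpow_of_exponent_le (by norm_num) ?_
      have h1 : (q i : ℝ) ≤ q k := by exact_mod_cast hmono hi.le
      have h2 := hqpos i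
      have : (1 : ℝ) / (4 * q k) ≤ 1 / (4 * q i) := by
        apply one_div_le_one_div_of_le <;> linarith
      linarith)))
  refine ⟨s, t, π, hex, hout, ?_, ?_⟩
  · have h1 : (k : ℝ) * G.fasCost π ≤ (k + 1) * G.fasOpt := by exact_mod_cast hcost
    -- This gives `k + 1 ≤ (1 + ε) * k`, the approximation ratio.
    have h2 : 1 ≤ ε * k := by
      rw [div_lt_iff₀ hε] at hk
      linarith
    have h3 : (0 : ℝ) ≤ G.fasOpt := Nat.cast_nonneg _
    refine le_of_mul_le_mul_left (h1.trans ?_) hkR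
    nlinarith
  · set m := max 1 (Real.logb 2 (w : ℝ)) with hm
    have hm1 : 1 ≤ m := le_max_left _ _
    have hsize := size_le_two_mul_logb w
    rw [← hm] at hsize
    have hτle : (τ : ℝ) ≤ 1000 * (n + 1 : ℝ) ^ 2 * ρ ^ n := Nat.floor_le (by positivity)
    have hρn : 1 ≤ ρ ^ n := one_le_pow₀ hρ1
    have hn : (0 : ℝ) ≤ n := Nat.cast_nonneg n
    have htR : (t : ℝ) ≤ ((6 * n + 5) + (k * τ + 1)) * ((2 * n + w.size + 3 + 20) * c) := by
      exact_mod_cast ht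
    have hsteps : (6 * n + 5 + (k * τ + 1) : ℝ) ≤ (6 + 1000 * k) * ((n + 1) ^ 2 * ρ ^ n) := by
      have h1 : (6 * n + 6 : ℝ) ≤ 6 * ((n + 1) ^ 2 * ρ ^ n) := by
        have : (n + 1 : ℝ) * 1 ≤ (n + 1) ^ 2 * ρ ^ n := by
          gcongr
          nlinarith
        linarith
      have h2 : (k : ℝ) * τ ≤ k * (1000 * (n + 1 : ℝ) ^ 2 * ρ ^ n) := by gcongr
      nlinarith
    -- The cost of a step contributes a third factor `n + 1` and the only logarithmic factor.
    have hunit : (2 * n + w.size + 3 + 20 : ℝ) ≤ 25 * ((n + 1) * m) := by nlinarith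
    calc (t : ℝ) ≤ ((6 * n + 5) + (k * τ + 1)) * ((2 * n + w.size + 3 + 20) * c) := htR
      _ ≤ ((6 + 1000 * k) * ((n + 1) ^ 2 * ρ ^ n)) * ((25 * ((n + 1) * m)) * c) := by gcongr
      _ = (6 + 1000 * k) * (25 * c) * m * ((n + 1) ^ 3 * ρ ^ n) := by ring
      _ ≤ (6 + 1000 * k) * (25 * c) * m * (C * (2 - δ) ^ n) := by
        exact mul_le_mul_of_nonneg_left (hC n) (by positivity)
      _ = (6 + 1000 * k) * (25 * c) * C * ((2 - δ) ^ n * m) := by ring
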